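/- **Definitions.** Let $\mathcal C$ be a monoidal category with tensor unit $I$. A *central idempotent* is an object $U$ with an (invertible) half-braiding $\sigma_A\colon U\otimes A\to A\otimes U$ (an object of the Drinfeld centre) and a morphism $u\colon U\to I$ such that, up to unitors, $u\otimes U=U\otimes u\colon U\otimes U\to U$ is invertible and $(A\otimes u)\circ\sigma_A=u\otimes A$ for all $A$. Put $u\le v$ when $u=v\circ m$ for some $m\colon U\to V$ respecting the half-braidings; identifying $u,v$ when such an $m$ is invertible (equivalently $u\le v\le u$) gives a partially ordered set $\mathrm{ZI}(\mathcal C)$, with meets $u\wedge v=u\otimes v$. $\mathcal C$ is *stiff* when for all $A$ and all central idempotents $u,v$ the square $$A\otimes U\otimes V\to A\otimes U,\quad A\otimes U\otimes V\to A\otimes V,\quad A\otimes U\to A,\quad A\otimes V\to A$$ is a pullback. $\mathcal C$ *has universal joins of central idempotents* when $\mathrm{ZI}(\mathcal C)$ has all joins and, for each family $S$ of central idempotents closed under binary meets with join $j\colon J\to I$ and each object $A$, the cocone $(A\otimes U\to A\otimes J)_{u\in S}$ is a colimit of the diagram of the $A\otimes U$, $u\in S$. A lax monoidal functor $F\colon\mathcal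 C\to\mathcal D$ *preserves central idempotents* when $I\to F(I)$ is invertible and, for each central idempotent $u$, all $F(A)\otimes F(U)\to F(A\otimes U)$ are invertible and $F(U)$ has a half-braiding that is compatible with the one of $U$ and makes $F(U)\to F(I)\cong I$ a central idempotent. It *preserves joins* when moreover the induced map $\mathrm{ZI}(\mathcal C)\to\mathrm{ZI}(\mathcal D)$ preserves all existing joins. $\mathbf{MonCat_s}$ consists of small stiff monoidal categories and lax monoidal functors preserving central idempotents; $\mathbf{MonCat_j}$ is its subcategory of those $\mathcal C$ that have universal joins of central idempotents and for which $\mathrm{ZI}(\mathcal C)$ is a spatial frame, with the functors that also preserve joins. For $\mathcal C$ stiff, the category $D[\mathcal C]$ has as objects pairs $\langle D,A\rangle$ of a down-closed set $D\subseteq\mathrm{ZI}(\mathcal C)$ and an object $A$ of $\mathcal C$. A morphism $\langle D,A\rangle\to\langle E,B\rangle$ is a family of morphisms $\eta_u\colon A\otimes U\to B$, $u\in D$, with $\eta_u=\eta_{u'}\circ(A\otimes m)$ whenever $u=u'\circ m$ witnesses $u\le u'$, and such that each $\eta_u$ factors through $B\otimes v\colon B\otimes V\to B$ for some $v\in E$.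 The identity is $(A\otimes u)_{u}$; the composite with $\zeta\colon\langle E,B\rangle\to\langle G,C\rangle$ has components $\zeta_v\circ\tilde\eta$, where $\eta_u=(B\otimes v)\circ\tilde\eta$ with $v\in E$. The tensor product is $\langle D\cap E,A\otimes B\rangle$ with unit $\langle\mathrm{ZI}(\mathcal C),I\rangle$, and $(\eta\otimes\zeta)_u$ is obtained by duplicating $U$ (via $U\cong U\otimes U$), moving one copy to its place with the inverse half-braiding, and applying $\eta_u\otimes\zeta_u$. The embedding $\mathcal C\to D[\mathcal C]$ sends $A$ to $\langle\mathrm{ZI}(\mathcal C),A\rangle$ and $f\colon A\to B$ to $(f\otimes u)_u$, with identity coherence morphisms. **Theorem.** Let $\mathcal C$ be a small stiff monoidal category. Then $D[\mathcal C]$ is an object of $\mathbf{MonCat_j}$ and the embedding $E\colon\mathcal C\to D[\mathcal C]$ is a lax monoidal functor that preserves central idempotents. Let $\mathcal D$ be a stiff monoidal category with universal joins of central idempotents. 1. For every lax monoidal functor $F\colon\mathcal C\to\mathcal D$ preserving central idempotents there is a lax monoidal functor $\widehat F\colon D[\mathcal C]\to\mathcal D$ preserving central idempotents and their joins with $\widehat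 F\circ E=F$. 2. It is unique up to unique monoidal natural isomorphism: if $G_1,G_2\colon D[\mathcal C]\to\mathcal D$ are lax monoidal functors preserving central idempotents and their joins, then every monoidal natural isomorphism $\gamma\colon G_1\circ E\cong G_2\circ E$ is the restriction along $E$ of exactly one monoidal natural isomorphism $G_1\cong G_2$. Consequently, when functors are identified if they are monoidally naturally isomorphic, $\mathcal C\mapsto D[\mathcal C]$ is the object part of a left adjoint to the forgetful functor $\mathbf{MonCat_j}\to\mathbf{MonCat_s}$, with the (class of the) embedding $\mathcal C\to D[\mathcal C]$ as unit. -/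

import Mathlib

open CategoryTheory MonoidalCategory

universe w v u

namespace CentralIdem

section Basic

variable {C : Type u} [Category.{v} C] [MonoidalCategory C]

/-- The conditions on a morphism `e : U ⟶ I` and a half-braiding `σ` on `U` that make them into a
central idempotent. -/
structure IsCentralIdempotent {U : C} (σ : HalfBraiding U) (e : U ⟶ 𝟙_ C) : Prop where
  isIso : IsIso (e ▷ U ≫ (λ_ U).hom)
  central : e ▷ U ≫ (λ_ U).hom = U ◁ e ≫ (ρ_ U).hom
  braid : ∀ A : C, (σ.β A).hom ≫ A ◁ e ≫ (ρ_ A).hom = e ▷ A ≫ (λ_ A).hom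

variable (C) in
/-- A (representative of a) central idempotent. -/
structure CentralIdempotent where
  obj : C
  σ : HalfBraiding obj
  counit : obj ⟶ 𝟙_ C
  isCentral : IsCentralIdempotent σ counit

/-- The morphism `A ⊗ u : A ⊗ U ⟶ A`. -/
def proj (A : C) (u : CentralIdempotent C) : A ⊗ u.obj ⟶ A :=
  A ◁ u.counit ≫ (ρ_ A).hom

namespace CentralIdempotent

/-- Morphisms `m : U ⟶ V` with `u = v ∘ m` that respect the half-braidings. -/
@[ext]
structure Hom (u v : CentralIdempotent C) where
  f : u.obj ⟶ v.obj
  w : f ≫ v.counit = u.counit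
  comm : ∀ A : C, f ▷ A ≫ (v.σ.β A).hom = (u.σ.β A).hom ≫ A ◁ f

/-- The identity. -/
def Hom.id (u : CentralIdempotent C) : Hom u u := ⟨𝟙 _, by simp, by simp⟩

/-- Composition. -/
def Hom.comp {u v w : CentralIdempotent C} (m : Hom u v) (n : Hom v w) : Hom u w :=
  ⟨m.f ≫ n.f, by simp [m.w, n.w], fun A => by
    rw [comp_whiskerRight, Category.assoc, n.comm, ← Category.assoc, m.comm, Category.assoc,
      ← MonoidalCategory.whiskerLeft_comp]⟩

instance : Preorder (CentralIdempotent C) where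
  le u v := Nonempty (Hom u v)
  le_refl u := ⟨Hom.id u⟩
  le_trans _ _ _ := fun ⟨m⟩ ⟨n⟩ => ⟨m.comp n⟩

end CentralIdempotent

variable (C) in
/-- The partially ordered set of central idempotents. Representatives `u`, `v` are identified
when `u ≤ v ≤ u`; by `toZI_eq_iff` this means that `u = v ∘ m` for an isomorphism `m` respecting
the half-braidings. -/
abbrev ZI := Antisymmetrization (CentralIdempotent C) (· ≤ ·)

/-- The class of a central idempotent. -/
def toZI (u : CentralIdempotent C) : ZI C := toAntisymmetrization (· ≤ ·) u

theorem toZI_le_toZI {u v : CentralIdempotent C} : toZI u ≤ toZI v ↔ u ≤ v := Iff.rfl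

theorem proj_naturality {A B : C} (f : A ⟶ B) (u : CentralIdempotent C) :
    f ▷ u.obj ≫ proj B u = proj A u ≫ f := by
  simp only [proj, Category.assoc, ← rightUnitor_naturality]
  rw [whisker_exchange_assoc]

theorem proj_naturality_assoc {A B : C} (f : A ⟶ B) (u : CentralIdempotent C) {Z : C} (h : B ⟶ Z) :
    f ▷ u.obj ≫ proj B u ≫ h = proj A u ≫ f ≫ h := by
  simp only [← Category.assoc, proj_naturality]

theorem whiskerLeft_hom_proj (A : C) {u v : CentralIdempotent C} (m : u.Hom v) :
    A ◁ m.f ≫ proj A v = proj A u := by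
  simp [proj, ← m.w]

theorem whiskerLeft_hom_proj_assoc (A : C) {u v : CentralIdempotent C} (m : u.Hom v) {Z : C} (h : A ⟶ Z) :
    A ◁ m.f ≫ proj A v ≫ h = proj A u ≫ h := by
  simp only [← Category.assoc, whiskerLeft_hom_proj]

theorem proj_tensor (A B : C) (u : CentralIdempotent C) :
    proj (A ⊗ B) u = (α_ A B u.obj).hom ≫ A ◁ proj B u := by
  simp [proj]

theorem proj_whiskerRight (A : C) (u : CentralIdempotent C) :
    proj A u ▷ u.obj = proj (A ⊗ u.obj) u := by
  have h := u.isCentral.central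
  rw [proj_tensor]
  simp only [proj, ← h]
  simp

instance (A : C) (u : CentralIdempotent C) : IsIso (proj (A ⊗ u.obj) u) := by
  have h := u.isCentral.central
  have := u.isCentral.isIso
  rw [proj_tensor]
  unfold proj
  rw [← h]
  infer_instance

/-- Comultiplication `A ⊗ U ⟶ A ⊗ U ⊗ U`. -/
noncomputable def copy (A : C) (u : CentralIdempotent C) : A ⊗ u.obj ⟶ (A ⊗ u.obj) ⊗ u.obj :=
  inv (proj (A ⊗ u.obj) u)

@[simp]
theorem copy_proj (A : C) (u : CentralIdempotent C) :
    copy A u ≫ proj (A ⊗ u.obj) u = 𝟙 _ := by simp [copy]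

@[simp]
theorem copy_proj_assoc (A : C) (u : CentralIdempotent C) {Z : C} (h : A ⊗ u.obj ⟶ Z) :
    copy A u ≫ proj (A ⊗ u.obj) u ≫ h = h := by
  simp only [← Category.assoc, copy_proj, Category.id_comp]

@[simp]
theorem copy_proj' (A : C) (u : CentralIdempotent C) :
    copy A u ≫ proj A u ▷ u.obj = 𝟙 _ := by simp [copy, proj_whiskerRight]

@[simp]
theorem copy_proj'_assoc (A : C) (u : CentralIdempotent C) {Z : C} (h : A ⊗ u.obj ⟶ Z) :
    copy A u ≫ proj A u ▷ u.obj ≫ h = h := by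
  simp only [← Category.assoc, copy_proj', Category.id_comp]

theorem cancel_proj {Z A : C} (v : CentralIdempotent C) [Epi (proj Z v)] {f g : Z ⟶ A ⊗ v.obj}
    (h : f ≫ proj A v = g ≫ proj A v) : f = g := by
  rw [← cancel_epi (proj Z v), ← proj_naturality, ← proj_naturality, ← proj_whiskerRight,
    ← comp_whiskerRight, ← comp_whiskerRight, h]

theorem cancel_counit {Z : C} (v : CentralIdempotent C) [Epi (proj Z v)] {f g : Z ⟶ v.obj}
    (h : f ≫ v.counit = g ≫ v.counit) : f = g := by
  have : f ≫ (λ_ _).inv = g ≫ (λ_ _).inv := by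
    apply cancel_proj v
    simp only [proj, Category.assoc, ← leftUnitor_inv_naturality_assoc, reassoc_of% h]
  simpa using this =≫ (λ_ _).hom

theorem isIso_proj_of_iso {Z Z' : C} (e : Z ≅ Z') (v : CentralIdempotent C) [IsIso (proj Z' v)] :
    IsIso (proj Z v) := by
  have : proj Z v = e.hom ▷ v.obj ≫ proj Z' v ≫ e.inv := by
    rw [proj_naturality_assoc]; simp
  rw [this]; infer_instance

theorem isIso_proj_tensor_left (A Z : C) (v : CentralIdempotent C) [IsIso (proj Z v)] :
    IsIso (proj (A ⊗ Z) v) := by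
  rw [proj_tensor]; infer_instance

theorem isIso_proj_obj_tensor (A : C) (v : CentralIdempotent C) :
    IsIso (proj (v.obj ⊗ A) v) := isIso_proj_of_iso (v.σ.β A) v

theorem epi_proj_of_hom (A : C) {u v : CentralIdempotent C} (f : u.obj ⟶ v.obj)
    (w : f ≫ v.counit = u.counit) : Epi (proj (A ⊗ u.obj) v) := by
  have h : (A ⊗ u.obj) ◁ f ≫ proj (A ⊗ u.obj) v = proj (A ⊗ u.obj) u := by
    simp [proj, ← w]
  have : Epi ((A ⊗ u.obj) ◁ f ≫ proj (A ⊗ u.obj) v) := by rw [h]; infer_instance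
  exact epi_of_epi ((A ⊗ u.obj) ◁ f) _

theorem epi_proj_of_iso {Z Z' : C} (e : Z ≅ Z') (v : CentralIdempotent C) [Epi (proj Z' v)] :
    Epi (proj Z v) := by
  have : proj Z v = e.hom ▷ v.obj ≫ proj Z' v ≫ e.inv := by
    rw [proj_naturality_assoc]; simp
  rw [this]; infer_instance

/-- A morphism over the tensor unit between central idempotents automatically respects the
half-braidings. -/
def CentralIdempotent.Hom.mk' {u v : CentralIdempotent C} (f : u.obj ⟶ v.obj)
    (w : f ≫ v.counit = u.counit) : u.Hom v :=
  ⟨f, w, fun A => by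
    have := epi_proj_of_hom A f w
    have := epi_proj_of_iso (u.σ.β A) v
    apply cancel_proj v
    have h1 := v.isCentral.braid A
    have h2 := u.isCentral.braid A
    simp only [proj, Category.assoc]
    rw [h1, ← comp_whiskerRight_assoc, w, ← h2, ← w]
    simp⟩

instance (u v : CentralIdempotent C) : Subsingleton (u.Hom v) := ⟨fun m n => by
  have := epi_proj_of_hom (𝟙_ C) m.f m.w
  have := epi_proj_of_iso (λ_ u.obj).symm v
  ext
  exact cancel_counit v (m.w.trans n.w.symm)⟩

theorem toZI_eq_iff {u v : CentralIdempotent C} :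
    toZI u = toZI v ↔ ∃ m : u.Hom v, IsIso m.f := by
  constructor
  · intro h
    obtain ⟨m⟩ : u ≤ v := toZI_le_toZI.1 h.le
    obtain ⟨n⟩ : v ≤ u := toZI_le_toZI.1 h.ge
    refine ⟨m, n.f, ?_, ?_⟩
    · exact congrArg CentralIdempotent.Hom.f (Subsingleton.elim (m.comp n) (.id u))
    · exact congrArg CentralIdempotent.Hom.f (Subsingleton.elim (n.comp m) (.id v))
  · rintro ⟨m, hm⟩
    apply le_antisymm
    · exact toZI_le_toZI.2 ⟨m⟩
    · exact toZI_le_toZI.2 ⟨.mk' (inv m.f) (by simp [← m.w])⟩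

/-- The half-braiding of a central idempotent is determined by the underlying morphism. -/
theorem halfBraiding_unique {U : C} {σ τ : HalfBraiding U} {e : U ⟶ 𝟙_ C}
    (hσ : IsCentralIdempotent σ e) (hτ : IsCentralIdempotent τ e) : σ = τ := by
  have key : ∀ A, (σ.β A).hom = (τ.β A).hom := fun A => by
    have := isIso_proj_obj_tensor A ⟨U, σ, e, hσ⟩
    exact cancel_proj ⟨U, σ, e, hσ⟩ ((hσ.braid A).trans (hτ.braid A).symm)
  cases σ; cases τ
  congr
  ext A
  exact key A

/-- A central idempotent as an object of the centre. -/
def CentralIdempotent.toCenter (u : CentralIdempotent C) : Center C := ⟨u.obj, u.σ⟩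

theorem tensor_β (u v : CentralIdempotent C) (A : C) :
    ((u.toCenter ⊗ v.toCenter).2.β A).hom =
      (α_ u.obj v.obj A).hom ≫ u.obj ◁ (v.σ.β A).hom ≫ (α_ u.obj A v.obj).inv ≫
        (u.σ.β A).hom ▷ v.obj ≫ (α_ A u.obj v.obj).hom := rfl

/-- The meet `u ∧ v`: the tensor product, with the tensor product half-braiding. -/
noncomputable def CentralIdempotent.inf (u v : CentralIdempotent C) : CentralIdempotent C where
  obj := u.obj ⊗ v.obj
  σ := (u.toCenter ⊗ v.toCenter).2
  counit := (u.counit ⊗ₘ v.counit) ≫ (λ_ _).hom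
  isCentral := by
    have hu := u.isCentral
    have hv := v.isCentral
    set w := (u.counit ⊗ₘ v.counit) ≫ (λ_ (𝟙_ C)).hom with hw
    have hpr : ∀ A : C, A ◁ w ≫ (ρ_ A).hom =
        (α_ A u.obj v.obj).inv ≫ proj (A ⊗ u.obj) v ≫ proj A u := by
      intro A
      simp only [proj, hw, tensorHom_def', unitors_equal]
      simp
    have hpr2 : w = proj u.obj v ≫ u.counit := by
      simp only [proj, hw, tensorHom_def', unitors_equal]
      simp
    have hpr3 : w = u.counit ▷ v.obj ≫ (λ_ _).hom ≫ v.counit := by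
      simp only [hw, MonoidalCategory.tensorHom_def]
      simp
    -- absorption
    have a1 : IsIso (proj (u.obj ⊗ v.obj) u) := isIso_proj_obj_tensor _ _
    have a2 : IsIso (proj ((u.obj ⊗ v.obj) ⊗ u.obj) v) := by
      have := isIso_proj_obj_tensor u.obj v
      have := isIso_proj_tensor_left u.obj (v.obj ⊗ u.obj) v
      exact isIso_proj_of_iso (α_ u.obj v.obj u.obj) v
    have a3 : IsIso (proj ((u.obj ⊗ v.obj) ⊗ (u.obj ⊗ v.obj)) v) :=
      isIso_proj_tensor_left (u.obj ⊗ v.obj) (u.obj ⊗ v.obj) v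
    have a4 : IsIso (proj ((u.obj ⊗ v.obj) ⊗ (u.obj ⊗ v.obj)) u) :=
      isIso_proj_tensor_left (u.obj ⊗ v.obj) (u.obj ⊗ v.obj) u
    have hc : w ▷ (u.obj ⊗ v.obj) ≫ (λ_ (u.obj ⊗ v.obj)).hom =
        (u.obj ⊗ v.obj) ◁ w ≫ (ρ_ (u.obj ⊗ v.obj)).hom := by
      apply cancel_proj v
      apply cancel_counit u
      simp only [Category.assoc, ← hpr2]
      rw [← leftUnitor_naturality, ← rightUnitor_naturality, whisker_exchange_assoc,
        unitors_equal]
    refine ⟨?_, hc, ?_⟩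
    · rw [hc, hpr]
      infer_instance
    · have key : ∀ A : C, ((α_ u.obj v.obj A).hom ≫ u.obj ◁ (v.σ.β A).hom ≫
          (α_ u.obj A v.obj).inv ≫ (u.σ.β A).hom ▷ v.obj ≫ (α_ A u.obj v.obj).hom) ≫
            A ◁ w ≫ (ρ_ A).hom = w ▷ A ≫ (λ_ A).hom := by
        intro A
        have h1 := hu.braid A
        have h2 := hv.braid A
        rw [hpr]
        simp only [Category.assoc, Iso.hom_inv_id_assoc]
        rw [proj_naturality_assoc]
        change _ ≫ _ ≫ _ ≫ _ ≫ (u.σ.β A).hom ≫ A ◁ u.counit ≫ (ρ_ A).hom = _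
        rw [h1, proj_tensor]
        simp only [Iso.inv_hom_id_assoc, Category.assoc]
        rw [← MonoidalCategory.whiskerLeft_comp_assoc]
        unfold proj
        rw [h2, hpr3]
        rw [whisker_exchange_assoc]
        simp
      exact key

theorem CentralIdempotent.inf_le_left (u v : CentralIdempotent C) : u.inf v ≤ u :=
  ⟨.mk' (proj u.obj v) (by
    simp only [proj, CentralIdempotent.inf, tensorHom_def', unitors_equal]; simp)⟩

theorem CentralIdempotent.inf_le_right (u v : CentralIdempotent C) : u.inf v ≤ v :=
  ⟨.mk' (u.counit ▷ v.obj ≫ (λ_ _).hom) (by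
    simp only [CentralIdempotent.inf, MonoidalCategory.tensorHom_def]; simp)⟩

/-- The morphism `f : Z ⟶ B` restricts to `v`: it factors through `B ⊗ v : B ⊗ V ⟶ B`. -/
def RestrictsTo {Z B : C} (f : Z ⟶ B) (v : CentralIdempotent C) : Prop :=
  ∃ g : Z ⟶ B ⊗ v.obj, g ≫ proj B v = f

variable (C) in
/-- Stiff monoidal categories. -/
class IsStiff : Prop where
  isPullback : ∀ (A : C) (u v : CentralIdempotent C),
    IsPullback (proj A u ▷ v.obj) (proj (A ⊗ u.obj) v) (proj A v) (proj A u)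

theorem RestrictsTo.mono {Z B : C} {f : Z ⟶ B} {u v : CentralIdempotent C}
    (h : RestrictsTo f u) (huv : u ≤ v) : RestrictsTo f v := by
  obtain ⟨g, rfl⟩ := h
  obtain ⟨m⟩ := huv
  exact ⟨g ≫ B ◁ m.f, by simp [whiskerLeft_hom_proj]⟩

theorem RestrictsTo.precomp {Z Z' B : C} {f : Z ⟶ B} {u : CentralIdempotent C}
    (h : RestrictsTo f u) (k : Z' ⟶ Z) : RestrictsTo (k ≫ f) u := by
  obtain ⟨g, rfl⟩ := h
  exact ⟨k ≫ g, by simp⟩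

theorem RestrictsTo.postcomp {Z B B' : C} {f : Z ⟶ B} {u : CentralIdempotent C}
    (h : RestrictsTo f u) (k : B ⟶ B') : RestrictsTo (f ≫ k) u := by
  obtain ⟨g, rfl⟩ := h
  exact ⟨g ≫ k ▷ u.obj, by simp [proj_naturality]⟩

theorem copy_comp {A B : C} (u : CentralIdempotent C) (f : A ⊗ u.obj ⟶ B) :
    (copy A u ≫ f ▷ u.obj) ≫ proj B u = f := by
  simp [proj_naturality]

theorem restrictsTo_self {A B : C} (u : CentralIdempotent C) (f : A ⊗ u.obj ⟶ B) :
    RestrictsTo f u := ⟨_, copy_comp u f⟩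

theorem RestrictsTo.whiskerLeft {Z B : C} {f : Z ⟶ B} {u : CentralIdempotent C}
    (h : RestrictsTo f u) (A : C) : RestrictsTo (A ◁ f) u := by
  obtain ⟨g, rfl⟩ := h
  exact ⟨A ◁ g ≫ (α_ _ _ _).inv, by simp [proj_tensor]⟩

/-- Moving `U` past `B`: the morphism `A ⊗ B ⊗ U ⟶ A ⊗ U ⊗ B`. -/
def swap (A B : C) (u : CentralIdempotent C) : (A ⊗ B) ⊗ u.obj ≅ (A ⊗ u.obj) ⊗ B :=
  α_ A B u.obj ≪≫ whiskerLeftIso A (u.σ.β B).symm ≪≫ (α_ A u.obj B).symm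

theorem swap_proj (A B : C) (u : CentralIdempotent C) :
    (swap A B u).hom ≫ proj A u ▷ B = proj (A ⊗ B) u := by
  have h := u.isCentral.braid B
  rw [← Iso.eq_inv_comp] at h
  rw [proj_tensor]
  simp only [swap, proj, Iso.trans_hom, whiskerLeftIso_hom, Iso.symm_hom, h, Category.assoc]
  simp

theorem swap_proj_assoc (A B : C) (u : CentralIdempotent C) {Z : C} (h : A ⊗ B ⟶ Z) :
    (swap A B u).hom ≫ proj A u ▷ B ≫ h = proj (A ⊗ B) u ≫ h := by
  simp only [← Category.assoc, swap_proj]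

theorem swap_inv_proj (A B : C) (u : CentralIdempotent C) :
    (swap A B u).inv ≫ proj (A ⊗ B) u = proj A u ▷ B := by
  rw [← swap_proj]; simp

theorem RestrictsTo.whiskerRight {Z B : C} {f : Z ⟶ B} {u : CentralIdempotent C}
    (h : RestrictsTo f u) (A : C) : RestrictsTo (f ▷ A) u := by
  obtain ⟨g, rfl⟩ := h
  exact ⟨g ▷ A ≫ (swap B A u).inv, by simp [swap_inv_proj]⟩

theorem swap_hom_naturality (A B : C) {u v : CentralIdempotent C} (m : u.Hom v) :
    (A ⊗ B) ◁ m.f ≫ (swap A B v).hom = (swap A B u).hom ≫ (A ◁ m.f) ▷ B := by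
  have h : B ◁ m.f ≫ (v.σ.β B).inv = (u.σ.β B).inv ≫ m.f ▷ B := by
    rw [Iso.comp_inv_eq, Category.assoc, m.comm, Iso.inv_hom_id_assoc]
  simp only [swap, Iso.trans_hom, whiskerLeftIso_hom, Iso.symm_hom, Category.assoc]
  rw [tensor_whiskerLeft]
  simp only [Category.assoc, Iso.inv_hom_id_assoc]
  rw [← MonoidalCategory.whiskerLeft_comp_assoc, h]
  simp

theorem swap_hom_naturality_assoc (A B : C) {u v : CentralIdempotent C} (m : u.Hom v) {Z : C}
    (h : (A ⊗ v.obj) ⊗ B ⟶ Z) :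
    (A ⊗ B) ◁ m.f ≫ (swap A B v).hom ≫ h = (swap A B u).hom ≫ (A ◁ m.f) ▷ B ≫ h := by
  simp only [← Category.assoc, swap_hom_naturality]

theorem swap_naturality_right (A : C) {B B' : C} (f : B ⟶ B') (u : CentralIdempotent C) :
    (A ◁ f) ▷ u.obj ≫ (swap A B' u).hom = (swap A B u).hom ≫ (A ⊗ u.obj) ◁ f := by
  have h : f ▷ u.obj ≫ (u.σ.β B').inv = (u.σ.β B).inv ≫ u.obj ◁ f := by
    rw [Iso.comp_inv_eq, Category.assoc, u.σ.naturality, Iso.inv_hom_id_assoc]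
  simp only [swap, Iso.trans_hom, whiskerLeftIso_hom, Iso.symm_hom, Category.assoc]
  rw [whisker_assoc, tensor_whiskerLeft]
  simp only [Category.assoc, Iso.inv_hom_id_assoc]
  rw [← MonoidalCategory.whiskerLeft_comp_assoc, h]
  simp

theorem swap_naturality_right_assoc (A : C) {B B' : C} (f : B ⟶ B') (u : CentralIdempotent C) {Z : C}
    (h : (A ⊗ u.obj) ⊗ B' ⟶ Z) :
    (A ◁ f) ▷ u.obj ≫ (swap A B' u).hom ≫ h =
      (swap A B u).hom ≫ (A ⊗ u.obj) ◁ f ≫ h := by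
  simp only [← Category.assoc, swap_naturality_right]

theorem swap_naturality_left {A A' : C} (f : A ⟶ A') (B : C) (u : CentralIdempotent C) :
    (f ▷ B) ▷ u.obj ≫ (swap A' B u).hom = (swap A B u).hom ≫ (f ▷ u.obj) ▷ B := by
  simp only [swap, Iso.trans_hom, whiskerLeftIso_hom, Iso.symm_hom, Category.assoc]
  rw [associator_naturality_left_assoc, ← whisker_exchange_assoc, associator_inv_naturality_left]

theorem swap_tensor_right (A B B' : C) (u : CentralIdempotent C) :
    (swap A (B ⊗ B') u).hom = (α_ A B B').inv ▷ u.obj ≫ (swap (A ⊗ B) B' u).hom ≫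
      (swap A B u).hom ▷ B' ≫ (α_ (A ⊗ u.obj) B B').hom := by
  have h : (u.σ.β (B ⊗ B')).inv = (α_ _ _ _).hom ≫ B ◁ (u.σ.β B').inv ≫ (α_ _ _ _).inv ≫
      (u.σ.β B).inv ▷ B' ≫ (α_ _ _ _).hom := by
    rw [← cancel_epi (u.σ.β (B ⊗ B')).hom, Iso.hom_inv_id, u.σ.monoidal]
    simp
  simp only [swap, Iso.trans_hom, whiskerLeftIso_hom, Iso.symm_hom, Category.assoc, h]
  monoidal

theorem swap_tensor_left (A A' B : C) (u : CentralIdempotent C) :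
    (swap (A ⊗ A') B u).hom = (α_ A A' B).hom ▷ u.obj ≫ (α_ _ _ _).hom ≫
      A ◁ (swap A' B u).hom ≫ (α_ _ _ _).inv ≫ (α_ A A' u.obj).inv ▷ B := by
  simp only [swap, Iso.trans_hom, whiskerLeftIso_hom, Iso.symm_hom]
  monoidal

section Stiff

variable [IsStiff C]

instance (A : C) (u : CentralIdempotent C) : Mono (proj A u) := ⟨fun f g h => by
  have hp := IsStiff.isPullback A u u
  have h1 : hp.lift f f rfl ≫ proj A u ▷ u.obj = f := hp.lift_fst _ _ _
  have h1' : hp.lift f f rfl ≫ proj (A ⊗ u.obj) u = f := hp.lift_snd _ _ _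
  have h2 : hp.lift f g h ≫ proj A u ▷ u.obj = f := hp.lift_fst _ _ _
  have h3 : hp.lift f g h ≫ proj (A ⊗ u.obj) u = g := hp.lift_snd _ _ _
  have e : ∀ {Z : C} (k : Z ⟶ (A ⊗ u.obj) ⊗ u.obj), k ≫ proj A u ▷ u.obj = k ≫ proj (A ⊗ u.obj) u :=
    fun _ => by rw [proj_whiskerRight]
  exact h2.symm.trans ((e _).trans h3)⟩

/-- A common restriction: two factorisations through `v` and `v'` come from one
through `v ∧ v'`. -/
theorem exists_restriction {Z B : C} (v v' : CentralIdempotent C) (g : Z ⟶ B ⊗ v.obj)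
    (g' : Z ⟶ B ⊗ v'.obj) (h : g ≫ proj B v = g' ≫ proj B v') :
    ∃ (w : CentralIdempotent C) (m : w.Hom v) (m' : w.Hom v') (k : Z ⟶ B ⊗ w.obj),
      k ≫ B ◁ m.f = g ∧ k ≫ B ◁ m'.f = g' := by
  obtain ⟨m⟩ := CentralIdempotent.inf_le_left v v'
  obtain ⟨m'⟩ := CentralIdempotent.inf_le_right v v'
  have hp := IsStiff.isPullback B v v'
  have hk : (hp.lift g' g h.symm ≫ (α_ B v.obj v'.obj).hom) ≫ proj B (v.inf v') =
      g ≫ proj B v := by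
    have e : (α_ B v.obj v'.obj).hom ≫ proj B (v.inf v') =
        proj (B ⊗ v.obj) v' ≫ proj B v := by
      simp only [proj, CentralIdempotent.inf, MonoidalCategory.tensorHom_def', unitors_equal]
      simp
    refine (Category.assoc _ _ _).trans ((congrArg (hp.lift g' g h.symm ≫ ·) e).trans ?_)
    exact (Category.assoc _ _ _).symm.trans
      (congrArg (· ≫ proj B v) (hp.lift_snd g' g h.symm))
  refine ⟨v.inf v', m, m', hp.lift g' g h.symm ≫ (α_ _ _ _).hom, ?_, ?_⟩
  · rw [← cancel_mono (proj B v), Category.assoc, whiskerLeft_hom_proj]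
    exact hk
  · rw [← cancel_mono (proj B v'), Category.assoc, whiskerLeft_hom_proj]
    exact hk.trans h

theorem RestrictsTo.exists_inf {Z B : C} {f : Z ⟶ B} {v v' : CentralIdempotent C}
    (h : RestrictsTo f v) (h' : RestrictsTo f v') :
    ∃ w : CentralIdempotent C, w ≤ v ∧ w ≤ v' ∧ RestrictsTo f w := by
  obtain ⟨g, rfl⟩ := h
  obtain ⟨g', hg'⟩ := h'
  obtain ⟨w, m, m', k, h1, h2⟩ := exists_restriction v v' g g' hg'.symm
  exact ⟨w, ⟨m⟩, ⟨m'⟩, k, by rw [← h1, Category.assoc, whiskerLeft_hom_proj]⟩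

end Stiff

variable (C) in
/-- Objects of the completion `D[C]`: pairs of a down-closed set of central idempotents and an
object of `C`. -/
structure Completion where
  D : LowerSet (ZI C)
  A : C

namespace Completion

theorem mem_left {D E : LowerSet (ZI C)} {a : ZI C} (h : a ∈ D ⊓ E) : a ∈ D := h.1

theorem mem_right {D E : LowerSet (ZI C)} {a : ZI C} (h : a ∈ D ⊓ E) : a ∈ E := h.2

/-- Morphisms of `D[C]`: compatible families of morphisms `A ⊗ U ⟶ B` for `u ∈ D`, each of which
restricts to some element of `E`. -/
@[ext]
structure Hom (X Y : Completion C) where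
  app : ∀ u : CentralIdempotent C, toZI u ∈ X.D → (X.A ⊗ u.obj ⟶ Y.A)
  restricts : ∀ (u : CentralIdempotent C) (hu : toZI u ∈ X.D),
    ∃ v : CentralIdempotent C, toZI v ∈ Y.D ∧ RestrictsTo (app u hu) v
  compat : ∀ (u u' : CentralIdempotent C) (m : u.Hom u') (hu : toZI u ∈ X.D)
    (hu' : toZI u' ∈ X.D), app u hu = X.A ◁ m.f ≫ app u' hu'

/-- The morphism with components `f ∘ (A ⊗ u)`. -/
def lift {X Y : Completion C} (h : X.D ≤ Y.D) (f : X.A ⟶ Y.A) : Hom X Y where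
  app u _ := proj X.A u ≫ f
  restricts u hu := ⟨u, h hu, (restrictsTo_self u (proj X.A u)).postcomp f⟩
  compat u u' m hu hu' := by rw [whiskerLeft_hom_proj_assoc]

/-- A choice of `v ∈ E` to which `η_u` restricts. -/
noncomputable def Hom.idx {X Y : Completion C} (η : Hom X Y) (u : CentralIdempotent C)
    (hu : toZI u ∈ X.D) : CentralIdempotent C := (η.restricts u hu).choose

theorem Hom.idx_mem {X Y : Completion C} (η : Hom X Y) (u : CentralIdempotent C)
    (hu : toZI u ∈ X.D) : toZI (η.idx u hu) ∈ Y.D := (η.restricts u hu).choose_spec.1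

/-- A choice of `η̃` with `η_u = (B ⊗ v) ∘ η̃`. -/
noncomputable def Hom.fac {X Y : Completion C} (η : Hom X Y) (u : CentralIdempotent C)
    (hu : toZI u ∈ X.D) : X.A ⊗ u.obj ⟶ Y.A ⊗ (η.idx u hu).obj :=
  (η.restricts u hu).choose_spec.2.choose

theorem Hom.fac_proj {X Y : Completion C} (η : Hom X Y) (u : CentralIdempotent C)
    (hu : toZI u ∈ X.D) : η.fac u hu ≫ proj Y.A (η.idx u hu) = η.app u hu :=
  (η.restricts u hu).choose_spec.2.choose_spec

theorem Hom.fac_proj_assoc {X Y : Completion C} (η : Hom X Y) (u : CentralIdempotent C)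
    (hu : toZI u ∈ X.D) {Z : C} (h : Y.A ⟶ Z) :
    η.fac u hu ≫ proj Y.A (η.idx u hu) ≫ h = η.app u hu ≫ h := by
  simp only [← Category.assoc, Hom.fac_proj]

theorem Hom.comp_aux [IsStiff C] {Y Z : Completion C} (ζ : Hom Y Z) {W : C}
    {v v' : CentralIdempotent C} (g : W ⟶ Y.A ⊗ v.obj) (g' : W ⟶ Y.A ⊗ v'.obj)
    (h : g ≫ proj Y.A v = g' ≫ proj Y.A v') (hv' : toZI v' ∈ Y.D) (k : Y.A ⊗ v.obj ⟶ Z.A)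
    (hk : ∀ w (hw : toZI w ∈ Y.D) (m : w.Hom v), ζ.app w hw = Y.A ◁ m.f ≫ k) :
    g' ≫ ζ.app v' hv' = g ≫ k := by
  obtain ⟨w, n, n', l, h1, h2⟩ := exists_restriction _ _ _ _ h
  have hw : toZI w ∈ Y.D := Y.D.lower (toZI_le_toZI.2 ⟨n'⟩) hv'
  rw [← h1, ← h2, Category.assoc, Category.assoc, ← ζ.compat w v' n' hw hv', ← hk w hw n]

/-- Composition: the component at `u` is `ζ_v ∘ η̃`, for any factorisation of `η_u` as
`(B ⊗ v) ∘ η̃` with `v ∈ E`; see `comp_app` for independence of the choice. -/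
noncomputable def Hom.comp [IsStiff C] {X Y Z : Completion C} (η : Hom X Y) (ζ : Hom Y Z) :
    Hom X Z where
  app u hu := η.fac u hu ≫ ζ.app (η.idx u hu) (η.idx_mem u hu)
  restricts u hu := by
    obtain ⟨v, hv, h⟩ := ζ.restricts (η.idx u hu) (η.idx_mem u hu)
    exact ⟨v, hv, h.precomp _⟩
  compat u u' m hu hu' := by
    symm
    rw [← Category.assoc]
    apply ζ.comp_aux
    · rw [Category.assoc, η.fac_proj, η.fac_proj, η.compat u u' m hu hu']
    · exact fun w hw m' => ζ.compat _ _ m' hw _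

section

variable [IsStiff C]

theorem Hom.comp_app_of_local {X Y Z : Completion C} (η : Hom X Y) (ζ : Hom Y Z)
    {u : CentralIdempotent C} (hu : toZI u ∈ X.D) {v : CentralIdempotent C}
    (g : X.A ⊗ u.obj ⟶ Y.A ⊗ v.obj) (hg : g ≫ proj Y.A v = η.app u hu) (k : Y.A ⊗ v.obj ⟶ Z.A)
    (hk : ∀ w (hw : toZI w ∈ Y.D) (m : w.Hom v), ζ.app w hw = Y.A ◁ m.f ≫ k) :
    (η.comp ζ).app u hu = g ≫ k :=
  ζ.comp_aux _ _ (hg.trans (η.fac_proj u hu).symm) _ k hk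

theorem Hom.comp_app {X Y Z : Completion C} (η : Hom X Y) (ζ : Hom Y Z)
    {u : CentralIdempotent C} (hu : toZI u ∈ X.D) {v : CentralIdempotent C} (hv : toZI v ∈ Y.D)
    (g : X.A ⊗ u.obj ⟶ Y.A ⊗ v.obj) (hg : g ≫ proj Y.A v = η.app u hu) :
    (η.comp ζ).app u hu = g ≫ ζ.app v hv :=
  η.comp_app_of_local ζ hu g hg _ fun w hw m => ζ.compat w v m hw hv

noncomputable instance : Category (Completion C) where
  Hom := Hom
  id X := lift le_rfl (𝟙 _)
  comp := Hom.comp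
  id_comp {X Y} η := by
    ext u hu
    refine (Hom.comp_app (lift le_rfl (𝟙 X.A)) η hu hu (𝟙 _) ?_).trans (Category.id_comp _)
    simp [lift]
  comp_id {X Y} η := by
    ext u hu
    refine (Hom.comp_app η (lift le_rfl (𝟙 Y.A)) hu (η.idx_mem u hu) _ (η.fac_proj u hu)).trans ?_
    simp [lift, Hom.fac_proj]
  assoc {W X Y Z} η ζ ξ := by
    ext u hu
    have h1 := ζ.fac_proj (η.idx u hu) (η.idx_mem u hu)
    refine (Hom.comp_app (η.comp ζ) ξ hu (ζ.idx_mem _ (η.idx_mem u hu))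
      (η.fac u hu ≫ ζ.fac _ (η.idx_mem u hu)) ?_).trans ?_
    · rw [Category.assoc, h1]
      rfl
    · rw [Category.assoc]
      rfl

@[ext]
theorem hom_ext {X Y : Completion C} {η ζ : X ⟶ Y}
    (h : ∀ u hu, Hom.app η u hu = Hom.app ζ u hu) : η = ζ :=
  Hom.ext (funext fun u => funext fun hu => h u hu)

/-- The components of a morphism. -/
def app {X Y : Completion C} (η : X ⟶ Y) (u : CentralIdempotent C) (hu : toZI u ∈ X.D) :
    X.A ⊗ u.obj ⟶ Y.A := Hom.app η u hu

/-- `lift` as a morphism. -/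
def ofHom {X Y : Completion C} (h : X.D ≤ Y.D) (f : X.A ⟶ Y.A) : X ⟶ Y := lift h f

theorem ofHom_app {X Y : Completion C} (h : X.D ≤ Y.D) (f : X.A ⟶ Y.A) (u : CentralIdempotent C)
    (hu : toZI u ∈ X.D) : Hom.app (ofHom h f) u hu = proj X.A u ≫ f := rfl

theorem comp_ofHom_app {X Y Z : Completion C} (η : X ⟶ Y) (h : Y.D ≤ Z.D) (f : Y.A ⟶ Z.A)
    (u : CentralIdempotent C) (hu : toZI u ∈ X.D) :
    Hom.app (η ≫ ofHom h f) u hu = Hom.app η u hu ≫ f := by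
  refine (Hom.comp_app η (lift h f) hu (Hom.idx_mem η u hu) _ (Hom.fac_proj η u hu)).trans ?_
  simp [lift, Hom.fac_proj_assoc]

theorem ofHom_comp_app {X Y Z : Completion C} (h : X.D ≤ Y.D) (f : X.A ⟶ Y.A) (η : Y ⟶ Z)
    (u : CentralIdempotent C) (hu : toZI u ∈ X.D) :
    Hom.app (ofHom h f ≫ η) u hu = f ▷ u.obj ≫ Hom.app η u (h hu) :=
  Hom.comp_app (lift h f) η hu (h hu) _ (proj_naturality f u)

@[simp]
theorem ofHom_comp_ofHom {X Y Z : Completion C} (h : X.D ≤ Y.D) (f : X.A ⟶ Y.A) (h' : Y.D ≤ Z.D)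
    (g : Y.A ⟶ Z.A) : (ofHom h f : X ⟶ Y) ≫ (ofHom h' g : Y ⟶ Z) = ofHom (h.trans h') (f ≫ g) := by
  ext u hu
  rw [comp_ofHom_app, ofHom_app, ofHom_app, Category.assoc]

@[simp]
theorem ofHom_comp_ofHom_assoc {X Y Z W : Completion C} (h : X.D ≤ Y.D) (f : X.A ⟶ Y.A)
    (h' : Y.D ≤ Z.D) (g : Y.A ⟶ Z.A) (k : Z ⟶ W) :
    (ofHom h f : X ⟶ Y) ≫ (ofHom h' g : Y ⟶ Z) ≫ k = ofHom (h.trans h') (f ≫ g) ≫ k := by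
  simp only [← Category.assoc, ofHom_comp_ofHom]

theorem id_eq_ofHom (X : Completion C) : 𝟙 X = ofHom le_rfl (𝟙 X.A) := rfl

/-- Isomorphisms between objects with the same down-closed set. -/
def ofIso {X Y : Completion C} (h : X.D = Y.D) (f : X.A ≅ Y.A) : X ≅ Y where
  hom := ofHom h.le f.hom
  inv := ofHom h.ge f.inv
  hom_inv_id := by simp [id_eq_ofHom]
  inv_hom_id := by simp [id_eq_ofHom]

/-- The tensor product of objects. -/
abbrev tensor (X Y : Completion C) : Completion C := ⟨X.D ⊓ Y.D, X.A ⊗ Y.A⟩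

/-- Left whiskering, with components `A ⊗ η_u`. -/
def whiskerL (X : Completion C) {Y Z : Completion C} (η : Y ⟶ Z) : tensor X Y ⟶ tensor X Z where
  app u hu := (α_ X.A Y.A u.obj).hom ≫ X.A ◁ Hom.app η u (mem_right hu)
  restricts u hu := by
    obtain ⟨v, hv, h⟩ := Hom.restricts η u (mem_right hu)
    obtain ⟨w, h1, h2, h3⟩ := h.exists_inf (restrictsTo_self u _)
    exact ⟨w, ⟨X.D.lower (toZI_le_toZI.2 h2) (mem_left hu), Z.D.lower (toZI_le_toZI.2 h1) hv⟩,
      (h3.whiskerLeft X.A).precomp _⟩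
  compat u u' m hu hu' := by
    rw [Hom.compat η u u' m (mem_right hu) (mem_right hu')]
    simp [tensor]

/-- Right whiskering, with components `(η_u ⊗ A) ∘ (B ⊗ σ⁻¹)`. -/
def whiskerR {X Y : Completion C} (η : X ⟶ Y) (Z : Completion C) : tensor X Z ⟶ tensor Y Z where
  app u hu := (swap X.A Z.A u).hom ≫ Hom.app η u (mem_left hu) ▷ Z.A
  restricts u hu := by
    obtain ⟨v, hv, h⟩ := Hom.restricts η u (mem_left hu)
    obtain ⟨w, h1, h2, h3⟩ := h.exists_inf (restrictsTo_self u _)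
    exact ⟨w, ⟨Y.D.lower (toZI_le_toZI.2 h1) hv, Z.D.lower (toZI_le_toZI.2 h2) (mem_right hu)⟩,
      (h3.whiskerRight Z.A).precomp _⟩
  compat u u' m hu hu' := by
    rw [Hom.compat η u u' m (mem_left hu) (mem_left hu'), comp_whiskerRight, ← swap_hom_naturality_assoc]

theorem whiskerL_app (X : Completion C) {Y Z : Completion C} (η : Y ⟶ Z)
    (u : CentralIdempotent C) (hu : toZI u ∈ X.D ⊓ Y.D) :
    Hom.app (whiskerL X η) u hu = (α_ X.A Y.A u.obj).hom ≫ X.A ◁ Hom.app η u (mem_right hu) := rfl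

theorem whiskerR_app {X Y : Completion C} (η : X ⟶ Y) (Z : Completion C)
    (u : CentralIdempotent C) (hu : toZI u ∈ X.D ⊓ Z.D) :
    Hom.app (whiskerR η Z) u hu = (swap X.A Z.A u).hom ≫ Hom.app η u (mem_left hu) ▷ Z.A := rfl

theorem whiskerL_ofHom (X : Completion C) {Y Z : Completion C} (h : Y.D ≤ Z.D) (f : Y.A ⟶ Z.A) :
    whiskerL X (ofHom h f) = ofHom (inf_le_inf_left _ h) (X.A ◁ f) := by
  ext u hu
  rw [whiskerL_app, ofHom_app, ofHom_app, proj_tensor]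
  simp

theorem whiskerR_ofHom {X Y : Completion C} (h : X.D ≤ Y.D) (f : X.A ⟶ Y.A) (Z : Completion C) :
    whiskerR (ofHom h f) Z = ofHom (inf_le_inf_right _ h) (f ▷ Z.A) := by
  ext u hu
  rw [whiskerR_app, ofHom_app, ofHom_app, comp_whiskerRight, swap_proj_assoc]

theorem whiskerL_comp (W : Completion C) {X Y Z : Completion C} (η : X ⟶ Y) (ζ : Y ⟶ Z) :
    whiskerL W (η ≫ ζ) = whiskerL W η ≫ whiskerL W ζ := by
  ext u hu
  have h1 := Hom.fac_proj η u (mem_right hu)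
  have h2 := Hom.comp_app η ζ (mem_right hu) (Hom.idx_mem η u (mem_right hu)) _ h1
  refine Eq.trans ?_ (Hom.comp_app_of_local (whiskerL W η) (whiskerL W ζ) hu
    ((α_ W.A X.A u.obj).hom ≫ W.A ◁ Hom.fac η u (mem_right hu) ≫ (α_ W.A Y.A _).inv) ?_
    ((α_ W.A Y.A _).hom ≫ W.A ◁ Hom.app ζ _ (Hom.idx_mem η u (mem_right hu))) ?_).symm
  · simp only [Category.assoc, Iso.inv_hom_id_assoc]
    rw [← MonoidalCategory.whiskerLeft_comp, ← h2]
    rfl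
  · simp only [tensor, proj_tensor, Category.assoc, Iso.inv_hom_id_assoc]
    rw [← MonoidalCategory.whiskerLeft_comp, h1]
    rfl
  · intro w hw m
    rw [whiskerL_app, Hom.compat ζ _ _ m (mem_right hw) (Hom.idx_mem η u (mem_right hu))]
    simp [tensor]

theorem whiskerR_comp {X Y Z : Completion C} (η : X ⟶ Y) (ζ : Y ⟶ Z) (W : Completion C) :
    whiskerR (η ≫ ζ) W = whiskerR η W ≫ whiskerR ζ W := by
  ext u hu
  have h1 := Hom.fac_proj η u (mem_left hu)
  have h2 := Hom.comp_app η ζ (mem_left hu) (Hom.idx_mem η u (mem_left hu)) _ h1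
  refine Eq.trans ?_ (Hom.comp_app_of_local (whiskerR η W) (whiskerR ζ W) hu
    ((swap X.A W.A u).hom ≫ Hom.fac η u (mem_left hu) ▷ W.A ≫ (swap Y.A W.A _).inv) ?_
    ((swap Y.A W.A _).hom ≫ Hom.app ζ _ (Hom.idx_mem η u (mem_left hu)) ▷ W.A) ?_).symm
  · simp only [Category.assoc, Iso.inv_hom_id_assoc]
    rw [← comp_whiskerRight, ← h2]
    rfl
  · simp only [tensor, Category.assoc, swap_inv_proj]
    rw [← comp_whiskerRight, h1]
    rfl
  · intro w hw m
    rw [whiskerR_app, Hom.compat ζ _ _ m (mem_left hw) (Hom.idx_mem η u (mem_left hu)), comp_whiskerRight,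
      ← swap_hom_naturality_assoc]

/-- The components of `η ⊗ ζ`: copy `U`, move one copy past `A₂`, and apply `η_u` and `ζ_u`. -/
theorem whiskerR_whiskerL_app {X₁ Y₁ X₂ Y₂ : Completion C} (η : X₁ ⟶ Y₁) (ζ : X₂ ⟶ Y₂)
    (u : CentralIdempotent C) (hu : toZI u ∈ X₁.D ⊓ X₂.D) :
    Hom.app (whiskerR η X₂ ≫ whiskerL Y₁ ζ) u hu =
      copy (X₁.A ⊗ X₂.A) u ≫ (swap X₁.A X₂.A u).hom ▷ u.obj ≫ (α_ _ _ _).hom ≫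
        (Hom.app η u (mem_left hu) ⊗ₘ Hom.app ζ u (mem_right hu)) := by
  refine (Hom.comp_app_of_local (whiskerR η X₂) (whiskerL Y₁ ζ) hu
    (copy (X₁.A ⊗ X₂.A) u ≫ Hom.app (whiskerR η X₂) u hu ▷ u.obj) (copy_comp u _)
    ((α_ _ _ _).hom ≫ Y₁.A ◁ Hom.app ζ u (mem_right hu)) ?_).trans ?_
  · intro w hw m
    rw [whiskerL_app, Hom.compat ζ _ _ m (mem_right hw) (mem_right hu)]
    simp [tensor]
  · rw [whiskerR_app]
    simp [MonoidalCategory.tensorHom_def, tensor]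

theorem whisker_exchange' {X₁ Y₁ X₂ Y₂ : Completion C} (η : X₁ ⟶ Y₁) (ζ : X₂ ⟶ Y₂) :
    whiskerL X₁ ζ ≫ whiskerR η Y₂ = whiskerR η X₂ ≫ whiskerL Y₁ ζ := by
  ext u hu
  rw [whiskerR_whiskerL_app]
  refine (Hom.comp_app_of_local (whiskerL X₁ ζ) (whiskerR η Y₂) hu
    (copy (X₁.A ⊗ X₂.A) u ≫ Hom.app (whiskerL X₁ ζ) u hu ▷ u.obj) (copy_comp u _)
    ((swap _ _ _).hom ≫ Hom.app η u (mem_left hu) ▷ Y₂.A) ?_).trans ?_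
  · intro w hw m
    rw [whiskerR_app, Hom.compat η _ _ m (mem_left hw) (mem_left hu), comp_whiskerRight,
      ← swap_hom_naturality_assoc]
  · rw [whiskerL_app]
    have h : copy (X₁.A ⊗ X₂.A) u ≫ (α_ X₁.A X₂.A u.obj).hom ▷ u.obj ≫
        (swap X₁.A (X₂.A ⊗ u.obj) u).hom =
        copy (X₁.A ⊗ X₂.A) u ≫ (swap X₁.A X₂.A u).hom ▷ u.obj ≫ (α_ _ _ _).hom := by
      have : Mono ((X₁.A ⊗ u.obj) ◁ proj X₂.A u) := by
        have e : (X₁.A ⊗ u.obj) ◁ proj X₂.A u =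
            (α_ _ _ _).inv ≫ proj ((X₁.A ⊗ u.obj) ⊗ X₂.A) u := by simp [proj_tensor]
        rw [e]
        infer_instance
      rw [← cancel_mono ((X₁.A ⊗ u.obj) ◁ proj X₂.A u)]
      simp only [Category.assoc]
      rw [← swap_naturality_right, ← comp_whiskerRight_assoc, ← proj_tensor, copy_proj'_assoc,
        ← proj_tensor, proj_naturality, copy_proj_assoc]
    have h' := h =≫ (Hom.app η u (mem_left hu) ⊗ₘ Hom.app ζ u (mem_right hu))
    simp only [Category.assoc] at h'
    rw [← h', MonoidalCategory.tensorHom_def', comp_whiskerRight]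
    simp only [Category.assoc]
    rw [swap_naturality_right_assoc]

/-- The associator of `D[C]`. -/
def assocIso (X Y Z : Completion C) : tensor (tensor X Y) Z ≅ tensor X (tensor Y Z) :=
  ofIso (inf_assoc _ _ _) (α_ X.A Y.A Z.A)

variable (C) in
/-- The tensor unit of `D[C]`. -/
abbrev unitObj : Completion C := ⟨⊤, 𝟙_ C⟩

/-- The left unitor of `D[C]`. -/
def leftUnitorIso (X : Completion C) : tensor (unitObj C) X ≅ X :=
  ofIso (top_inf_eq _) (λ_ X.A)

/-- The right unitor of `D[C]`. -/
def rightUnitorIso (X : Completion C) : tensor X (unitObj C) ≅ X :=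
  ofIso (inf_top_eq _) (ρ_ X.A)

theorem assoc_naturality_left {X X' : Completion C} (η : X ⟶ X') (Y Z : Completion C) :
    whiskerR (whiskerR η Y) Z ≫ (assocIso X' Y Z).hom =
      (assocIso X Y Z).hom ≫ whiskerR η (tensor Y Z) := by
  ext u hu
  dsimp only [assocIso, ofIso]
  rw [comp_ofHom_app, ofHom_comp_app, whiskerR_app, whiskerR_app, whiskerR_app, swap_tensor_right]
  simp

theorem assoc_naturality_middle (X : Completion C) {Y Y' : Completion C} (η : Y ⟶ Y')
    (Z : Completion C) :
    whiskerR (whiskerL X η) Z ≫ (assocIso X Y' Z).hom =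
      (assocIso X Y Z).hom ≫ whiskerL X (whiskerR η Z) := by
  ext u hu
  dsimp only [assocIso, ofIso]
  rw [comp_ofHom_app, ofHom_comp_app, whiskerR_app, whiskerL_app, whiskerL_app, whiskerR_app,
    swap_tensor_left]
  simp

theorem assoc_naturality_right (X Y : Completion C) {Z Z' : Completion C} (η : Z ⟶ Z') :
    whiskerL (tensor X Y) η ≫ (assocIso X Y Z').hom =
      (assocIso X Y Z).hom ≫ whiskerL X (whiskerL Y η) := by
  ext u hu
  dsimp only [assocIso, ofIso]
  rw [comp_ofHom_app, ofHom_comp_app, whiskerL_app, whiskerL_app, whiskerL_app]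
  simp

theorem leftUnitor_nat {X Y : Completion C} (η : X ⟶ Y) :
    whiskerL (unitObj C) η ≫ (leftUnitorIso Y).hom = (leftUnitorIso X).hom ≫ η := by
  ext u hu
  dsimp only [leftUnitorIso, ofIso]
  rw [comp_ofHom_app, ofHom_comp_app, whiskerL_app]
  simp

theorem rightUnitor_nat {X Y : Completion C} (η : X ⟶ Y) :
    whiskerR η (unitObj C) ≫ (rightUnitorIso Y).hom = (rightUnitorIso X).hom ≫ η := by
  ext u hu
  dsimp only [rightUnitorIso, ofIso]
  rw [comp_ofHom_app, ofHom_comp_app, whiskerR_app]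
  have h : (swap X.A (𝟙_ C) u).hom ≫ (ρ_ _).hom = (ρ_ X.A).hom ▷ u.obj := by
    rw [← cancel_mono (proj X.A u), proj_naturality, Category.assoc, ← rightUnitor_naturality,
      swap_proj_assoc]
  rw [← h]
  simp

noncomputable instance : MonoidalCategory (Completion C) where
  tensorObj := tensor
  whiskerLeft X _ _ η := whiskerL X η
  whiskerRight η Z := whiskerR η Z
  tensorHom {_ Y₁ X₂ _} η ζ := whiskerR η X₂ ≫ whiskerL Y₁ ζ
  tensorUnit := unitObj C
  associator := assocIso
  leftUnitor := leftUnitorIso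
  rightUnitor := rightUnitorIso
  tensorHom_def _ _ := rfl
  id_tensorHom_id X Y := by
    rw [id_eq_ofHom, id_eq_ofHom, whiskerR_ofHom, whiskerL_ofHom, ofHom_comp_ofHom]
    simp [id_eq_ofHom]
  tensorHom_comp_tensorHom {X₁ Y₁ Z₁ X₂ Y₂ Z₂} η₁ η₂ ζ₁ ζ₂ := by
    rw [whiskerR_comp, whiskerL_comp, Category.assoc, Category.assoc,
      ← Category.assoc (whiskerL Y₁ η₂), whisker_exchange', Category.assoc]
  whiskerLeft_id X Y := by
    rw [id_eq_ofHom, whiskerL_ofHom]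
    simp [id_eq_ofHom]
  id_whiskerRight X Y := by
    rw [id_eq_ofHom, whiskerR_ofHom]
    simp [id_eq_ofHom]
  associator_naturality {X₁ X₂ X₃ Y₁ Y₂ Y₃} f g h := by
    rw [whiskerR_comp, whiskerL_comp, Category.assoc, Category.assoc, assoc_naturality_right,
      ← Category.assoc (whiskerR (whiskerL _ _) _), assoc_naturality_middle, Category.assoc,
      ← Category.assoc, assoc_naturality_left, Category.assoc]
  leftUnitor_naturality := leftUnitor_nat
  rightUnitor_naturality := rightUnitor_nat
  pentagon W X Y Z := by
    dsimp only [assocIso, ofIso]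
    rw [whiskerR_ofHom, whiskerL_ofHom, ofHom_comp_ofHom, ofHom_comp_ofHom, ofHom_comp_ofHom]
    congr 1
    exact MonoidalCategory.pentagon _ _ _ _
  triangle X Y := by
    dsimp only [assocIso, ofIso, leftUnitorIso, rightUnitorIso]
    rw [whiskerR_ofHom, whiskerL_ofHom, ofHom_comp_ofHom]
    congr 1
    exact MonoidalCategory.triangle _ _

end

end Completion

/-! ### Universal joins -/

/-- The morphism witnessing `u ≤ v` (there is exactly one). -/
noncomputable def leHom {u v : CentralIdempotent C} (h : u ≤ v) : u.Hom v := Classical.choice h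

/-- The diagram `A ⊗ U` for `u ∈ S`, with morphisms `A ⊗ U ⟶ A ⊗ V` for `u ≤ v`. -/
noncomputable def joinDiagram (A : C) (S : Set (CentralIdempotent C)) : S ⥤ C where
  obj u := A ⊗ u.1.obj
  map f := A ◁ (leHom (leOfHom f)).f
  map_id u := by
    rw [Subsingleton.elim (leHom (leOfHom (𝟙 u))) (.id u.1)]
    simp [CentralIdempotent.Hom.id]
  map_comp f g := by
    rw [Subsingleton.elim (leHom (leOfHom (f ≫ g)))
      ((leHom (leOfHom f)).comp (leHom (leOfHom g)))]
    simp [CentralIdempotent.Hom.comp]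

/-- The cocone `A ⊗ U ⟶ A ⊗ J` for an upper bound `j` of `S`. -/
noncomputable def joinCocone (A : C) (S : Set (CentralIdempotent C)) (j : CentralIdempotent C)
    (h : ∀ u ∈ S, u ≤ j) : Limits.Cocone (joinDiagram A S) where
  pt := A ⊗ j.obj
  ι :=
    { app := fun u => A ◁ (leHom (h u.1 u.2)).f
      naturality := fun u v f => by
        rw [Subsingleton.elim (leHom (h u.1 u.2)) ((leHom (leOfHom f)).comp (leHom (h v.1 v.2)))]
        simp [CentralIdempotent.Hom.comp, joinDiagram] }

theorem le_of_isLUB {S : Set (CentralIdempotent C)} {j : CentralIdempotent C}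
    (h : IsLUB (toZI '' S) (toZI j)) : ∀ u ∈ S, u ≤ j :=
  fun u hu => toZI_le_toZI.1 (h.1 ⟨u, hu, rfl⟩)

variable (C) in
/-- Universal joins of central idempotents: all joins exist in `ZI C`, and for every set of central
idempotents closed under binary meets, with join `j`, and every object `A`, the cocone
`A ⊗ U ⟶ A ⊗ J` is a colimit. -/
structure HasUniversalJoins : Prop where
  exists_isLUB : ∀ S : Set (ZI C), ∃ a, IsLUB S a
  isColimit : ∀ S : Set (CentralIdempotent C),
    (∀ u ∈ S, ∀ v ∈ S, ∃ w ∈ S, IsGLB {toZI u, toZI v} (toZI w)) →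
    ∀ (j : CentralIdempotent C) (hj : IsLUB (toZI '' S) (toZI j)) (A : C),
      Nonempty (Limits.IsColimit (joinCocone A S j (le_of_isLUB hj)))

/-! ### Spatiality -/

/-- Completely prime filters of a partially ordered set. -/
structure CompletelyPrimeFilter (L : Type u) [PartialOrder L] where
  toPFilter : Order.PFilter L
  proper : ∃ a, a ∉ toPFilter
  completelyPrime : ∀ (S : Set L) (a : L), IsLUB S a → a ∈ toPFilter → ∃ s ∈ S, s ∈ toPFilter

/-- The topology generated by the sets `B_a = {P | a ∈ P}`. -/
instance (L : Type u) [PartialOrder L] : TopologicalSpace (CompletelyPrimeFilter L) :=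
  TopologicalSpace.generateFrom (Set.range fun a : L => {P | a ∈ P.toPFilter})

/-- Isomorphic to the frame of open sets of the completely prime spectrum. -/
def IsSpatial (L : Type u) [PartialOrder L] : Prop :=
  Nonempty (L ≃o TopologicalSpace.Opens (CompletelyPrimeFilter L))

variable (C) in
/-- The objects of `MonCat_j`: stiff monoidal categories with universal joins of central
idempotents, whose central idempotents form a spatial frame. -/
structure InMonCatJ : Prop where
  stiff : IsStiff C
  joins : HasUniversalJoins C
  spatial : IsSpatial (ZI C)

/-- The embedding `C ⥤ D[C]`, sending `A` to `(ZI C, A)` and `f` to the family `f ⊗ u`. -/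
def embeddingFunctor [IsStiff C] : C ⥤ Completion C where
  obj A := ⟨⊤, A⟩
  map f := Completion.ofHom le_rfl f

namespace Completion

variable [IsStiff C]

theorem whiskerRight_ofHom {X Y : Completion C} (h : X.D ≤ Y.D) (f : X.A ⟶ Y.A)
    (Z : Completion C) : (ofHom h f : X ⟶ Y) ▷ Z =
      (ofHom (inf_le_inf_right Z.D h) (f ▷ Z.A) : tensor X Z ⟶ tensor Y Z) :=
  whiskerR_ofHom h f Z

theorem whiskerLeft_ofHom (X : Completion C) {Y Z : Completion C} (h : Y.D ≤ Z.D)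
    (f : Y.A ⟶ Z.A) : X ◁ (ofHom h f : Y ⟶ Z) =
      (ofHom (inf_le_inf_left X.D h) (X.A ◁ f) : tensor X Y ⟶ tensor X Z) :=
  whiskerL_ofHom X h f

theorem associator_hom (X Y Z : Completion C) : (α_ X Y Z).hom =
    (ofHom (inf_assoc X.D Y.D Z.D).le (α_ X.A Y.A Z.A).hom :
      tensor (tensor X Y) Z ⟶ tensor X (tensor Y Z)) := rfl

theorem leftUnitor_hom (X : Completion C) : (λ_ X).hom =
    (ofHom (top_inf_eq X.D).le (λ_ X.A).hom : tensor (unitObj C) X ⟶ X) := rfl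

theorem rightUnitor_hom (X : Completion C) : (ρ_ X).hom =
    (ofHom (inf_top_eq X.D).le (ρ_ X.A).hom : tensor X (unitObj C) ⟶ X) := rfl

/-- The (strict) monoidal structure of the embedding. -/
noncomputable instance : (embeddingFunctor (C := C)).LaxMonoidal where
  ε := 𝟙 (unitObj C)
  μ A B := (ofHom le_top (𝟙 (A ⊗ B)) : tensor ⟨⊤, A⟩ ⟨⊤, B⟩ ⟶ ⟨⊤, A ⊗ B⟩)
  μ_natural_left f B := by
    dsimp only [embeddingFunctor]
    rw [whiskerRight_ofHom]
    refine (ofHom_comp_ofHom _ _ _ _).trans (Eq.trans ?_ (ofHom_comp_ofHom _ _ _ _).symm)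
    exact congrArg _ ((Category.comp_id (f ▷ B)).trans (Category.id_comp (f ▷ B)).symm)
  μ_natural_right A f := by
    dsimp only [embeddingFunctor]
    rw [whiskerLeft_ofHom]
    refine (ofHom_comp_ofHom _ _ _ _).trans (Eq.trans ?_ (ofHom_comp_ofHom _ _ _ _).symm)
    exact congrArg _ ((Category.comp_id (A ◁ f)).trans (Category.id_comp (A ◁ f)).symm)
  associativity X Y Z := by
    dsimp only [embeddingFunctor]
    rw [whiskerRight_ofHom, whiskerLeft_ofHom, associator_hom]
    rw [ofHom_comp_ofHom_assoc]
    refine (ofHom_comp_ofHom _ _ _ _).trans (Eq.trans ?_ (congrArg _ (ofHom_comp_ofHom _ _ _ _)).symm)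
    refine Eq.trans ?_ (ofHom_comp_ofHom _ _ _ _).symm
    have h : (𝟙 (X ⊗ Y) ▷ Z ≫ 𝟙 ((X ⊗ Y) ⊗ Z)) ≫ (α_ X Y Z).hom =
        (α_ X Y Z).hom ≫ X ◁ 𝟙 (Y ⊗ Z) ≫ 𝟙 (X ⊗ Y ⊗ Z) := by simp
    exact congrArg _ h
  left_unitality X := by
    dsimp only [embeddingFunctor]
    rw [id_eq_ofHom, whiskerRight_ofHom, leftUnitor_hom]
    refine Eq.trans ?_ (congrArg _ (ofHom_comp_ofHom _ _ _ _)).symm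
    refine Eq.trans ?_ (ofHom_comp_ofHom _ _ _ _).symm
    have h : (λ_ X).hom = 𝟙 (𝟙_ C) ▷ X ≫ 𝟙 (𝟙_ C ⊗ X) ≫ (λ_ X).hom := by simp
    exact congrArg _ h
  right_unitality X := by
    dsimp only [embeddingFunctor]
    rw [id_eq_ofHom, whiskerLeft_ofHom, rightUnitor_hom]
    refine Eq.trans ?_ (congrArg _ (ofHom_comp_ofHom _ _ _ _)).symm
    refine Eq.trans ?_ (ofHom_comp_ofHom _ _ _ _).symm
    have h : (ρ_ X).hom = X ◁ 𝟙 (𝟙_ C) ≫ 𝟙 (X ⊗ 𝟙_ C) ≫ (ρ_ X).hom := by simp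
    exact congrArg _ h

end Completion

variable (C) in
/-- The embedding of `C` into `D[C]` as a monoidal functor. -/
noncomputable abbrev embedding [IsStiff C] : LaxMonoidalFunctor C (Completion C) :=
  .of embeddingFunctor

end Basic

section Functors

universe v₁ v₂ v₃ v₄ u₁ u₂ u₃ u₄

open Functor.LaxMonoidal

variable {C : Type u₁} [Category.{v₁} C] [MonoidalCategory C]
  {D : Type u₂} [Category.{v₂} D] [MonoidalCategory D]
  {E : Type u₃} [Category.{v₃} E] [MonoidalCategory E]

/-- The identity lax monoidal functor. -/
abbrev laxId (C : Type u₁) [Category.{v₁} C] [MonoidalCategory C] : LaxMonoidalFunctor C C :=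
  .of (𝟭 C)

/-- Composition of lax monoidal functors. -/
abbrev laxComp (F : LaxMonoidalFunctor C D) (G : LaxMonoidalFunctor D E) :
    LaxMonoidalFunctor C E := .of (F.toFunctor ⋙ G.toFunctor)

/-- Lax monoidal functors that preserve central idempotents: the coherence morphisms `I ⟶ F I` and
`F A ⊗ F U ⟶ F (A ⊗ U)` are invertible, and `F U` carries a half-braiding that is compatible with
that of `U` and makes `F U ⟶ F I ≅ I` into a central idempotent. This half-braiding is unique
(`halfBraiding_unique`), so that it necessarily is the canonical one on `F I`, and on `F (U ⊗ V)`
the one induced by those on `F U` and `F V`. -/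
structure PreservesCentralIdempotents (F : C ⥤ D) [F.LaxMonoidal] : Prop where
  isIso_ε : IsIso (ε F)
  isIso_μ : ∀ (A : C) (u : CentralIdempotent C), IsIso (μ F A u.obj)
  exists_halfBraiding : ∀ u : CentralIdempotent C, ∃ τ : HalfBraiding (F.obj u.obj),
    (∀ A : C, (τ.β (F.obj A)).hom ≫ μ F A u.obj = μ F u.obj A ≫ F.map (u.σ.β A).hom) ∧
    IsCentralIdempotent τ (F.map u.counit ≫ inv (ε F))

/-- The action of `F` on central idempotents. -/
noncomputable def PreservesCentralIdempotents.map {F : C ⥤ D} [F.LaxMonoidal]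
    (h : PreservesCentralIdempotents F) (u : CentralIdempotent C) : CentralIdempotent D where
  obj := F.obj u.obj
  σ := (h.exists_halfBraiding u).choose
  counit := F.map u.counit ≫ @inv _ _ _ _ (ε F) h.isIso_ε
  isCentral := (h.exists_halfBraiding u).choose_spec.2

/-- `F` preserves joins of central idempotents. -/
def PreservesCentralIdempotents.PreservesJoins {F : C ⥤ D} [F.LaxMonoidal]
    (h : PreservesCentralIdempotents F) : Prop :=
  ∀ (S : Set (CentralIdempotent C)) (j : CentralIdempotent C), IsLUB (toZI '' S) (toZI j) →
    IsLUB ((fun u => toZI (h.map u)) '' S) (toZI (h.map j))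

/-- Lax monoidal functors that preserve central idempotents and their joins. -/
def IsJoinMorphism (F : C ⥤ D) [F.LaxMonoidal] : Prop :=
  ∃ h : PreservesCentralIdempotents F, h.PreservesJoins

theorem PreservesCentralIdempotents.id : PreservesCentralIdempotents (𝟭 C) where
  isIso_ε := by simp only [Functor.LaxMonoidal.id_ε]; infer_instance
  isIso_μ A u := by simp only [Functor.LaxMonoidal.id_μ]; infer_instance
  exists_halfBraiding u := ⟨u.σ, by simp, by simpa using u.isCentral⟩

theorem PreservesCentralIdempotents.comp {F : C ⥤ D} [F.LaxMonoidal] {G : D ⥤ E} [G.LaxMonoidal]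
    (hF : PreservesCentralIdempotents F) (hG : PreservesCentralIdempotents G) :
    PreservesCentralIdempotents (F ⋙ G) := by
  have := hF.isIso_ε
  have := hG.isIso_ε
  have : IsIso (ε (F ⋙ G)) := by rw [comp_ε]; infer_instance
  refine ⟨this, fun A u => ?_, fun u => ?_⟩
  · have := hF.isIso_μ A u
    have : IsIso (μ G (F.obj A) (F.obj u.obj)) := hG.isIso_μ (F.obj A) (hF.map u)
    rw [comp_μ]
    infer_instance
  · obtain ⟨h1, h2⟩ := (hG.exists_halfBraiding (hF.map u)).choose_spec
    refine ⟨(hG.map (hF.map u)).σ, fun A => ?_, ?_⟩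
    · have h3 := (hF.exists_halfBraiding u).choose_spec.1 A
      have h4 := h1 (F.obj A)
      rw [comp_μ, comp_μ]
      refine (Category.assoc _ _ _).symm.trans ((congrArg (· ≫ _) h4).trans ?_)
      refine (Category.assoc _ _ _).trans (Eq.trans ?_ (Category.assoc _ _ _).symm)
      exact congrArg _ ((G.map_comp _ _).symm.trans ((congrArg G.map h3).trans (G.map_comp _ _)))
    · have h3 := (hG.map (hF.map u)).isCentral
      have h5 : G.map (F.map u.counit ≫ inv (ε F)) ≫ inv (ε G) =
          (F ⋙ G).map u.counit ≫ inv (ε (F ⋙ G)) := by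
        rw [IsIso.eq_comp_inv]
        simp
      change IsCentralIdempotent _ (G.map (F.map u.counit ≫ inv (ε F)) ≫ inv (ε G)) at h3
      rw [h5] at h3
      exact h3

theorem PreservesCentralIdempotents.toZI_map_eq {F : C ⥤ D} [F.LaxMonoidal]
    (h : PreservesCentralIdempotents F) (u : CentralIdempotent C) (v : CentralIdempotent D)
    (e : F.obj u.obj ≅ v.obj)
    (he : e.hom ≫ v.counit ≫ ε F = F.map u.counit) : toZI (h.map u) = toZI v := by
  have := h.isIso_ε
  rw [toZI_eq_iff]
  exact ⟨.mk' e.hom (by simp [PreservesCentralIdempotents.map, ← he]), e.isIso_hom⟩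

theorem IsJoinMorphism.id : IsJoinMorphism (𝟭 C) := by
  refine ⟨.id, fun S j hj => ?_⟩
  have h : ∀ u : CentralIdempotent C,
      toZI ((PreservesCentralIdempotents.id (C := C)).map u) = toZI u :=
    fun u => PreservesCentralIdempotents.toZI_map_eq _ u u (Iso.refl _) (by simp)
  simpa only [h] using hj

theorem IsJoinMorphism.comp {F : C ⥤ D} [F.LaxMonoidal] {G : D ⥤ E} [G.LaxMonoidal]
    (hF : IsJoinMorphism F) (hG : IsJoinMorphism G) : IsJoinMorphism (F ⋙ G) := by
  obtain ⟨hF, kF⟩ := hF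
  obtain ⟨hG, kG⟩ := hG
  refine ⟨hF.comp hG, fun S j hj => ?_⟩
  have := hF.isIso_ε
  have := hG.isIso_ε
  have h : ∀ u : CentralIdempotent C, toZI ((hF.comp hG).map u) = toZI (hG.map (hF.map u)) :=
    fun u => PreservesCentralIdempotents.toZI_map_eq _ u _ (Iso.refl _) (by
      simp [PreservesCentralIdempotents.map])
  have key := kG (hF.map '' S) (hF.map j) (by
    have := kF S j hj
    rwa [Set.image_image])
  rw [Set.image_image] at key
  simpa only [h] using key

/-- Composition of lax monoidal functors respects monoidal natural isomorphisms. -/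
def laxCompIso {F F' : LaxMonoidalFunctor C D} {G G' : LaxMonoidalFunctor D E} (a : F ≅ F')
    (b : G ≅ G') : laxComp F G ≅ laxComp F' G' where
  hom := ⟨a.hom.hom ◫ b.hom.hom, NatTrans.IsMonoidal.hcomp _ _⟩
  inv := ⟨a.inv.hom ◫ b.inv.hom, NatTrans.IsMonoidal.hcomp _ _⟩
  hom_inv_id := by
    have h1 : a.hom.hom ≫ a.inv.hom = 𝟙 _ := congrArg LaxMonoidalFunctor.Hom.hom a.hom_inv_id
    have h2 : b.hom.hom ≫ b.inv.hom = 𝟙 _ := congrArg LaxMonoidalFunctor.Hom.hom b.hom_inv_id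
    apply LaxMonoidalFunctor.hom_ext
    change (a.hom.hom ◫ b.hom.hom) ≫ (a.inv.hom ◫ b.inv.hom) = 𝟙 _
    rw [← NatTrans.exchange, h1, h2]
    exact Functor.id_hcomp (F := F.toFunctor) (𝟙 G.toFunctor) |>.trans
      (Functor.whiskerLeft_id' _)
  inv_hom_id := by
    have h1 : a.inv.hom ≫ a.hom.hom = 𝟙 _ := congrArg LaxMonoidalFunctor.Hom.hom a.inv_hom_id
    have h2 : b.inv.hom ≫ b.hom.hom = 𝟙 _ := congrArg LaxMonoidalFunctor.Hom.hom b.inv_hom_id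
    apply LaxMonoidalFunctor.hom_ext
    change (a.inv.hom ◫ b.inv.hom) ≫ (a.hom.hom ◫ b.hom.hom) = 𝟙 _
    rw [← NatTrans.exchange, h1, h2]
    exact Functor.id_hcomp (F := F'.toFunctor) (𝟙 G'.toFunctor) |>.trans
      (Functor.whiskerLeft_id' _)

/-- Left unit law. -/
def laxIdComp (F : LaxMonoidalFunctor C D) : laxComp (laxId C) F ≅ F :=
  @LaxMonoidalFunctor.isoMk _ _ _ _ _ _ _ _ F.toFunctor.leftUnitor
    (inferInstanceAs (NatTrans.IsMonoidal F.toFunctor.leftUnitor.hom))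

/-- Right unit law. -/
def laxCompId (F : LaxMonoidalFunctor C D) : laxComp F (laxId D) ≅ F :=
  @LaxMonoidalFunctor.isoMk _ _ _ _ _ _ _ _ F.toFunctor.rightUnitor
    (inferInstanceAs (NatTrans.IsMonoidal F.toFunctor.rightUnitor.hom))

/-- Associativity. -/
def laxAssoc {E' : Type u₄} [Category.{v₄} E'] [MonoidalCategory E'] (F : LaxMonoidalFunctor C D)
    (G : LaxMonoidalFunctor D E) (H : LaxMonoidalFunctor E E') :
    laxComp (laxComp F G) H ≅ laxComp F (laxComp G H) :=
  @LaxMonoidalFunctor.isoMk _ _ _ _ _ _ _ _ (Functor.associator F.toFunctor G.toFunctor H.toFunctor)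
    (inferInstanceAs (NatTrans.IsMonoidal (Functor.associator F.toFunctor G.toFunctor H.toFunctor).hom))

end Functors

/-! ### The categories `MonCat_s` and `MonCat_j` -/

/-- Small stiff monoidal categories. -/
structure MonCatS : Type (u + 1) where
  carrier : Type u
  [cat : SmallCategory carrier]
  [monoidal : MonoidalCategory carrier]
  [stiff : IsStiff carrier]

/-- Small stiff monoidal categories with universal joins of central idempotents, whose central
idempotents form a spatial frame. -/
structure MonCatJ : Type (u + 1) where
  carrier : Type u
  [cat : SmallCategory carrier]
  [monoidal : MonoidalCategory carrier]
  isJ : InMonCatJ carrier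

attribute [instance] MonCatS.cat MonCatS.monoidal MonCatS.stiff MonCatJ.cat MonCatJ.monoidal

/-- Lax monoidal functors preserving central idempotents. -/
def MonCatS.PreHom (C D : MonCatS.{u}) : Type u :=
  {F : LaxMonoidalFunctor C.carrier D.carrier // PreservesCentralIdempotents F.toFunctor}

/-- Two functors are identified when they are monoidally naturally isomorphic. -/
instance MonCatS.homSetoid (C D : MonCatS.{u}) : Setoid (MonCatS.PreHom C D) where
  r F G := Nonempty (F.1 ≅ G.1)
  iseqv := ⟨fun F => ⟨Iso.refl F.1⟩, fun ⟨e⟩ => ⟨e.symm⟩, fun ⟨e⟩ ⟨f⟩ => ⟨e ≪≫ f⟩⟩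

/-- Lax monoidal functors preserving central idempotents and their joins. -/
def MonCatJ.PreHom (C D : MonCatJ.{u}) : Type u :=
  {F : LaxMonoidalFunctor C.carrier D.carrier // IsJoinMorphism F.toFunctor}

/-- Two functors are identified when they are monoidally naturally isomorphic. -/
instance MonCatJ.homSetoid (C D : MonCatJ.{u}) : Setoid (MonCatJ.PreHom C D) where
  r F G := Nonempty (F.1 ≅ G.1)
  iseqv := ⟨fun F => ⟨Iso.refl F.1⟩, fun ⟨e⟩ => ⟨e.symm⟩, fun ⟨e⟩ ⟨f⟩ => ⟨e ≪≫ f⟩⟩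

/-- Morphisms of `MonCat_s`: lax monoidal functors preserving central idempotents, up to monoidal
natural isomorphism. -/
instance : Category MonCatS.{u} where
  Hom C D := Quotient (MonCatS.homSetoid C D)
  id C := Quotient.mk _ ⟨laxId C.carrier, .id⟩
  comp := Quotient.map₂ (fun F G => ⟨laxComp F.1 G.1, F.2.comp G.2⟩)
    fun _ _ ⟨a⟩ _ _ ⟨b⟩ => ⟨laxCompIso a b⟩
  id_comp := by
    rintro C D ⟨F⟩
    exact Quotient.sound ⟨laxIdComp F.1⟩
  comp_id := by
    rintro C D ⟨F⟩
    exact Quotient.sound ⟨laxCompId F.1⟩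
  assoc := by
    rintro A B C D ⟨F⟩ ⟨G⟩ ⟨H⟩
    exact Quotient.sound ⟨laxAssoc F.1 G.1 H.1⟩

/-- Morphisms of `MonCat_j`: lax monoidal functors preserving central idempotents and their joins,
up to monoidal natural isomorphism. -/
instance : Category MonCatJ.{u} where
  Hom C D := Quotient (MonCatJ.homSetoid C D)
  id C := Quotient.mk _ ⟨laxId C.carrier, .id⟩
  comp := Quotient.map₂ (fun F G => ⟨laxComp F.1 G.1, F.2.comp G.2⟩)
    fun _ _ ⟨a⟩ _ _ ⟨b⟩ => ⟨laxCompIso a b⟩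
  id_comp := by
    rintro C D ⟨F⟩
    exact Quotient.sound ⟨laxIdComp F.1⟩
  comp_id := by
    rintro C D ⟨F⟩
    exact Quotient.sound ⟨laxCompId F.1⟩
  assoc := by
    rintro A B C D ⟨F⟩ ⟨G⟩ ⟨H⟩
    exact Quotient.sound ⟨laxAssoc F.1 G.1 H.1⟩

/-- The class of a lax monoidal functor preserving central idempotents. -/
def MonCatS.homMk {C D : MonCatS.{u}} (F : LaxMonoidalFunctor C.carrier D.carrier)
    (h : PreservesCentralIdempotents F.toFunctor) : C ⟶ D :=
  Quotient.mk (MonCatS.homSetoid C D) ⟨F, h⟩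

/-- The underlying object of `MonCat_s`. -/
abbrev MonCatJ.toS (C : MonCatJ.{u}) : MonCatS.{u} :=
  { carrier := C.carrier, stiff := C.isJ.stiff }

/-- The forgetful functor `MonCat_j ⥤ MonCat_s`. -/
def forgetJS : MonCatJ.{u} ⥤ MonCatS.{u} where
  obj C := C.toS
  map {C D} := Quotient.map' (s₁ := MonCatJ.homSetoid C D) (s₂ := MonCatS.homSetoid C.toS D.toS)
    (fun F => ⟨F.1, F.2.choose⟩) fun _ _ h => h
  map_id _ := rfl
  map_comp := by
    rintro A B C ⟨F⟩ ⟨G⟩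
    rfl

end CentralIdem

/-!
The idempotents of `D[C]` are the down-sets of `ZI C`, so they form a spatial frame in which the
join of a family is a union. A morphism out of `⟨D, A⟩` is by definition a compatible family
indexed by `D`, which makes `⟨D, A⟩` the colimit of the objects `⟨↓u, A⟩ ≅ ⟨⊤, A ⊗ U⟩` with
`u ∈ D`; this is universality of joins. An extension of `F` is therefore forced to send `⟨D, A⟩` to
`F A ⊗ ⋁ {F u | u ∈ D}`, and universality of joins in the target lets one define it on morphisms and
check its coherence by restricting to the `F u`. This only gives `F̂ ∘ E ≅ F`; transporting the
structure of `F̂` along the isomorphisms on the objects `⟨⊤, A⟩` makes the triangle commute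
strictly. Stiffness of the target makes the image of each inclusion `⟨D, A⟩ ⟶ ⟨⊤, A⟩` a
monomorphism, which determines a transformation by its components on the image of `E`, and these
components lift along the monomorphisms because the joins are preserved.
-/

namespace CentralIdem

section CentralIdempotents

variable {C : Type u} [Category.{v} C] [MonoidalCategory C]

/-! ### Constructing and comparing central idempotents -/

theorem whiskerLeft_counit_whiskerRight {P : C} (p : P ⟶ 𝟙_ C)
    (hp : p ▷ P ≫ (λ_ P).hom = P ◁ p ≫ (ρ_ P).hom) (A : C) :
    (A ◁ p ≫ (ρ_ A).hom) ▷ P = (A ⊗ P) ◁ p ≫ (ρ_ (A ⊗ P)).hom := by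
  calc (A ◁ p ≫ (ρ_ A).hom) ▷ P = (α_ A P P).hom ≫ A ◁ (p ▷ P ≫ (λ_ P).hom) := by simp
    _ = (A ⊗ P) ◁ p ≫ (ρ_ (A ⊗ P)).hom := by rw [hp]; simp

theorem isIso_whiskerLeft_counit_of_iso {P : C} (p : P ⟶ 𝟙_ C)
    (h : IsIso (P ◁ p ≫ (ρ_ P).hom)) {Z A : C} (e : Z ≅ A ⊗ P) :
    IsIso (Z ◁ p ≫ (ρ_ Z).hom) := by
  have : Z ◁ p ≫ (ρ_ Z).hom = e.hom ▷ P ≫ (α_ A P P).hom ≫ A ◁ (P ◁ p ≫ (ρ_ P).hom) ≫ e.inv := by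
    rw [← cancel_mono e.hom, Category.assoc, ← rightUnitor_naturality, whisker_exchange_assoc]
    simp
  rw [this]
  infer_instance

theorem eq_of_comp_whiskerLeft_counit_eq {P : C} (p : P ⟶ 𝟙_ C)
    (hp : p ▷ P ≫ (λ_ P).hom = P ◁ p ≫ (ρ_ P).hom) {Z A : C}
    [Epi (Z ◁ p ≫ (ρ_ Z).hom)] {f g : Z ⟶ A ⊗ P}
    (h : f ≫ A ◁ p ≫ (ρ_ A).hom = g ≫ A ◁ p ≫ (ρ_ A).hom) : f = g := by
  have precomp (k : Z ⟶ A ⊗ P) :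
      (Z ◁ p ≫ (ρ_ Z).hom) ≫ k = (k ≫ A ◁ p ≫ (ρ_ A).hom) ▷ P := by
    rw [comp_whiskerRight, whiskerLeft_counit_whiskerRight p hp, ← whisker_exchange_assoc,
      Category.assoc, rightUnitor_naturality]
  rw [← cancel_epi (Z ◁ p ≫ (ρ_ Z).hom), precomp, precomp, h]

namespace CentralIdempotent

/-- The central idempotent on `p : P ⟶ I` given by isomorphisms `P ⊗ A ≅ A ⊗ P` over `A`, whose
naturality and hexagon can be checked after the cancellable `A ⊗ p : A ⊗ P ⟶ A`. -/
def ofBraid {P : C} (p : P ⟶ 𝟙_ C)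
    (hp : p ▷ P ≫ (λ_ P).hom = P ◁ p ≫ (ρ_ P).hom) (h : IsIso (P ◁ p ≫ (ρ_ P).hom))
    (β : ∀ A : C, P ⊗ A ≅ A ⊗ P)
    (hβ : ∀ A : C, (β A).hom ≫ A ◁ p ≫ (ρ_ A).hom = p ▷ A ≫ (λ_ A).hom) :
    CentralIdempotent C where
  obj := P
  σ :=
    { β := β
      monoidal := fun A B => by
        have := isIso_whiskerLeft_counit_of_iso p h (β (A ⊗ B))
        apply eq_of_comp_whiskerLeft_counit_eq p hp
        have left : (α_ A B P).inv ≫ (A ⊗ B) ◁ p ≫ (ρ_ (A ⊗ B)).hom =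
            A ◁ (B ◁ p ≫ (ρ_ B).hom) := by simp
        have right : (α_ A P B).hom ≫ A ◁ (p ▷ B ≫ (λ_ B).hom) =
            (A ◁ p ≫ (ρ_ A).hom) ▷ B := by simp
        simp only [Category.assoc]
        rw [hβ, left, ← MonoidalCategory.whiskerLeft_comp, hβ, right, ← comp_whiskerRight, hβ]
        simp
      naturality := fun {A B} f => by
        have := isIso_whiskerLeft_counit_of_iso p h (β A)
        apply eq_of_comp_whiskerLeft_counit_eq p hp
        rw [Category.assoc, hβ, Category.assoc, ← whisker_exchange_assoc, rightUnitor_naturality,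
          reassoc_of% (hβ A), ← leftUnitor_naturality, whisker_exchange_assoc] }
  counit := p
  isCentral := ⟨by rwa [hp], hp, hβ⟩

/-- Transport of a central idempotent along an isomorphism. -/
def ofIso {P : C} (u : CentralIdempotent C) (e : P ≅ u.obj) : CentralIdempotent C :=
  have left : (e.hom ≫ u.counit) ▷ P ≫ (λ_ P).hom =
      (e.hom ⊗ₘ e.hom) ≫ (u.counit ▷ u.obj ≫ (λ_ u.obj).hom) ≫ e.inv := by
    rw [← Category.assoc, Iso.eq_comp_inv, MonoidalCategory.tensorHom_def]
    simp only [Category.assoc, comp_whiskerRight, ← leftUnitor_naturality]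
    rw [whisker_exchange_assoc]
  have right : P ◁ (e.hom ≫ u.counit) ≫ (ρ_ P).hom =
      (e.hom ⊗ₘ e.hom) ≫ (u.obj ◁ u.counit ≫ (ρ_ u.obj).hom) ≫ e.inv := by
    rw [← Category.assoc, Iso.eq_comp_inv, tensorHom_def']
    simp only [Category.assoc, MonoidalCategory.whiskerLeft_comp, ← rightUnitor_naturality]
    rw [whisker_exchange_assoc]
  have := u.isCentral.isIso
  ofBraid (e.hom ≫ u.counit)
    (by rw [left, right, u.isCentral.central])
    (by rw [right, ← u.isCentral.central]; infer_instance)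
    (fun A => whiskerRightIso e A ≪≫ u.σ.β A ≪≫ whiskerLeftIso A e.symm)
    (fun A => by
      simp only [Iso.trans_hom, whiskerRightIso_hom, whiskerLeftIso_hom, Iso.symm_hom,
        Category.assoc, comp_whiskerRight, ← u.isCentral.braid A]
      rw [← MonoidalCategory.whiskerLeft_comp_assoc, Iso.inv_hom_id_assoc])

variable (C) in
/-- The tensor unit as a central idempotent; it is the greatest one. -/
def unit : CentralIdempotent C :=
  ofBraid (𝟙 (𝟙_ C)) (by simp [unitors_equal]) inferInstance (fun A => λ_ A ≪≫ (ρ_ A).symm)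
    (fun A => by simp)

theorem le_unit (u : CentralIdempotent C) : u ≤ unit C :=
  ⟨.mk' u.counit (Category.comp_id _)⟩

theorem inf_counit (u v : CentralIdempotent C) :
    (u.inf v).counit = proj u.obj v ≫ u.counit := by
  simp only [proj, inf, tensorHom_def', unitors_equal]
  simp

theorem le_inf {u v w : CentralIdempotent C} (hu : w ≤ u) (hv : w ≤ v) : w ≤ u.inf v := by
  obtain ⟨m⟩ := hu
  obtain ⟨n⟩ := hv
  have := w.isCentral.isIso
  refine ⟨.mk' (inv (w.counit ▷ w.obj ≫ (λ_ w.obj).hom) ≫ (m.f ⊗ₘ n.f)) ?_⟩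
  change (inv (w.counit ▷ w.obj ≫ (λ_ w.obj).hom) ≫ (m.f ⊗ₘ n.f)) ≫
    (u.counit ⊗ₘ v.counit) ≫ (λ_ (𝟙_ C)).hom = _
  rw [Category.assoc, IsIso.inv_comp_eq, tensorHom_comp_tensorHom_assoc, m.w, n.w,
    MonoidalCategory.tensorHom_def]
  simp

theorem isGLB_inf (u v : CentralIdempotent C) : IsGLB {toZI u, toZI v} (toZI (u.inf v)) := by
  refine ⟨?_, fun a ha => ?_⟩
  · rintro _ (rfl | rfl)
    exacts [toZI_le_toZI.2 (inf_le_left u v), toZI_le_toZI.2 (inf_le_right u v)]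
  · induction a using Quotient.inductionOn with
    | h w => exact toZI_le_toZI.2 (le_inf (toZI_le_toZI.1 (ha (Or.inl rfl)))
        (toZI_le_toZI.1 (ha (Or.inr rfl))))

theorem Hom.isIso_of_ge {u v : CentralIdempotent C} (m : u.Hom v) (h : v ≤ u) : IsIso m.f := by
  obtain ⟨n⟩ := h
  exact ⟨n.f, congrArg Hom.f (Subsingleton.elim (m.comp n) (.id u)),
    congrArg Hom.f (Subsingleton.elim (n.comp m) (.id v))⟩

end CentralIdempotent

theorem toZI_surjective : Function.Surjective (toZI (C := C)) := Quotient.exists_rep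

theorem isIso_proj_tensor_right (A Z : C) (v : CentralIdempotent C) [IsIso (proj Z v)] :
    IsIso (proj (Z ⊗ A) v) := by
  rw [← swap_proj]
  infer_instance

theorem isIso_proj_of_le {Z : C} {u v : CentralIdempotent C} [IsIso (proj Z u)] (h : u ≤ v)
    [Mono (proj Z v)] : IsIso (proj Z v) := by
  obtain ⟨m⟩ := h
  have : IsSplitEpi (proj Z v) := ⟨⟨inv (proj Z u) ≫ Z ◁ m.f, by simp [whiskerLeft_hom_proj]⟩⟩
  exact isIso_of_mono_of_isSplitEpi _

theorem associator_hom_proj_inf (A : C) (u v : CentralIdempotent C) :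
    (α_ A u.obj v.obj).hom ≫ proj A (u.inf v) = proj (A ⊗ u.obj) v ≫ proj A u := by
  simp only [proj, CentralIdempotent.inf, MonoidalCategory.tensorHom_def', unitors_equal]
  simp

theorem associator_inv_proj_proj (A : C) (u v : CentralIdempotent C) :
    (α_ A u.obj v.obj).inv ≫ proj (A ⊗ u.obj) v ≫ proj A u = proj A (u.inf v) := by
  rw [← associator_hom_proj_inf]
  exact Iso.inv_hom_id_assoc _ _

theorem isIso_proj_inf (Z : C) (u v : CentralIdempotent C) [IsIso (proj Z u)] [IsIso (proj Z v)] :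
    IsIso (proj Z (u.inf v)) := by
  have := isIso_proj_tensor_right u.obj Z v
  rw [← associator_inv_proj_proj]
  exact IsIso.comp_isIso' (Iso.isIso_inv _) inferInstance

/-! ### Restriction to a central idempotent -/

theorem restrictsTo_proj (A : C) (u : CentralIdempotent C) : RestrictsTo (proj A u) u :=
  restrictsTo_self u _

theorem restrictsTo_of_isIso_proj {Z B : C} (f : Z ⟶ B) (u : CentralIdempotent C)
    [IsIso (proj Z u)] : RestrictsTo f u := by
  rw [← IsIso.inv_hom_id_assoc (proj Z u) f]
  exact ((restrictsTo_proj Z u).postcomp f).precomp _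

theorem restrictsTo_counit_iff {u v : CentralIdempotent C} : RestrictsTo u.counit v ↔ u ≤ v := by
  constructor
  · rintro ⟨g, hg⟩
    exact ⟨.mk' (g ≫ (λ_ _).hom) (by simp [← hg, proj, ← unitors_equal])⟩
  · rintro ⟨m⟩
    exact ⟨m.f ≫ (λ_ _).inv, by simp [← m.w, proj, ← unitors_equal]⟩

theorem restrictsTo_proj_tensorUnit_iff {u v : CentralIdempotent C} :
    RestrictsTo (proj (𝟙_ C) u) v ↔ u ≤ v := by
  have proj_eq : proj (𝟙_ C) u = (λ_ u.obj).hom ≫ u.counit := by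
    rw [proj, ← unitors_equal, leftUnitor_naturality]
  rw [proj_eq, ← restrictsTo_counit_iff]
  refine ⟨fun h => ?_, fun h => h.precomp _⟩
  have := h.precomp (λ_ u.obj).inv
  rwa [Iso.inv_hom_id_assoc] at this

theorem RestrictsTo.inf [IsStiff C] {Z A : C} {f : Z ⟶ A} {u v : CentralIdempotent C}
    (hu : RestrictsTo f u) (hv : RestrictsTo f v) : RestrictsTo f (u.inf v) := by
  obtain ⟨w, hwu, hwv, hw⟩ := hu.exists_inf hv
  exact hw.mono (CentralIdempotent.le_inf hwu hwv)

theorem restrictsTo_tensorHom_proj [IsStiff C] (A B : C) (u v : CentralIdempotent C) :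
    RestrictsTo (proj A u ⊗ₘ proj B v) (u.inf v) := by
  refine .inf ?_ ?_
  · rw [MonoidalCategory.tensorHom_def]
    exact ((restrictsTo_proj A u).whiskerRight _).postcomp _
  · rw [MonoidalCategory.tensorHom_def']
    exact ((restrictsTo_proj B v).whiskerLeft _).postcomp _

theorem exists_comp_tensorHom_proj_eq [IsStiff C] {Z A B : C} {f : Z ⟶ A ⊗ B}
    {u v : CentralIdempotent C} (hu : RestrictsTo f u) (hv : RestrictsTo f v) :
    ∃ g : Z ⟶ (A ⊗ u.obj) ⊗ B ⊗ v.obj, g ≫ (proj A u ⊗ₘ proj B v) = f := by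
  obtain ⟨g, hg⟩ := hu.inf hv
  have proj_proj : (α_ (A ⊗ u.obj) B v.obj).hom ≫ (proj A u ⊗ₘ proj B v) =
      proj ((A ⊗ u.obj) ⊗ B) v ≫ proj A u ▷ B := by
    rw [MonoidalCategory.tensorHom_def', proj_tensor, Category.assoc]
  have fac : ((α_ (A ⊗ B) u.obj v.obj).inv ≫ (swap A B u).hom ▷ v.obj ≫
      (α_ (A ⊗ u.obj) B v.obj).hom) ≫ (proj A u ⊗ₘ proj B v) = proj (A ⊗ B) (u.inf v) := by
    rw [← associator_inv_proj_proj, Category.assoc, Category.assoc, proj_proj,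
      proj_naturality_assoc, swap_proj]
  exact ⟨g ≫ _, (Category.assoc _ _ _).trans ((congrArg (g ≫ ·) fac).trans hg)⟩

theorem mono_tensorHom_proj [IsStiff C] (A B : C) (u v : CentralIdempotent C) :
    Mono (proj A u ⊗ₘ proj B v) := by
  have mono_whiskerRight : Mono (proj A u ▷ (B ⊗ v.obj)) := by
    rw [← swap_inv_proj]
    exact mono_comp _ _
  have mono_whiskerLeft : Mono (A ◁ proj B v) := by
    rw [← Iso.inv_hom_id_assoc (α_ A B v.obj) (A ◁ proj B v), ← proj_tensor]
    exact mono_comp _ _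
  rw [MonoidalCategory.tensorHom_def]
  exact mono_comp _ _

theorem isStiff_of_mono_of_restrictsTo_inf
    (hm : ∀ (A : C) (u : CentralIdempotent C), Mono (proj A u))
    (hr : ∀ {Z A : C} (f : Z ⟶ A) (u v : CentralIdempotent C), RestrictsTo f u → RestrictsTo f v →
      RestrictsTo f (u.inf v)) : IsStiff C where
  isPullback A u v := by
    have comm : proj A u ▷ v.obj ≫ proj A v = proj (A ⊗ u.obj) v ≫ proj A u :=
      proj_naturality _ _
    choose g hg using fun s : Limits.PullbackCone (proj A v) (proj A u) =>
      hr (s.snd ≫ proj A u) u v ⟨s.snd, rfl⟩ ⟨s.fst, s.condition⟩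
    have fac (s) : (g s ≫ (α_ A u.obj v.obj).inv) ≫ proj (A ⊗ u.obj) v ≫ proj A u =
        s.snd ≫ proj A u :=
      (Category.assoc _ _ _).trans
        ((congrArg (g s ≫ ·) (associator_inv_proj_proj A u v)).trans (hg s))
    refine ⟨⟨comm⟩, ⟨Limits.PullbackCone.IsLimit.mk comm
      (fun s => g s ≫ (α_ A u.obj v.obj).inv) (fun s => ?_) (fun s => ?_) fun s m _ hm' => ?_⟩⟩
    · rw [← cancel_mono (proj A v), Category.assoc, comm, fac, s.condition]
    · rw [← cancel_mono (proj A u), Category.assoc, fac]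
    · rw [← cancel_mono (proj (A ⊗ u.obj) v), ← cancel_mono (proj A u), hm', Category.assoc, fac]

end CentralIdempotents

/-! ### Universal joins -/

section UniversalJoins

variable {C : Type u} [Category.{v} C] [MonoidalCategory C]

/-- Sets of central idempotents that are closed under binary meets, up to equivalence. -/
def MeetClosed (S : Set (CentralIdempotent C)) : Prop :=
  ∀ u ∈ S, ∀ v ∈ S, ∃ w ∈ S, IsGLB {toZI u, toZI v} (toZI w)

/-- `j` is a universal upper bound of `S`: every `A ⊗ J` is the colimit of the `A ⊗ U`, `u ∈ S`. -/
structure IsUniversalJoin (S : Set (CentralIdempotent C)) (j : CentralIdempotent C) : Prop where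
  le : ∀ u ∈ S, u ≤ j
  isColimit : ∀ A : C, Nonempty (Limits.IsColimit (joinCocone A S j le))

theorem HasUniversalJoins.isUniversalJoin (h : HasUniversalJoins C)
    {S : Set (CentralIdempotent C)} (hS : MeetClosed S) {j : CentralIdempotent C}
    (hj : IsLUB (toZI '' S) (toZI j)) : IsUniversalJoin S j :=
  ⟨le_of_isLUB hj, h.isColimit S hS j hj⟩

theorem joinDiagram_map (A : C) {S : Set (CentralIdempotent C)} {u v : S} (f : u ⟶ v)
    (m : u.1.Hom v.1) : (joinDiagram A S).map f = A ◁ m.f := by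
  rw [Subsingleton.elim m (leHom (leOfHom f))]
  rfl

theorem joinCocone_ι_app (A : C) {S : Set (CentralIdempotent C)} {j : CentralIdempotent C}
    (h : ∀ u ∈ S, u ≤ j) {u : CentralIdempotent C} (hu : u ∈ S) (m : u.Hom j) :
    (joinCocone A S j h).ι.app ⟨u, hu⟩ = A ◁ m.f := by
  rw [Subsingleton.elim m (leHom (h u hu))]
  rfl

namespace IsUniversalJoin

variable {S : Set (CentralIdempotent C)} {j : CentralIdempotent C}

theorem of_existsUnique (le : ∀ u ∈ S, u ≤ j)
    (H : ∀ (A Y : C) (k : ∀ u ∈ S, A ⊗ u.obj ⟶ Y),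
      (∀ u v (hu : u ∈ S) (hv : v ∈ S) (m : u.Hom v), k u hu = A ◁ m.f ≫ k v hv) →
      ∃! f : A ⊗ j.obj ⟶ Y, ∀ u (hu : u ∈ S) (m : u.Hom j), A ◁ m.f ≫ f = k u hu) :
    IsUniversalJoin S j := by
  refine ⟨le, fun A => ⟨Limits.IsColimit.ofExistsUnique fun s => ?_⟩⟩
  obtain ⟨f, hf, huniq⟩ := H A s.pt (fun u hu => s.ι.app ⟨u, hu⟩) fun u v hu hv m => by
    rw [← joinDiagram_map A (homOfLE ⟨m⟩ : (⟨u, hu⟩ : S) ⟶ ⟨v, hv⟩) m]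
    exact (s.w _).symm
  refine ⟨f, fun u => ?_, fun d hd => huniq d fun u hu m => ?_⟩
  · obtain ⟨m⟩ := le u.1 u.2
    rw [joinCocone_ι_app A le u.2 m]
    exact hf u.1 u.2 m
  · rw [← joinCocone_ι_app A le hu m]
    exact hd ⟨u, hu⟩

variable (h : IsUniversalJoin S j)
include h

theorem hom_ext {A Y : C} {f g : A ⊗ j.obj ⟶ Y}
    (hfg : ∀ u ∈ S, ∀ m : u.Hom j, A ◁ m.f ≫ f = A ◁ m.f ≫ g) : f = g := by
  obtain ⟨colim⟩ := h.isColimit A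
  refine colim.hom_ext fun u => ?_
  obtain ⟨m⟩ := h.le u.1 u.2
  rw [joinCocone_ι_app A _ u.2 m]
  exact hfg u.1 u.2 m

theorem exists_desc {A Y : C} (k : ∀ u ∈ S, A ⊗ u.obj ⟶ Y)
    (hk : ∀ u v (hu : u ∈ S) (hv : v ∈ S) (m : u.Hom v), k u hu = A ◁ m.f ≫ k v hv) :
    ∃ f : A ⊗ j.obj ⟶ Y, ∀ u (hu : u ∈ S) (m : u.Hom j), A ◁ m.f ≫ f = k u hu := by
  obtain ⟨colim⟩ := h.isColimit A
  refine ⟨colim.desc ⟨Y, ⟨fun u => k u.1 u.2, fun u v f => ?_⟩⟩, fun u hu m => ?_⟩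
  · obtain ⟨m⟩ := leOfHom f
    rw [joinDiagram_map A f m]
    exact (hk _ _ u.2 v.2 m).symm.trans (Category.comp_id _).symm
  · rw [← joinCocone_ι_app A h.le hu m]
    exact colim.fac _ ⟨u, hu⟩

theorem hom_ext_of_isIso_proj {Z Y : C} [IsIso (proj Z j)] {f g : Z ⟶ Y}
    (hfg : ∀ u ∈ S, proj Z u ≫ f = proj Z u ≫ g) : f = g := by
  rw [← cancel_epi (proj Z j)]
  refine h.hom_ext fun u hu m => ?_
  rw [whiskerLeft_hom_proj_assoc, whiskerLeft_hom_proj_assoc, hfg u hu]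

theorem restrictsTo_of_forall [IsStiff C] {Z B : C} [IsIso (proj Z j)] {f : Z ⟶ B}
    {t : CentralIdempotent C} (hf : ∀ u ∈ S, RestrictsTo (proj Z u ≫ f) t) : RestrictsTo f t := by
  choose k hk using hf
  obtain ⟨g, hg⟩ := h.exists_desc k fun u v hu hv m => by
    rw [← cancel_mono (proj B t), Category.assoc, hk, hk, whiskerLeft_hom_proj_assoc]
  refine ⟨inv (proj Z j) ≫ g, ?_⟩
  rw [Category.assoc, IsIso.inv_comp_eq]
  refine h.hom_ext fun u hu m => ?_
  rw [reassoc_of% (hg u hu m), hk, whiskerLeft_hom_proj_assoc]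

theorem inf_le [IsStiff C] {T : Set (CentralIdempotent C)} {k t : CentralIdempotent C}
    (hk : IsUniversalJoin T k) (ht : ∀ u ∈ S, ∀ v ∈ T, u.inf v ≤ t) : j.inf k ≤ t := by
  have : IsIso (proj (j.inf k).obj j) := isIso_proj_obj_tensor k.obj j
  have : IsIso (proj (j.inf k).obj k) := inferInstanceAs (IsIso (proj (j.obj ⊗ k.obj) k))
  refine restrictsTo_counit_iff.1 (h.restrictsTo_of_forall fun u hu => ?_)
  have := isIso_proj_tensor_right u.obj (j.inf k).obj k
  refine hk.restrictsTo_of_forall fun v hv => .mono (.inf ?_ ?_) (ht u hu v hv)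
  · exact ((restrictsTo_proj _ u).postcomp _).precomp _
  · exact (restrictsTo_proj _ v).postcomp _

end IsUniversalJoin

theorem IsUniversalJoin.exists_desc_image {ι : Type*} {φ : ι → CentralIdempotent C} {T : Set ι}
    {j : CentralIdempotent C} (h : IsUniversalJoin (φ '' T) j) {A Y : C}
    (k : ∀ i ∈ T, A ⊗ (φ i).obj ⟶ Y)
    (hk : ∀ i i' (hi : i ∈ T) (hi' : i' ∈ T) (m : (φ i).Hom (φ i')),
      k i hi = A ◁ m.f ≫ k i' hi') :
    ∃ f : A ⊗ j.obj ⟶ Y, ∀ i (hi : i ∈ T) (m : (φ i).Hom j), A ◁ m.f ≫ f = k i hi := by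
  choose index index_mem index_eq using fun u (hu : u ∈ φ '' T) => hu
  have le (u) (hu : u ∈ φ '' T) : u ≤ φ (index u hu) := (index_eq u hu).ge
  obtain ⟨f, hf⟩ := h.exists_desc
    (fun u hu => A ◁ (leHom (le u hu)).f ≫ k (index u hu) (index_mem u hu))
    fun u v hu hv m => by
      have huv : u ≤ v := ⟨m⟩
      obtain ⟨n⟩ := (index_eq u hu).le.trans (huv.trans (le v hv))
      have comp_eq : (leHom (le u hu)).comp n = m.comp (leHom (le v hv)) := Subsingleton.elim _ _
      rw [hk _ _ (index_mem u hu) (index_mem v hv) n, ← MonoidalCategory.whiskerLeft_comp_assoc,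
        ← MonoidalCategory.whiskerLeft_comp_assoc]
      exact congrArg (A ◁ · ≫ _) (congrArg CentralIdempotent.Hom.f comp_eq)
  have hφ {i} (hi : i ∈ T) : φ i ∈ φ '' T := ⟨i, hi, rfl⟩
  exact ⟨f, fun i hi m => (hf _ (hφ hi) m).trans (hk _ _ hi (index_mem _ (hφ hi)) _).symm⟩

end UniversalJoins

namespace Completion

variable {C : Type u} [Category.{v} C] [MonoidalCategory C]

/-! ### Down-closed sets as central idempotents of the completion -/

/-- The morphism `f` restricts to some element of the down-closed set `L`: this is the local
condition on the components of a morphism of the completion. -/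
def RestrictsInto {Z B : C} (f : Z ⟶ B) (L : LowerSet (ZI C)) : Prop :=
  ∃ v : CentralIdempotent C, toZI v ∈ L ∧ RestrictsTo f v

variable [IsStiff C]

theorem RestrictsInto.inf {Z B : C} {f : Z ⟶ B} {L M : LowerSet (ZI C)}
    (hL : RestrictsInto f L) (hM : RestrictsInto f M) : RestrictsInto f (L ⊓ M) := by
  obtain ⟨v, hv, fv⟩ := hL
  obtain ⟨w, hw, fw⟩ := hM
  exact ⟨v.inf w, ⟨L.lower (toZI_le_toZI.2 (v.inf_le_left w)) hv,
    M.lower (toZI_le_toZI.2 (v.inf_le_right w)) hw⟩, fv.inf fw⟩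

theorem app_congr {X Y : Completion C} {η ζ : X ⟶ Y} (h : η = ζ) (u : CentralIdempotent C)
    (hu : toZI u ∈ X.D) : Hom.app η u hu = Hom.app ζ u hu := by rw [h]

theorem ofHom_comp_eq {X Y Z : Completion C} {h : X.D ≤ Y.D} {f : X.A ⟶ Y.A} {h' : Y.D ≤ Z.D}
    {g : Y.A ⟶ Z.A} {e : X.A ⟶ Z.A} (k : X.D ≤ Z.D) (he : f ≫ g = e) :
    (ofHom h f : X ⟶ Y) ≫ (ofHom h' g : Y ⟶ Z) = ofHom k e := by
  rw [ofHom_comp_ofHom, he]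

theorem ofHom_comp_eq_comp {X Y Y' Z : Completion C} {f : X.A ⟶ Y.A} {g : Y.A ⟶ Z.A}
    {f' : X.A ⟶ Y'.A} {g' : Y'.A ⟶ Z.A} (h : X.D ≤ Y.D) (h' : Y.D ≤ Z.D) (k : X.D ≤ Y'.D)
    (k' : Y'.D ≤ Z.D) (he : f ≫ g = f' ≫ g') :
    (ofHom h f : X ⟶ Y) ≫ (ofHom h' g : Y ⟶ Z) =
      (ofHom k f' : X ⟶ Y') ≫ (ofHom k' g' : Y' ⟶ Z) := by
  rw [ofHom_comp_ofHom, ofHom_comp_ofHom, he]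

theorem isIso_ofHom {X Y : Completion C} (h : X.D = Y.D) (f : X.A ⟶ Y.A) [IsIso f] :
    IsIso (ofHom h.le f : X ⟶ Y) :=
  (ofIso h (asIso f)).isIso_hom

instance mono_ofHom {X Y : Completion C} (h : X.D ≤ Y.D) (f : X.A ⟶ Y.A) [Mono f] :
    Mono (ofHom h f : X ⟶ Y) := ⟨fun p q hpq => by
  ext u hu
  have := app_congr hpq u hu
  rwa [comp_ofHom_app, comp_ofHom_app, cancel_mono] at this⟩

/-- The inclusion `⟨L, A⟩ ⟶ ⟨M, A⟩` for `L ⊆ M`. -/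
abbrev incl {L M : LowerSet (ZI C)} (h : L ≤ M) (A : C) : (⟨L, A⟩ : Completion C) ⟶ ⟨M, A⟩ :=
  ofHom h (𝟙 A)

theorem incl_comp_incl {L M N : LowerSet (ZI C)} (h : L ≤ M) (h' : M ≤ N) (A : C) :
    incl h A ≫ incl h' A = incl (h.trans h') A :=
  ofHom_comp_eq _ (Category.comp_id _)

theorem exists_comp_incl_eq {Z : Completion C} {L M : LowerSet (ZI C)} (h : L ≤ M) {A : C}
    (f : Z ⟶ ⟨M, A⟩)
    (hf : ∀ (u : CentralIdempotent C) (hu : toZI u ∈ Z.D), RestrictsInto (Hom.app f u hu) L) :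
    ∃ g : Z ⟶ ⟨L, A⟩, g ≫ incl h A = f := by
  refine ⟨({ app := fun u hu => Hom.app f u hu, restricts := hf,
             compat := Hom.compat f } : Hom Z ⟨L, A⟩), ?_⟩
  ext u hu
  rw [comp_ofHom_app]
  exact Category.comp_id _

/-- The subobject `⟨L, I⟩ ⟶ ⟨ZI, I⟩` of the unit of the completion. -/
def idemCounit (L : LowerSet (ZI C)) : (⟨L, 𝟙_ C⟩ : Completion C) ⟶ 𝟙_ (Completion C) :=
  (ofHom le_top (𝟙 (𝟙_ C)) : (⟨L, 𝟙_ C⟩ : Completion C) ⟶ unitObj C)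

theorem whiskerLeft_idemCounit_rightUnitor (X : Completion C) (L : LowerSet (ZI C)) :
    X ◁ idemCounit L ≫ (ρ_ X).hom =
      (ofHom inf_le_left (ρ_ X.A).hom : tensor X ⟨L, 𝟙_ C⟩ ⟶ X) := by
  rw [idemCounit, whiskerLeft_ofHom, rightUnitor_hom]
  have h : X.A ◁ 𝟙 (𝟙_ C) ≫ (ρ_ X.A).hom = (ρ_ X.A).hom := by simp
  exact ofHom_comp_eq _ h

theorem idemCounit_whiskerRight_leftUnitor (L : LowerSet (ZI C)) (X : Completion C) :
    idemCounit L ▷ X ≫ (λ_ X).hom =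
      (ofHom inf_le_right (λ_ X.A).hom : tensor ⟨L, 𝟙_ C⟩ X ⟶ X) := by
  rw [idemCounit, whiskerRight_ofHom, leftUnitor_hom]
  have h : 𝟙 (𝟙_ C) ▷ X.A ≫ (λ_ X.A).hom = (λ_ X.A).hom := by simp
  exact ofHom_comp_eq _ h

/-- The central idempotent `⟨L, I⟩ ⟶ ⟨ZI, I⟩` of a down-closed set `L`. -/
noncomputable def idem (L : LowerSet (ZI C)) : CentralIdempotent (Completion C) :=
  .ofBraid (idemCounit L)
    (by
      rw [idemCounit_whiskerRight_leftUnitor, whiskerLeft_idemCounit_rightUnitor]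
      exact congrArg (ofHom _) unitors_equal)
    (by
      rw [whiskerLeft_idemCounit_rightUnitor]
      exact isIso_ofHom (X := tensor ⟨L, 𝟙_ C⟩ ⟨L, 𝟙_ C⟩) (Y := ⟨L, 𝟙_ C⟩) (inf_idem L)
        (ρ_ (𝟙_ C)).hom)
    (fun X => ofIso (X := tensor ⟨L, 𝟙_ C⟩ X) (Y := tensor X ⟨L, 𝟙_ C⟩) (inf_comm L X.D)
      (λ_ X.A ≪≫ (ρ_ X.A).symm))
    (fun X => by
      rw [whiskerLeft_idemCounit_rightUnitor, idemCounit_whiskerRight_leftUnitor]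
      have h : (λ_ X.A ≪≫ (ρ_ X.A).symm).hom ≫ (ρ_ X.A).hom = (λ_ X.A).hom := by simp
      exact ofHom_comp_eq (h := (inf_comm L X.D).le) _ h)

/-- The isomorphism between `⟨D, A⟩ ⊗ ⟨L, I⟩` and `⟨D ∩ L, A⟩`. -/
def tensorIdemIso (X : Completion C) (L : LowerSet (ZI C)) :
    X ⊗ (idem L).obj ≅ ⟨X.D ⊓ L, X.A⟩ :=
  ofIso (X := tensor X ⟨L, 𝟙_ C⟩) (Y := ⟨X.D ⊓ L, X.A⟩) rfl (ρ_ X.A)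

theorem proj_idem (X : Completion C) (L : LowerSet (ZI C)) :
    proj X (idem L) = (tensorIdemIso X L).hom ≫ incl inf_le_left X.A :=
  (whiskerLeft_idemCounit_rightUnitor X L).trans
    (ofHom_comp_eq (X := tensor X ⟨L, 𝟙_ C⟩) (Y := ⟨X.D ⊓ L, X.A⟩) (h := le_rfl) inf_le_left
      (Category.comp_id (ρ_ X.A).hom)).symm

theorem restrictsTo_idem_iff {Z X : Completion C} (f : Z ⟶ X) (L : LowerSet (ZI C)) :
    RestrictsTo f (idem L) ↔
      ∀ (u : CentralIdempotent C) (hu : toZI u ∈ Z.D), RestrictsInto (Hom.app f u hu) L := by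
  constructor
  · rintro ⟨g, rfl⟩ u hu
    obtain ⟨v, hv, h⟩ := Hom.restricts (g ≫ (tensorIdemIso X L).hom) u hu
    rw [proj_idem, ← Category.assoc, comp_ofHom_app]
    exact ⟨v, mem_right hv, h.postcomp _⟩
  · intro h
    obtain ⟨g, hg⟩ := exists_comp_incl_eq (inf_le_left : X.D ⊓ L ≤ X.D) (A := X.A) f
      fun u hu => .inf (Hom.restricts f u hu) (h u hu)
    refine ⟨g ≫ (tensorIdemIso X L).inv, ?_⟩
    rw [proj_idem, Category.assoc, Iso.inv_hom_id_assoc]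
    exact hg

theorem idem_le_idem {L M : LowerSet (ZI C)} : idem L ≤ idem M ↔ L ≤ M := by
  have app_counit (u : CentralIdempotent C) (hu : toZI u ∈ L) :
      Hom.app (idem L).counit u hu = proj (𝟙_ C) u :=
    Category.comp_id _
  have app_restrictsTo_iff (u v : CentralIdempotent C) (hu : toZI u ∈ L) :
      RestrictsTo (Hom.app (idem L).counit u hu) v ↔ u ≤ v := by
    rw [app_counit]
    exact restrictsTo_proj_tensorUnit_iff
  rw [← restrictsTo_counit_iff, restrictsTo_idem_iff]
  constructor
  · intro h a ha
    obtain ⟨u, rfl⟩ := toZI_surjective a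
    obtain ⟨v, hv, huv⟩ := h u ha
    exact M.lower (toZI_le_toZI.2 ((app_restrictsTo_iff u v ha).1 huv)) hv
  · exact fun h u hu => ⟨u, h hu, (app_restrictsTo_iff u u hu).2 le_rfl⟩

end Completion

/-! ### Lax monoidal functors and central idempotents -/

section LaxFunctors

universe v₁ v₂ u₁ u₂

open Functor.LaxMonoidal

variable {C : Type u₁} [Category.{v₁} C] [MonoidalCategory C]
  {D : Type u₂} [Category.{v₂} D] [MonoidalCategory D] (F : C ⥤ D) [F.LaxMonoidal]

theorem μ_map_whiskerLeft_rightUnitor [IsIso (ε F)] (A : C) {P : C} (p : P ⟶ 𝟙_ C) :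
    μ F A P ≫ F.map (A ◁ p ≫ (ρ_ A).hom) =
      F.obj A ◁ (F.map p ≫ inv (ε F)) ≫ (ρ_ (F.obj A)).hom := by
  rw [F.map_comp, ← μ_natural_right_assoc, MonoidalCategory.whiskerLeft_comp, Category.assoc,
    right_unitality, ← MonoidalCategory.whiskerLeft_comp_assoc (F.obj A) (inv (ε F)),
    IsIso.inv_hom_id, MonoidalCategory.whiskerLeft_id, Category.id_comp]

theorem μ_map_whiskerRight_leftUnitor [IsIso (ε F)] (A : C) {P : C} (p : P ⟶ 𝟙_ C) :
    μ F P A ≫ F.map (p ▷ A ≫ (λ_ A).hom) =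
      (F.map p ≫ inv (ε F)) ▷ F.obj A ≫ (λ_ (F.obj A)).hom := by
  rw [F.map_comp, ← μ_natural_left_assoc, comp_whiskerRight, Category.assoc,
    left_unitality, ← comp_whiskerRight_assoc (inv (ε F)),
    IsIso.inv_hom_id, id_whiskerRight, Category.id_comp]

theorem braid_comp_μ_of_isCentralIdempotent [IsIso (ε F)] (A : C) (u : CentralIdempotent C)
    [IsIso (μ F A u.obj)] {τ : HalfBraiding (F.obj u.obj)}
    (hτ : IsCentralIdempotent τ (F.map u.counit ≫ inv (ε F))) :
    (τ.β (F.obj A)).hom ≫ μ F A u.obj = μ F u.obj A ≫ F.map (u.σ.β A).hom := by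
  let w : CentralIdempotent D := ⟨F.obj u.obj, τ, _, hτ⟩
  have : IsIso (proj (F.obj u.obj ⊗ F.obj A) w) := isIso_proj_obj_tensor (F.obj A) w
  have proj_eq : proj (F.obj A) w = μ F A u.obj ≫ F.map (proj A u) :=
    (μ_map_whiskerLeft_rightUnitor F A u.counit).symm
  rw [← cancel_mono (inv (μ F A u.obj)), Category.assoc, IsIso.hom_inv_id, Category.comp_id]
  apply cancel_proj w
  refine (hτ.braid (F.obj A)).trans ?_
  rw [proj_eq, Category.assoc, IsIso.inv_hom_id_assoc, Category.assoc, ← F.map_comp]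
  refine (μ_map_whiskerRight_leftUnitor F A u.counit).symm.trans ?_
  rw [← u.isCentral.braid A]
  rfl

namespace PreservesCentralIdempotents

variable {F}

theorem of_iso (isIso_ε : IsIso (ε F))
    (isIso_μ : ∀ (A : C) (u : CentralIdempotent C), IsIso (μ F A u.obj))
    (exists_iso : ∀ u : CentralIdempotent C, ∃ (w : CentralIdempotent D) (e : F.obj u.obj ≅ w.obj),
      e.hom ≫ w.counit = F.map u.counit ≫ inv (ε F)) : PreservesCentralIdempotents F where
  isIso_ε := isIso_ε
  isIso_μ := isIso_μ
  exists_halfBraiding u := by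
    obtain ⟨w, e, he⟩ := exists_iso u
    have isCentral : IsCentralIdempotent (w.ofIso e).σ (F.map u.counit ≫ inv (ε F)) :=
      he ▸ (w.ofIso e).isCentral
    refine ⟨_, fun A => ?_, isCentral⟩
    have := isIso_μ A u
    exact braid_comp_μ_of_isCentralIdempotent F A u isCentral

theorem of_forall_exists_toZI_eq (isIso_ε : IsIso (ε F))
    (H : ∀ u : CentralIdempotent C, ∃ v : CentralIdempotent C, toZI v = toZI u ∧
      (∀ A : C, IsIso (μ F A v.obj)) ∧ ∃ (w : CentralIdempotent D) (e : F.obj v.obj ≅ w.obj),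
        e.hom ≫ w.counit ≫ ε F = F.map v.counit) : PreservesCentralIdempotents F := by
  refine .of_iso isIso_ε (fun A u => ?_) fun u => ?_ <;>
    obtain ⟨v, hv, isIso_μ, w, e, he⟩ := H u <;>
    obtain ⟨m, isIso_m⟩ := toZI_eq_iff.1 hv
  · have natural := μ_natural_right F A m.f
    have := isIso_μ A
    have isIso_comp : IsIso (F.obj A ◁ F.map m.f ≫ μ F A u.obj) := by
      rw [natural]
      infer_instance
    exact (isIso_comp_left_iff _ _).1 isIso_comp
  · refine ⟨w, (F.mapIso (asIso m.f)).symm ≪≫ e, ?_⟩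
    rw [IsIso.eq_comp_inv, Iso.trans_hom, Category.assoc, Category.assoc, he]
    simp [← m.w]

variable (h : PreservesCentralIdempotents F)
include h

theorem μ_map_proj (A : C) (u : CentralIdempotent C) :
    μ F A u.obj ≫ F.map (proj A u) = proj (F.obj A) (h.map u) := by
  have := h.isIso_ε
  exact μ_map_whiskerLeft_rightUnitor F A u.counit

/-- The coherence isomorphism `F A ⊗ F U ≅ F (A ⊗ U)`. -/
noncomputable def μIso (A : C) (u : CentralIdempotent C) :
    F.obj A ⊗ (h.map u).obj ≅ F.obj (A ⊗ u.obj) :=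
  @asIso D _ (F.obj A ⊗ F.obj u.obj) _ (μ F A u.obj) (h.isIso_μ A u)

theorem μIso_map_proj (A : C) (u : CentralIdempotent C) :
    (h.μIso A u).hom ≫ F.map (proj A u) = proj (F.obj A) (h.map u) :=
  h.μ_map_proj A u

theorem map_counit_comp_ε (u : CentralIdempotent C) :
    (h.map u).counit ≫ ε F = F.map u.counit := by
  simp [PreservesCentralIdempotents.map]

theorem map_mono {u v : CentralIdempotent C} (huv : u ≤ v) : h.map u ≤ h.map v := by
  obtain ⟨m⟩ := huv
  have := h.isIso_ε
  exact ⟨.mk' (F.map m.f) (by simp [PreservesCentralIdempotents.map, ← F.map_comp_assoc, m.w])⟩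

theorem toZI_map_congr {u v : CentralIdempotent C} (huv : toZI u = toZI v) :
    toZI (h.map u) = toZI (h.map v) :=
  le_antisymm (toZI_le_toZI.2 (h.map_mono (toZI_le_toZI.1 huv.le)))
    (toZI_le_toZI.2 (h.map_mono (toZI_le_toZI.1 huv.ge)))

theorem toZI_map_inf (u v : CentralIdempotent C) :
    toZI (h.map (u.inf v)) = toZI ((h.map u).inf (h.map v)) := by
  have := h.isIso_μ u.obj v
  refine h.toZI_map_eq _ _ (asIso (μ F u.obj v.obj)).symm ?_
  have counit_eq : ((h.map u).inf (h.map v)).counit ≫ ε F =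
      μ F u.obj v.obj ≫ F.map (u.inf v).counit := by
    have left : (proj (h.map u).obj (h.map v) ≫ (h.map u).counit) ≫ ε F =
        proj (F.obj u.obj) (h.map v) ≫ F.map u.counit :=
      (Category.assoc _ _ _).trans (congrArg (_ ≫ ·) (h.map_counit_comp_ε u))
    have right : (μ F u.obj v.obj ≫ F.map (proj u.obj v)) ≫ F.map u.counit =
        μ F u.obj v.obj ≫ F.map (proj u.obj v ≫ u.counit) := by
      rw [Category.assoc, ← F.map_comp]
    rw [CentralIdempotent.inf_counit, CentralIdempotent.inf_counit]
    exact left.trans ((congrArg (· ≫ F.map u.counit) (h.μ_map_proj u.obj v).symm).trans right)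
  exact (congrArg (inv (μ F u.obj v.obj) ≫ ·) counit_eq).trans
    (IsIso.inv_hom_id_assoc (μ F u.obj v.obj) _)

theorem meetClosed_image {S : Set (CentralIdempotent C)} (hS : MeetClosed S) :
    MeetClosed (h.map '' S) := by
  rintro _ ⟨u, hu, rfl⟩ _ ⟨v, hv, rfl⟩
  obtain ⟨w, hw, glb⟩ := hS u hu v hv
  refine ⟨_, ⟨w, hw, rfl⟩, ?_⟩
  rw [h.toZI_map_congr (glb.unique (CentralIdempotent.isGLB_inf u v)), h.toZI_map_inf]
  exact CentralIdempotent.isGLB_inf _ _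

end PreservesCentralIdempotents

theorem exists_centralIdempotent_of_map [F.Full] [F.Faithful] [IsIso (ε F)]
    [∀ A B, IsIso (μ F A B)] {P : C} (p : P ⟶ 𝟙_ C) (w : CentralIdempotent D)
    (e : F.obj P ≅ w.obj) (he : e.hom ≫ w.counit = F.map p ≫ inv (ε F)) :
    ∃ u : CentralIdempotent C, ∃ e' : P ≅ u.obj, e'.hom ≫ u.counit = p := by
  obtain ⟨τ, hτ⟩ : ∃ τ : HalfBraiding (F.obj P), IsCentralIdempotent τ (F.map p ≫ inv (ε F)) :=
    ⟨(w.ofIso e).σ, he ▸ (w.ofIso e).isCentral⟩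
  have central : p ▷ P ≫ (λ_ P).hom = P ◁ p ≫ (ρ_ P).hom := F.map_injective <| by
    rw [← cancel_epi (μ F P P), μ_map_whiskerRight_leftUnitor, μ_map_whiskerLeft_rightUnitor,
      hτ.central]
  have isIso_counit : IsIso (P ◁ p ≫ (ρ_ P).hom) := by
    have := hτ.isIso
    rw [← μ_map_whiskerRight_leftUnitor, central, isIso_comp_left_iff] at this
    exact isIso_of_fully_faithful F _
  refine ⟨.ofBraid p central isIso_counit (fun A => F.preimageIso ((asIso (μ F P A)).symm ≪≫
    τ.β (F.obj A) ≪≫ asIso (μ F A P))) (fun A => F.map_injective ?_), Iso.refl _,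
    Category.id_comp _⟩
  have braid := hτ.braid (F.obj A)
  rw [← μ_map_whiskerLeft_rightUnitor, ← μ_map_whiskerRight_leftUnitor] at braid
  rw [F.map_comp]
  simpa using braid

end LaxFunctors

namespace Completion

variable {C : Type u} [Category.{v} C] [MonoidalCategory C] [IsStiff C]

/-! ### Gluing morphisms of the completion -/

section Glue

variable {ι : Type*} {M : ι → LowerSet (ZI C)} {L : LowerSet (ZI C)} (hM : ∀ i, M i ≤ L)
  (hL : ∀ a ∈ L, ∃ i, a ∈ M i) {A : C} {Y : Completion C}
include hL

theorem hom_ext_of_cover {f g : (⟨L, A⟩ : Completion C) ⟶ Y}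
    (h : ∀ i, incl (hM i) A ≫ f = incl (hM i) A ≫ g) : f = g := by
  ext u hu
  obtain ⟨i, hi⟩ := hL _ hu
  have := app_congr (h i) u hi
  rw [ofHom_comp_app, ofHom_comp_app] at this
  simpa using this

theorem exists_glue_of_cover (f : ∀ i, (⟨M i, A⟩ : Completion C) ⟶ Y)
    (hf : ∀ i k, incl (inf_le_left : M i ⊓ M k ≤ M i) A ≫ f i = incl inf_le_right A ≫ f k) :
    ∃ g : (⟨L, A⟩ : Completion C) ⟶ Y, ∀ i, incl (hM i) A ≫ g = f i := by
  have app_eq (i k) (u : CentralIdempotent C) (hi : toZI u ∈ M i) (hk : toZI u ∈ M k) :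
      Hom.app (f i) u hi = Hom.app (f k) u hk := by
    have mem : toZI u ∈ (⟨M i ⊓ M k, A⟩ : Completion C).D := ⟨hi, hk⟩
    have := app_congr (hf i k) u mem
    rwa [ofHom_comp_app, ofHom_comp_app, id_whiskerRight, Category.id_comp, Category.id_comp]
      at this
  choose idx hidx using hL
  refine ⟨({ app := fun u hu => Hom.app (f (idx _ hu)) u (hidx _ hu)
             restricts := fun u hu => Hom.restricts (f (idx _ hu)) u (hidx _ hu)
             compat := fun u u' m hu hu' => ?_ } : Hom ⟨L, A⟩ Y), fun i => ?_⟩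
  · have h := (M (idx _ hu')).lower (toZI_le_toZI.2 ⟨m⟩) (hidx _ hu')
    rw [app_eq _ (idx _ hu') u _ h]
    exact Hom.compat _ _ _ m _ _
  · ext u hu
    rw [ofHom_comp_app, id_whiskerRight, Category.id_comp]
    exact app_eq _ _ u (hidx _ (hM i hu)) hu

end Glue

/-! ### The embedding -/

/-- The image of a morphism of `C` under the embedding. -/
abbrev topHom {A B : C} (f : A ⟶ B) : (⟨⊤, A⟩ : Completion C) ⟶ ⟨⊤, B⟩ :=
  ofHom (le_refl (⊤ : LowerSet (ZI C))) f

/-- The monomorphism `⟨D, A⟩ ⟶ ⟨ZI, A⟩`. -/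
abbrev toTop (X : Completion C) : X ⟶ ⟨⊤, X.A⟩ := incl le_top X.A

instance : IsIso (Functor.LaxMonoidal.ε (embeddingFunctor (C := C))) :=
  inferInstanceAs (IsIso (𝟙 (unitObj C)))

instance (A B : C) : IsIso (Functor.LaxMonoidal.μ (embeddingFunctor (C := C)) A B) :=
  isIso_ofHom (X := tensor ⟨⊤, A⟩ ⟨⊤, B⟩) (Y := ⟨⊤, A ⊗ B⟩) (inf_top_eq _) (𝟙 (A ⊗ B))

theorem comp_inv_ε {X : Completion C} (f : X ⟶ (embeddingFunctor (C := C)).obj (𝟙_ C)) :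
    f ≫ inv (Functor.LaxMonoidal.ε (embeddingFunctor (C := C))) = f :=
  (IsIso.comp_inv_eq _).2 (Category.comp_id f).symm

theorem topHom_app_unit {A B : C} (f : (⟨⊤, A⟩ : Completion C) ⟶ ⟨⊤, B⟩) :
    topHom ((ρ_ A).inv ≫ Hom.app f (.unit C) trivial) = f := by
  ext u hu
  obtain ⟨m⟩ := u.le_unit
  rw [Hom.compat f u _ m hu trivial, ofHom_app]
  have : m.f = u.counit := m.w ▸ (Category.comp_id _).symm
  rw [this, proj, Category.assoc]
  exact congrArg _ (Iso.hom_inv_id_assoc _ _)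

theorem topHom_injective {A B : C} : Function.Injective (topHom : (A ⟶ B) → _) := fun f g h => by
  have app_eq : proj A (.unit C) ≫ f = proj A (.unit C) ≫ g := app_congr h (.unit C) trivial
  have : IsIso (proj A (.unit C)) := inferInstanceAs (IsIso (A ◁ 𝟙 _ ≫ (ρ_ A).hom))
  exact (cancel_epi _).1 app_eq

instance : (embeddingFunctor (C := C)).Full where
  map_surjective f := ⟨_, topHom_app_unit f⟩

instance : (embeddingFunctor (C := C)).Faithful where
  map_injective h := topHom_injective h

theorem exists_iso_comp_toTop_eq (A : C) (a : CentralIdempotent C) {L : LowerSet (ZI C)}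
    (hL : IsGreatest (L : Set (ZI C)) (toZI a)) :
    ∃ e : (⟨⊤, A ⊗ a.obj⟩ : Completion C) ≅ ⟨L, A⟩, e.hom ≫ toTop ⟨L, A⟩ = topHom (proj A a) := by
  have le (w) (hw : toZI w ∈ L) : w ≤ a := toZI_le_toZI.1 (hL.2 hw)
  obtain ⟨f, hf⟩ := exists_comp_incl_eq (le_top : L ≤ ⊤) (A := A) (topHom (proj A a))
    fun u hu => ⟨a, hL.1, (restrictsTo_proj A a).precomp _⟩
  obtain ⟨g, hg⟩ : ∃ g : (⟨L, A⟩ : Completion C) ⟶ ⟨⊤, A ⊗ a.obj⟩,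
      g ≫ topHom (proj A a) = toTop ⟨L, A⟩ := by
    refine ⟨({ app := fun w hw => A ◁ (leHom (le w hw)).f
               restricts := fun w hw => ⟨w, trivial, restrictsTo_self _ _⟩
               compat := fun w w' m hw hw' => by
                rw [Subsingleton.elim (leHom (le w hw)) (m.comp (leHom (le w' hw')))]
                simp [CentralIdempotent.Hom.comp] } : Hom ⟨L, A⟩ ⟨⊤, A ⊗ a.obj⟩), ?_⟩
    ext w hw
    rw [comp_ofHom_app, ofHom_app]
    exact (whiskerLeft_hom_proj A (leHom (le w hw))).trans (Category.comp_id _).symm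
  refine ⟨⟨f, g, ?_, ?_⟩, hf⟩
  · rw [← cancel_mono (topHom (proj A a)), Category.assoc, hg, hf, Category.id_comp]
  · rw [← cancel_mono (toTop ⟨L, A⟩), Category.assoc, hf, hg, Category.id_comp]

theorem comp_eq_topHom_app {X : Completion C} {B : C} (k : X ⟶ ⟨⊤, B⟩) (a : CentralIdempotent C)
    (ha : toZI a ∈ X.D) (f : (⟨⊤, X.A ⊗ a.obj⟩ : Completion C) ⟶ X)
    (hf : f ≫ toTop X = topHom (proj X.A a)) : f ≫ k = topHom (Hom.app k a ha) := by
  ext w hw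
  rw [ofHom_app]
  refine Hom.comp_app f k hw ha _ ?_
  have := app_congr hf w hw
  rw [comp_ofHom_app, ofHom_app] at this
  exact this.symm.trans (Category.comp_id _)

theorem exists_iso_tensor_idem_Iic (X : Completion C) (a : CentralIdempotent C)
    (ha : toZI a ∈ X.D) :
    ∃ e : (⟨⊤, X.A ⊗ a.obj⟩ : Completion C) ≅ X ⊗ (idem (LowerSet.Iic (toZI a))).obj,
      (e.hom ≫ proj X (idem (LowerSet.Iic (toZI a)))) ≫ toTop X = topHom (proj X.A a) := by
  obtain ⟨e, he⟩ := exists_iso_comp_toTop_eq X.A a (L := X.D ⊓ LowerSet.Iic (toZI a))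
    ⟨⟨ha, le_refl (toZI a)⟩, fun _ hw => mem_right hw⟩
  refine ⟨e ≪≫ (tensorIdemIso X (LowerSet.Iic (toZI a))).symm, ?_⟩
  rw [proj_idem, ← he]
  simp

/- Multiplying `u` by the idempotent of the principal down-set of `a` lands in the image of the
embedding, which reflects central idempotents. -/
theorem exists_iso_comp_counit_eq_app (u : CentralIdempotent (Completion C))
    (a : CentralIdempotent C) (ha : toZI a ∈ u.obj.D) :
    ∃ (v : CentralIdempotent C) (e : u.obj.A ⊗ a.obj ≅ v.obj),
      e.hom ≫ v.counit = Hom.app u.counit a ha ∧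
      ∃ f : (⟨⊤, v.obj⟩ : Completion C) ⟶ u.obj, f ≫ u.counit = topHom v.counit := by
  obtain ⟨e, he⟩ := exists_iso_tensor_idem_Iic u.obj a ha
  have counit_eq := comp_eq_topHom_app u.counit a ha _ he
  rw [Category.assoc] at counit_eq
  obtain ⟨v, e', he'⟩ := exists_centralIdempotent_of_map embeddingFunctor
    (Hom.app u.counit a ha) (u.inf (idem (LowerSet.Iic (toZI a)))) e (by
      rw [CentralIdempotent.inf_counit]
      exact counit_eq.trans (comp_inv_ε _).symm)
  refine ⟨v, e', he', topHom e'.inv ≫ e.hom ≫ proj u.obj (idem (LowerSet.Iic (toZI a))), ?_⟩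
  rw [Category.assoc, Category.assoc, counit_eq]
  refine ofHom_comp_eq _ ?_
  rw [← he', Iso.inv_hom_id_assoc]

end Completion

/-! ### Spatiality of lattices of down-closed sets -/

section Spatial

variable {L : Type u} [PartialOrder L]

/-- The open set of points of `L` that contain `a`. -/
def basicOpen (a : L) : TopologicalSpace.Opens (CompletelyPrimeFilter L) :=
  ⟨{Q | a ∈ Q.toPFilter}, TopologicalSpace.isOpen_generateFrom_of_mem ⟨a, rfl⟩⟩

theorem basicOpen_surjective (h : ∀ S : Set L, ∃ a, IsLUB S a) :
    Function.Surjective (basicOpen (L := L)) := by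
  have eq_setOf_mem (U : Set (CompletelyPrimeFilter L)) (hU : IsOpen U) :
      ∃ a, U = {Q | a ∈ Q.toPFilter} := by
    induction hU with
    | basic s hs =>
      obtain ⟨a, rfl⟩ := hs
      exact ⟨a, rfl⟩
    | univ =>
      obtain ⟨a, ha⟩ := h Set.univ
      refine ⟨a, (Set.eq_univ_of_forall fun Q => ?_).symm⟩
      obtain ⟨x, hx⟩ := Q.toPFilter.nonempty
      exact Q.toPFilter.mem_of_le (ha.1 trivial) hx
    | inter s t _ _ hs ht =>
      obtain ⟨a, rfl⟩ := hs
      obtain ⟨b, rfl⟩ := ht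
      obtain ⟨c, hc⟩ := h (lowerBounds {a, b})
      have glb : IsGLB {a, b} c := isLUB_lowerBounds.1 hc
      refine ⟨c, Set.ext fun Q => ⟨fun ⟨ha, hb⟩ => ?_, fun hQ => ⟨?_, ?_⟩⟩⟩
      · obtain ⟨d, hd, hda, hdb⟩ := Q.toPFilter.directed _ ha _ hb
        exact Q.toPFilter.mem_of_le (glb.2 (by simpa using ⟨hda, hdb⟩)) hd
      · exact Q.toPFilter.mem_of_le (glb.1 (Or.inl rfl)) hQ
      · exact Q.toPFilter.mem_of_le (glb.1 (Or.inr rfl)) hQ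
    | sUnion T _ hT =>
      choose f hf using hT
      obtain ⟨a, ha⟩ := h {b | ∃ s hs, f s hs = b}
      refine ⟨a, Set.ext fun Q => ⟨fun ⟨s, hs, hQ⟩ => ?_, fun hQ => ?_⟩⟩
      · rw [hf s hs] at hQ
        exact Q.toPFilter.mem_of_le (ha.1 ⟨s, hs, rfl⟩) hQ
      · obtain ⟨_, ⟨s, hs, rfl⟩, hQ'⟩ := Q.completelyPrime _ _ ha hQ
        exact ⟨s, hs, (hf s hs).symm ▸ hQ'⟩
  intro U
  obtain ⟨a, ha⟩ := eq_setOf_mem U U.isOpen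
  exact ⟨a, TopologicalSpace.Opens.ext ha.symm⟩

theorem isSpatial_of_separates (h : ∀ S : Set L, ∃ a, IsLUB S a)
    (sep : ∀ a b : L, (∀ Q : CompletelyPrimeFilter L, a ∈ Q.toPFilter → b ∈ Q.toPFilter) → a ≤ b) :
    IsSpatial L :=
  ⟨RelIso.ofSurjective (OrderEmbedding.ofMapLEIff basicOpen fun a b =>
    ⟨fun hab => sep a b fun _ hQ => hab hQ, fun hab Q hQ => Q.toPFilter.mem_of_le hab hQ⟩)
    (basicOpen_surjective h)⟩

variable {P : Type*} [Preorder P] (e : L ≃o LowerSet P)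

/-- The point of `L ≃o LowerSet P` given by `p : P`: the down-closed sets that contain `p`. -/
def pointFilter (p : P) : CompletelyPrimeFilter L where
  toPFilter := Order.IsPFilter.toPFilter (F := {c | p ∈ e c}) <| by
    refine .of_def ⟨e.symm ⊤, ?_⟩ (fun x hx y hy => ⟨e.symm (e x ⊓ e y), ?_, ?_, ?_⟩)
      fun hxy hx => e.monotone hxy hx
    · simp
    · simpa using ⟨hx, hy⟩
    · exact e.symm_apply_le.2 inf_le_left
    · exact e.symm_apply_le.2 inf_le_right
  proper := ⟨e.symm ⊥, fun h => by
    have : p ∈ e (e.symm ⊥) := h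
    simp at this⟩
  completelyPrime S c hc hp := by
    have mem : p ∈ sSup (e '' S) := (e.isLUB_image'.2 hc).sSup_eq ▸ hp
    obtain ⟨_, ⟨s, hs, rfl⟩, hps⟩ := LowerSet.mem_sSup_iff.1 mem
    exact ⟨s, hs, hps⟩

include e in
theorem isSpatial_of_orderIso : IsSpatial L :=
  isSpatial_of_separates
    (fun S => ⟨e.symm (sSup (e '' S)), by
      rw [← e.isLUB_image', e.apply_symm_apply]
      exact isLUB_sSup _⟩)
    fun _ _ h => e.le_iff_le.1 fun p hp => h (pointFilter e p) hp

end Spatial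

namespace Completion

variable {C : Type u} [Category.{v} C] [MonoidalCategory C] [IsStiff C]

/-! ### The completion is stiff and has universal joins -/

theorem preservesCentralIdempotents_embedding :
    PreservesCentralIdempotents (embeddingFunctor (C := C)) :=
  .of_iso inferInstance (fun _ _ => inferInstance) fun u => by
    refine ⟨.ofBraid (P := ⟨⊤, u.obj⟩) (topHom u.counit) ?_ ?_
      (fun X => ofIso (X := tensor ⟨⊤, u.obj⟩ X) (Y := tensor X ⟨⊤, u.obj⟩) (inf_comm _ _)
        (u.σ.β X.A)) (fun X => ?_), Iso.refl _, (Category.id_comp _).trans (comp_inv_ε _).symm⟩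
    · rw [whiskerLeft_ofHom, whiskerRight_ofHom, leftUnitor_hom, rightUnitor_hom]
      exact ofHom_comp_eq_comp _ _ _ _ u.isCentral.central
    · have : IsIso (u.obj ◁ u.counit ≫ (ρ_ u.obj).hom) :=
        u.isCentral.central ▸ u.isCentral.isIso
      rw [whiskerLeft_ofHom, rightUnitor_hom]
      exact (ofHom_comp_ofHom (X := tensor ⟨⊤, u.obj⟩ ⟨⊤, u.obj⟩)
        (Y := tensor ⟨⊤, u.obj⟩ (unitObj C)) (Z := ⟨⊤, u.obj⟩) _ _ _ _).symm ▸
        isIso_ofHom (X := tensor ⟨⊤, u.obj⟩ ⟨⊤, u.obj⟩) (Y := ⟨⊤, u.obj⟩) (inf_idem _)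
          (u.obj ◁ u.counit ≫ (ρ_ u.obj).hom)
    · rw [whiskerLeft_ofHom, whiskerRight_ofHom, leftUnitor_hom, rightUnitor_hom]
      exact (congrArg _ (ofHom_comp_ofHom _ _ _ _)).trans
        (ofHom_comp_eq_comp (X := tensor ⟨⊤, u.obj⟩ X) (Y := tensor X ⟨⊤, u.obj⟩)
          (Y' := tensor (unitObj C) X) (Z := X) (inf_comm _ _).le inf_le_left
          (inf_le_inf_right _ le_top) inf_le_right
          (u.isCentral.braid X.A))

theorem map_embedding_counit (u : CentralIdempotent C) :
    (preservesCentralIdempotents_embedding.map u).counit = topHom u.counit :=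
  comp_inv_ε _

theorem toZI_map_embedding (u : CentralIdempotent C) :
    toZI (preservesCentralIdempotents_embedding.map u) = toZI (idem (LowerSet.Iic (toZI u))) := by
  refine le_antisymm (toZI_le_toZI.2 ?_) (toZI_le_toZI.2 ?_)
  · rw [← restrictsTo_counit_iff, map_embedding_counit]
    exact (restrictsTo_idem_iff (topHom u.counit) _).2 fun w hw => ⟨u, le_refl (toZI u),
      (restrictsTo_counit_iff.2 le_rfl).precomp (proj u.obj w)⟩
  · obtain ⟨e, he⟩ := exists_iso_comp_toTop_eq (𝟙_ C) u (L := LowerSet.Iic (toZI u))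
      ⟨le_refl (toZI u), fun _ hw => hw⟩
    have counit_eq : (λ_ u.obj).hom ≫ u.counit = proj (𝟙_ C) u := by simp [proj, ← unitors_equal]
    refine ⟨.mk' (e.inv ≫ topHom (λ_ u.obj).hom) ?_⟩
    rw [map_embedding_counit]
    exact (Category.assoc _ _ _).trans
      ((Iso.inv_comp_eq _).2 ((ofHom_comp_eq _ counit_eq).trans he.symm))

theorem incl_comp_idem_counit {M N : LowerSet (ZI C)} (h : M ≤ N) :
    incl h (𝟙_ C) ≫ (idem N).counit = (idem M).counit :=
  ofHom_comp_eq (Z := unitObj C) (h' := le_top) le_top (Category.comp_id _)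

theorem idem_le_iff {L : LowerSet (ZI C)} {u : CentralIdempotent (Completion C)} :
    idem L ≤ u ↔ ∀ a ∈ L, idem (LowerSet.Iic a) ≤ u := by
  refine ⟨fun h a ha => (idem_le_idem.2 (LowerSet.Iic_le.2 ha)).trans h, fun h => ?_⟩
  have hM (a : L) : LowerSet.Iic a.1 ≤ L := LowerSet.Iic_le.2 a.2
  have hL (a) (ha : a ∈ L) : ∃ i : L, a ∈ LowerSet.Iic i.1 := ⟨⟨a, ha⟩, le_refl a⟩
  let m (a : L) : (idem (LowerSet.Iic a.1)).Hom u := leHom (h a.1 a.2)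
  let restrict {M : LowerSet (ZI C)} (a : L) (hMa : M ≤ LowerSet.Iic a.1) : (idem M).Hom u :=
    .comp (.mk' (u := idem M) (v := idem (.Iic a.1)) (incl hMa (𝟙_ C)) (incl_comp_idem_counit hMa))
      (m a)
  obtain ⟨g, hg⟩ := exists_glue_of_cover hM hL (fun a => (m a).f) fun a b =>
    congrArg CentralIdempotent.Hom.f
      (Subsingleton.elim (restrict a inf_le_left) (restrict b inf_le_right))
  refine ⟨.mk' g (hom_ext_of_cover hM hL fun a => ?_)⟩
  refine (Category.assoc _ _ _).symm.trans ((congrArg (· ≫ u.counit) (hg a)).trans ?_)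
  exact (m a).w.trans (incl_comp_idem_counit (hM a)).symm

/-- The down-closed set of a central idempotent `u` of the completion: the classes `a` whose
principal down-set lies below `u`. -/
def lower (u : CentralIdempotent (Completion C)) : LowerSet (ZI C) where
  carrier := {a | idem (LowerSet.Iic a) ≤ u}
  lower' _ _ hba ha := (idem_le_idem.2 (LowerSet.Iic_le.2 hba)).trans ha

theorem idem_lower_le (u : CentralIdempotent (Completion C)) : idem (lower u) ≤ u :=
  idem_le_iff.2 fun _ ha => ha

theorem le_idem_lower (u : CentralIdempotent (Completion C)) : u ≤ idem (lower u) := by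
  rw [← restrictsTo_counit_iff, restrictsTo_idem_iff]
  intro a ha
  obtain ⟨v, e, he, f, hf⟩ := exists_iso_comp_counit_eq_app u a ha
  refine ⟨v, ?_, ?_⟩
  · exact (toZI_le_toZI.1 (toZI_map_embedding v).ge).trans
      ⟨.mk' f (hf.trans (map_embedding_counit v).symm)⟩
  · rw [← he]
    exact (restrictsTo_counit_iff.2 le_rfl).precomp _

theorem toZI_idem_lower (u : CentralIdempotent (Completion C)) : toZI (idem (lower u)) = toZI u :=
  le_antisymm (toZI_le_toZI.2 (idem_lower_le u)) (toZI_le_toZI.2 (le_idem_lower u))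

theorem lower_le_lower {u v : CentralIdempotent (Completion C)} : lower u ≤ lower v ↔ u ≤ v := by
  rw [← idem_le_idem, ← toZI_le_toZI, toZI_idem_lower, toZI_idem_lower, toZI_le_toZI]

variable (C) in
/-- The central idempotents of the completion are the down-closed sets. -/
noncomputable def lowerSetIso : LowerSet (ZI C) ≃o ZI (Completion C) :=
  RelIso.ofSurjective (OrderEmbedding.ofMapLEIff (fun L => toZI (idem L))
    fun _ _ => toZI_le_toZI.trans idem_le_idem) fun a => by
      obtain ⟨u, rfl⟩ := toZI_surjective a
      exact ⟨lower u, toZI_idem_lower u⟩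

theorem lowerSetIso_lower (u : CentralIdempotent (Completion C)) :
    lowerSetIso C (lower u) = toZI u :=
  toZI_idem_lower u

theorem exists_mem_lower_of_isLUB {S : Set (CentralIdempotent (Completion C))}
    {j : CentralIdempotent (Completion C)} (hj : IsLUB (toZI '' S) (toZI j)) {a : ZI C}
    (ha : a ∈ lower j) : ∃ u ∈ S, a ∈ lower u := by
  have isLUB : IsLUB (lower '' S) (lower j) := (lowerSetIso C).isLUB_image'.1 <| by
    simpa only [Set.image_image, lowerSetIso_lower] using hj
  rw [← isLUB.sSup_eq] at ha
  obtain ⟨_, ⟨u, hu, rfl⟩, hau⟩ := LowerSet.mem_sSup_iff.1 ha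
  exact ⟨u, hu, hau⟩

theorem lower_eq_inf {u v w : CentralIdempotent (Completion C)}
    (hw : IsGLB {toZI u, toZI v} (toZI w)) : lower w = lower u ⊓ lower v := by
  refine ((lowerSetIso C).isGLB_image'.1 ?_).unique isGLB_pair
  simpa only [Set.image_pair, lowerSetIso_lower] using hw

/-- The isomorphism between `⟨D, A⟩ ⊗ u` and `⟨D ∩ L, A⟩`, where `L` is the down-closed set
of `u`. -/
noncomputable def tensorIso (X : Completion C) (u : CentralIdempotent (Completion C)) :
    X ⊗ u.obj ≅ ⟨X.D ⊓ lower u, X.A⟩ :=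
  have := (leHom (le_idem_lower u)).isIso_of_ge (idem_lower_le u)
  whiskerLeftIso X (asIso (leHom (le_idem_lower u)).f) ≪≫ tensorIdemIso X (lower u)

theorem tensorIso_hom_incl (X : Completion C) (u : CentralIdempotent (Completion C)) :
    (tensorIso X u).hom ≫ incl inf_le_left X.A = proj X u := by
  rw [← whiskerLeft_hom_proj X (leHom (le_idem_lower u)), proj_idem, tensorIso, Iso.trans_hom,
    Category.assoc]
  rfl

instance mono_proj (X : Completion C) (u : CentralIdempotent (Completion C)) :
    Mono (proj X u) := by
  rw [← tensorIso_hom_incl]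
  exact mono_comp _ _

theorem tensorIso_inv_whiskerLeft (X : Completion C) {u v : CentralIdempotent (Completion C)}
    (m : u.Hom v) : (tensorIso X u).inv ≫ X ◁ m.f =
      incl (inf_le_inf_left X.D (lower_le_lower.2 ⟨m⟩)) X.A ≫ (tensorIso X v).inv := by
  rw [← cancel_mono (proj X v), Category.assoc, whiskerLeft_hom_proj, ← tensorIso_hom_incl X u,
    ← tensorIso_hom_incl X v, Iso.inv_hom_id_assoc, Category.assoc, Iso.inv_hom_id_assoc,
    incl_comp_incl]

theorem restrictsTo_iff {Z X : Completion C} (f : Z ⟶ X) (u : CentralIdempotent (Completion C)) :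
    RestrictsTo f u ↔ ∀ (w : CentralIdempotent C) (hw : toZI w ∈ Z.D),
      RestrictsInto (Hom.app f w hw) (lower u) := by
  rw [← restrictsTo_idem_iff]
  exact ⟨fun h => h.mono (le_idem_lower u), fun h => h.mono (idem_lower_le u)⟩

variable (C) in
theorem isStiff_completion : IsStiff (Completion C) :=
  isStiff_of_mono_of_restrictsTo_inf inferInstance fun f u v hu hv => by
    rw [restrictsTo_iff] at hu hv ⊢
    rw [lower_eq_inf (CentralIdempotent.isGLB_inf u v)]
    exact fun w hw => (hu w hw).inf (hv w hw)

theorem isUniversalJoin_of_isLUB {S : Set (CentralIdempotent (Completion C))} (hS : MeetClosed S)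
    {j : CentralIdempotent (Completion C)} (hj : IsLUB (toZI '' S) (toZI j)) :
    IsUniversalJoin S j :=
  .of_existsUnique (le_of_isLUB hj) fun X Y f hf => by
    have hM (i : S) : X.D ⊓ lower i.1 ≤ X.D ⊓ lower j :=
      inf_le_inf_left _ (lower_le_lower.2 (le_of_isLUB hj i.1 i.2))
    have hL (a) (ha : a ∈ X.D ⊓ lower j) : ∃ i : S, a ∈ X.D ⊓ lower i.1 := by
      obtain ⟨u, hu, hau⟩ := exists_mem_lower_of_isLUB hj (mem_right ha)
      exact ⟨⟨u, hu⟩, mem_left ha, hau⟩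
    let f' (i : S) : (⟨X.D ⊓ lower i.1, X.A⟩ : Completion C) ⟶ Y :=
      (tensorIso X i.1).inv ≫ f i.1 i.2
    have incl_f' {w v : S} (m : w.1.Hom v.1) :
        incl (inf_le_inf_left X.D (lower_le_lower.2 ⟨m⟩)) X.A ≫ f' v = f' w := by
      rw [← Category.assoc, ← tensorIso_inv_whiskerLeft _ m, Category.assoc, ← hf]
    obtain ⟨g, hg⟩ := exists_glue_of_cover hM hL f' fun i k => by
      obtain ⟨w, hw, glb⟩ := hS i.1 i.2 k.1 k.2
      have hwM : (X.D ⊓ lower i.1) ⊓ (X.D ⊓ lower k.1) ≤ X.D ⊓ lower w := by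
        rw [lower_eq_inf glb, ← inf_inf_distrib_left]
      have incl_eq (v : S) (h : w ≤ v.1)
          (h' : (X.D ⊓ lower i.1) ⊓ (X.D ⊓ lower k.1) ≤ X.D ⊓ lower v.1) :
          incl h' X.A ≫ f' v = incl hwM X.A ≫ f' ⟨w, hw⟩ := by
        rw [← incl_f' (w := ⟨w, hw⟩) (leHom h), reassoc_of% (incl_comp_incl hwM _ X.A)]
      rw [incl_eq i (toZI_le_toZI.1 (glb.1 (Or.inl rfl))),
        incl_eq k (toZI_le_toZI.1 (glb.1 (Or.inr rfl)))]
    refine ⟨(tensorIso X j).hom ≫ g, fun u hu m => ?_, fun d hd => ?_⟩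
    · rw [← cancel_epi (tensorIso X u).inv, reassoc_of% (tensorIso_inv_whiskerLeft X m),
        Iso.inv_hom_id_assoc]
      exact hg ⟨u, hu⟩
    · rw [← Iso.inv_comp_eq]
      refine hom_ext_of_cover hM hL fun i => ?_
      obtain ⟨m⟩ := le_of_isLUB hj i.1 i.2
      rw [hg i, ← reassoc_of% (tensorIso_inv_whiskerLeft X m), hd i.1 i.2 m]

variable (C) in
theorem hasUniversalJoins_completion : HasUniversalJoins (Completion C) where
  exists_isLUB S := by
    refine ⟨lowerSetIso C (sSup (lowerSetIso C ⁻¹' S)), ?_⟩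
    have isLUB := (lowerSetIso C).isLUB_image'.2 (isLUB_sSup (lowerSetIso C ⁻¹' S))
    rwa [Set.image_preimage_eq _ (lowerSetIso C).surjective] at isLUB
  isColimit _ hS _ hj := (isUniversalJoin_of_isLUB hS hj).isColimit

end Completion

theorem inMonCatJ_completion (C : Type u) [Category.{v} C] [MonoidalCategory C] [IsStiff C] :
    InMonCatJ (Completion C) :=
  ⟨Completion.isStiff_completion C, Completion.hasUniversalJoins_completion C,
    isSpatial_of_orderIso (Completion.lowerSetIso C).symm⟩

/-! ### Extending a functor to the completion -/

section Extension

universe v₁ v₂ u₁ u₂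

open Functor.LaxMonoidal Completion

variable {C : Type u₁} [Category.{v₁} C] [MonoidalCategory C]
  {D : Type u₂} [Category.{v₂} D] [MonoidalCategory D] {F : C ⥤ D} [F.LaxMonoidal]

namespace PreservesCentralIdempotents

variable (hF : PreservesCentralIdempotents F)

/-- The images of the elements of a down-closed set. -/
def image (L : LowerSet (ZI C)) : Set (CentralIdempotent D) := hF.map '' {u | toZI u ∈ L}

theorem meetClosed_image_lowerSet (L : LowerSet (ZI C)) : MeetClosed (hF.image L) :=
  hF.meetClosed_image fun u hu v _ =>
    ⟨u.inf v, L.lower (toZI_le_toZI.2 (u.inf_le_left v)) hu, CentralIdempotent.isGLB_inf u v⟩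

theorem map_hom_f {u v : CentralIdempotent C} (m : u.Hom v) (n : (hF.map u).Hom (hF.map v)) :
    n.f = F.map m.f := by
  have := hF.isIso_ε
  exact congrArg CentralIdempotent.Hom.f (Subsingleton.elim n (.mk' (F.map m.f)
    (by simp [PreservesCentralIdempotents.map, ← F.map_comp_assoc, m.w])))

theorem whiskerLeft_hom_μIso (A : C) {u v : CentralIdempotent C} (m : u.Hom v)
    (n : (hF.map u).Hom (hF.map v)) :
    F.obj A ◁ n.f ≫ (hF.μIso A v).hom = (hF.μIso A u).hom ≫ F.map (A ◁ m.f) := by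
  rw [hF.map_hom_f m n]
  exact μ_natural_right F A m.f

include hF in
theorem mono_map_proj (A : C) (u : CentralIdempotent C) [Mono (proj (F.obj A) (hF.map u))] :
    Mono (F.map (proj A u)) := by
  rw [← Iso.inv_hom_id_assoc (hF.μIso A u) (F.map (proj A u)), hF.μIso_map_proj]
  infer_instance

variable (hD : HasUniversalJoins D)

/-- The join of the images of the elements of a down-closed set. -/
noncomputable def join (L : LowerSet (ZI C)) : CentralIdempotent D :=
  (toZI_surjective (hD.exists_isLUB (toZI '' hF.image L)).choose).choose

theorem isLUB_join (L : LowerSet (ZI C)) : IsLUB (toZI '' hF.image L) (toZI (hF.join hD L)) := by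
  rw [join, (toZI_surjective (hD.exists_isLUB (toZI '' hF.image L)).choose).choose_spec]
  exact (hD.exists_isLUB (toZI '' hF.image L)).choose_spec

theorem isUniversalJoin_join (L : LowerSet (ZI C)) :
    IsUniversalJoin (hF.image L) (hF.join hD L) :=
  hD.isUniversalJoin (hF.meetClosed_image_lowerSet L) (hF.isLUB_join hD L)

theorem map_le_join {L : LowerSet (ZI C)} {u : CentralIdempotent C} (hu : toZI u ∈ L) :
    hF.map u ≤ hF.join hD L :=
  le_of_isLUB (hF.isLUB_join hD L) _ ⟨u, hu, rfl⟩

theorem join_le {L : LowerSet (ZI C)} {t : CentralIdempotent D}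
    (ht : ∀ u : CentralIdempotent C, toZI u ∈ L → hF.map u ≤ t) : hF.join hD L ≤ t := by
  refine toZI_le_toZI.1 ((hF.isLUB_join hD L).2 ?_)
  rintro _ ⟨_, ⟨u, hu, rfl⟩, rfl⟩
  exact toZI_le_toZI.2 (ht u hu)

theorem join_mono {L M : LowerSet (ZI C)} (h : L ≤ M) : hF.join hD L ≤ hF.join hD M :=
  hF.join_le hD fun _ hu => hF.map_le_join hD (h hu)

theorem join_hom_ext {L : LowerSet (ZI C)} {A Y : D} {f g : A ⊗ (hF.join hD L).obj ⟶ Y}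
    (h : ∀ u : CentralIdempotent C, toZI u ∈ L → ∀ m : (hF.map u).Hom (hF.join hD L),
      A ◁ m.f ≫ f = A ◁ m.f ≫ g) : f = g := by
  refine (hF.isUniversalJoin_join hD L).hom_ext ?_
  rintro _ ⟨u, hu, rfl⟩ m
  exact h u hu m

theorem join_hom_ext_of_isIso_proj {L : LowerSet (ZI C)} {Z Y : D}
    [IsIso (proj Z (hF.join hD L))] {f g : Z ⟶ Y} (h : ∀ u : CentralIdempotent C, toZI u ∈ L →
      proj Z (hF.map u) ≫ f = proj Z (hF.map u) ≫ g) : f = g := by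
  refine (hF.isUniversalJoin_join hD L).hom_ext_of_isIso_proj ?_
  rintro _ ⟨u, hu, rfl⟩
  exact h u hu

/- A morphism `F U ⟶ F V` need not come from `U ⟶ V`. But then `F (U ⊗ V) ⟶ F U` is invertible, so
the comparison can be made on `U ⊗ V`, which lies below both `U` and `V`. -/
theorem exists_join_desc {L : LowerSet (ZI C)} {A Y : D}
    (k : ∀ u : CentralIdempotent C, toZI u ∈ L → (A ⊗ (hF.map u).obj ⟶ Y))
    (hk : ∀ (u v : CentralIdempotent C) (hu : toZI u ∈ L) (hv : toZI v ∈ L), u ≤ v →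
      ∀ (m : (hF.map u).Hom (hF.map v)), k u hu = A ◁ m.f ≫ k v hv) :
    ∃ f : A ⊗ (hF.join hD L).obj ⟶ Y, ∀ (u : CentralIdempotent C) (hu : toZI u ∈ L)
      (m : (hF.map u).Hom (hF.join hD L)), A ◁ m.f ≫ f = k u hu := by
  refine (hF.isUniversalJoin_join hD L).exists_desc_image k fun u v hu hv m => ?_
  have huv : toZI (u.inf v) ∈ L := L.lower (toZI_le_toZI.2 (u.inf_le_left v)) hu
  obtain ⟨n⟩ := hF.map_mono (u.inf_le_left v)
  have : IsIso n.f := n.isIso_of_ge ((CentralIdempotent.le_inf le_rfl ⟨m⟩).trans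
    (toZI_le_toZI.1 (hF.toZI_map_inf u v).ge))
  rw [← cancel_epi (A ◁ n.f), ← hk _ _ huv hu (u.inf_le_left v) n,
    hk _ _ huv hv (u.inf_le_right v) (n.comp m)]
  simp [CentralIdempotent.Hom.comp]

/-- The value of the extension of `F` at `⟨L, A⟩`: the join of the `F A ⊗ F U`, `u ∈ L`. -/
noncomputable abbrev extObj (X : Completion C) : D := F.obj X.A ⊗ (hF.join hD X.D).obj

/-- The projection from the extension of `F` at `⟨L, A⟩` to `F A`; it is monic if `D` is stiff. -/
noncomputable abbrev extProj (X : Completion C) : hF.extObj hD X ⟶ F.obj X.A :=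
  proj (F.obj X.A) (hF.join hD X.D)

variable [IsStiff D]

theorem join_inf (L M : LowerSet (ZI C)) :
    (hF.join hD L).inf (hF.join hD M) ≤ hF.join hD (L ⊓ M) := by
  refine (hF.isUniversalJoin_join hD L).inf_le (hF.isUniversalJoin_join hD M) ?_
  rintro _ ⟨u, hu, rfl⟩ _ ⟨v, hv, rfl⟩
  refine (toZI_le_toZI.1 (hF.toZI_map_inf u v).ge).trans (hF.map_le_join hD ⟨?_, ?_⟩)
  · exact L.lower (toZI_le_toZI.2 (u.inf_le_left v)) hu
  · exact M.lower (toZI_le_toZI.2 (u.inf_le_right v)) hv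

instance isIso_proj_join_top (A : C) : IsIso (proj (F.obj A) (hF.join hD ⊤)) := by
  have : IsIso (proj (F.obj A) (hF.map (.unit C))) := by
    have : IsIso (proj A (.unit C)) := inferInstanceAs (IsIso (A ◁ 𝟙 _ ≫ (ρ_ A).hom))
    rw [← hF.μIso_map_proj]
    infer_instance
  exact isIso_proj_of_le (hF.map_le_join hD (u := .unit C) trivial)

instance isIso_proj_tensor_join (X Y : Completion C) :
    IsIso (proj (hF.extObj hD X ⊗ hF.extObj hD Y) (hF.join hD (X.D ⊓ Y.D))) := by
  have := isIso_proj_tensor_right (hF.extObj hD Y) (hF.extObj hD X) (hF.join hD X.D)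
  have := isIso_proj_tensor_left (hF.extObj hD X) (hF.extObj hD Y) (hF.join hD Y.D)
  have := isIso_proj_inf (hF.extObj hD X ⊗ hF.extObj hD Y) (hF.join hD X.D) (hF.join hD Y.D)
  exact isIso_proj_of_le (hF.join_inf hD X.D Y.D)

theorem proj_extObj (X : Completion C) (u : CentralIdempotent C)
    (m : (hF.map u).Hom (hF.join hD X.D)) :
    proj (hF.extObj hD X) (hF.map u) =
      hF.extProj hD X ▷ (hF.map u).obj ≫ F.obj X.A ◁ m.f := by
  rw [← cancel_mono (hF.extProj hD X), Category.assoc, whiskerLeft_hom_proj, proj_naturality]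

theorem μ_map_swap (A B : C) (u : CentralIdempotent C) :
    μ F A B ▷ (hF.map u).obj ≫ (hF.μIso (A ⊗ B) u).hom ≫ F.map (swap A B u).hom =
      (swap (F.obj A) (F.obj B) (hF.map u)).hom ≫ (hF.μIso A u).hom ▷ F.obj B ≫
        μ F (A ⊗ u.obj) B := by
  have : Mono (F.map (proj A u ▷ B)) := by
    have := hF.mono_map_proj (A ⊗ B) u
    rw [← swap_inv_proj, F.map_comp]
    infer_instance
  rw [← cancel_mono (F.map (proj A u ▷ B))]
  simp only [Category.assoc]
  rw [← F.map_comp, swap_proj, hF.μIso_map_proj, proj_naturality, ← μ_natural_left,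
    ← comp_whiskerRight_assoc, hF.μIso_map_proj, swap_proj_assoc]

/-- The unit of the extension of `F`. -/
noncomputable def extε : 𝟙_ D ⟶ hF.extObj hD (unitObj C) := ε F ≫ inv (hF.extProj hD (unitObj C))

theorem extε_proj : hF.extε hD ≫ hF.extProj hD (unitObj C) = ε F := by
  simp [extε]

theorem isIso_extε : IsIso (hF.extε hD) := by
  have := hF.isIso_ε
  unfold extε
  infer_instance

theorem exists_extμ (X Y : Completion C) :
    ∃ f : hF.extObj hD X ⊗ hF.extObj hD Y ⟶ hF.extObj hD (X.tensor Y),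
      f ≫ hF.extProj hD (X.tensor Y) = (hF.extProj hD X ⊗ₘ hF.extProj hD Y) ≫ μ F X.A Y.A :=
  ((restrictsTo_tensorHom_proj _ _ _ _).mono (hF.join_inf hD X.D Y.D)).postcomp _

/-- The tensorator of the extension of `F`. -/
noncomputable def extμ (X Y : Completion C) :
    hF.extObj hD X ⊗ hF.extObj hD Y ⟶ hF.extObj hD (X.tensor Y) := (hF.exists_extμ hD X Y).choose

theorem extμ_proj (X Y : Completion C) :
    hF.extμ hD X Y ≫ hF.extProj hD (X.tensor Y) =
      (hF.extProj hD X ⊗ₘ hF.extProj hD Y) ≫ μ F X.A Y.A := (hF.exists_extμ hD X Y).choose_spec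

theorem isIso_extμ (X Y : Completion C) [IsIso (μ F X.A Y.A)] : IsIso (hF.extμ hD X Y) := by
  have mono : Mono (hF.extμ hD X Y) := by
    have := mono_tensorHom_proj (F.obj X.A) (F.obj Y.A) (hF.join hD X.D) (hF.join hD Y.D)
    have : Mono (hF.extμ hD X Y ≫ hF.extProj hD (X.tensor Y)) := by
      rw [hF.extμ_proj]
      exact mono_comp _ _
    exact mono_of_mono _ (hF.extProj hD (X.tensor Y))
  have : IsIso (proj (hF.extObj hD (X.tensor Y)) (hF.join hD X.D)) :=
    isIso_proj_of_le (hF.join_mono hD (inf_le_left : X.D ⊓ Y.D ≤ X.D))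
  have : IsIso (proj (hF.extObj hD (X.tensor Y)) (hF.join hD Y.D)) :=
    isIso_proj_of_le (hF.join_mono hD (inf_le_right : X.D ⊓ Y.D ≤ Y.D))
  obtain ⟨g, hg⟩ := exists_comp_tensorHom_proj_eq
    (restrictsTo_of_isIso_proj (hF.extProj hD (X.tensor Y) ≫ inv (μ F X.A Y.A)) (hF.join hD X.D))
    (restrictsTo_of_isIso_proj _ (hF.join hD Y.D))
  have comp_eq_id : g ≫ hF.extμ hD X Y = 𝟙 _ := by
    rw [← cancel_mono (hF.extProj hD (X.tensor Y)), Category.assoc, hF.extμ_proj,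
      reassoc_of% hg, IsIso.inv_hom_id, Category.comp_id, Category.id_comp]
  have : IsSplitEpi (hF.extμ hD X Y) := ⟨⟨⟨g, comp_eq_id⟩⟩⟩
  exact isIso_of_mono_of_isSplitEpi _

theorem extμ_whiskerRight_proj (X Y Z : Completion C) :
    hF.extμ hD X Y ▷ hF.extObj hD Z ≫ hF.extμ hD (X.tensor Y) Z ≫
      hF.extProj hD ((X.tensor Y).tensor Z) =
    ((hF.extProj hD X ⊗ₘ hF.extProj hD Y) ⊗ₘ hF.extProj hD Z) ≫ μ F X.A Y.A ▷ F.obj Z.A ≫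
      μ F (X.A ⊗ Y.A) Z.A := by
  rw [hF.extμ_proj, ← tensorHom_id, ← tensorHom_id, tensorHom_comp_tensorHom_assoc,
    tensorHom_comp_tensorHom_assoc, hF.extμ_proj, Category.id_comp, Category.comp_id]

theorem extμ_whiskerLeft_proj (X Y Z : Completion C) :
    hF.extObj hD X ◁ hF.extμ hD Y Z ≫ hF.extμ hD X (Y.tensor Z) ≫
      hF.extProj hD (X.tensor (Y.tensor Z)) =
    (hF.extProj hD X ⊗ₘ hF.extProj hD Y ⊗ₘ hF.extProj hD Z) ≫ F.obj X.A ◁ μ F Y.A Z.A ≫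
      μ F X.A (Y.A ⊗ Z.A) := by
  rw [hF.extμ_proj, ← id_tensorHom, ← id_tensorHom, tensorHom_comp_tensorHom_assoc,
    tensorHom_comp_tensorHom_assoc, hF.extμ_proj, Category.id_comp, Category.comp_id]

variable [IsStiff C]

theorem exists_extMap {X Y : Completion C} (η : X ⟶ Y) :
    ∃ f : hF.extObj hD X ⟶ hF.extObj hD Y, ∀ (u : CentralIdempotent C) (hu : toZI u ∈ X.D)
      (m : (hF.map u).Hom (hF.join hD X.D)), F.obj X.A ◁ m.f ≫ f ≫ hF.extProj hD Y =
        (hF.μIso X.A u).hom ≫ F.map (Hom.app η u hu) := by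
  obtain ⟨f, hf⟩ := hF.exists_join_desc hD (L := X.D)
    (fun u hu => (hF.μIso X.A u).hom ≫ F.map (Hom.app η u hu)) fun u v hu hv huv m => by
      obtain ⟨n⟩ := huv
      rw [reassoc_of% (hF.whiskerLeft_hom_μIso X.A n m), ← F.map_comp, Hom.compat η u v n hu hv]
  have restrictsTo : RestrictsTo f (hF.join hD Y.D) := by
    refine (hF.isUniversalJoin_join hD X.D).restrictsTo_of_forall ?_
    rintro _ ⟨u, hu, rfl⟩
    obtain ⟨m⟩ := hF.map_le_join hD hu
    rw [hF.proj_extObj hD X u m, Category.assoc, hf u hu m]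
    obtain ⟨v, hv, g, hg⟩ := Hom.restricts η u hu
    refine ((RestrictsTo.mono ?_ (hF.map_le_join hD hv)).precomp _).precomp _
    refine ⟨F.map g ≫ (hF.μIso Y.A v).inv, ?_⟩
    rw [← hF.μIso_map_proj, Category.assoc, Iso.inv_hom_id_assoc, ← F.map_comp, hg]
  obtain ⟨g, hg⟩ := restrictsTo
  exact ⟨g, fun u hu m => by rw [hg, hf u hu m]⟩

/-- The extension of `F` on morphisms. -/
noncomputable def extMap {X Y : Completion C} (η : X ⟶ Y) : hF.extObj hD X ⟶ hF.extObj hD Y :=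
  (hF.exists_extMap hD η).choose

theorem extMap_spec {X Y : Completion C} (η : X ⟶ Y) (u : CentralIdempotent C)
    (hu : toZI u ∈ X.D) (m : (hF.map u).Hom (hF.join hD X.D)) :
    F.obj X.A ◁ m.f ≫ hF.extMap hD η ≫ hF.extProj hD Y =
      (hF.μIso X.A u).hom ≫ F.map (Hom.app η u hu) :=
  (hF.exists_extMap hD η).choose_spec u hu m

theorem extMap_unique {X Y : Completion C} (η : X ⟶ Y) {f : hF.extObj hD X ⟶ hF.extObj hD Y}
    (hf : ∀ (u : CentralIdempotent C) (hu : toZI u ∈ X.D)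
      (m : (hF.map u).Hom (hF.join hD X.D)), F.obj X.A ◁ m.f ≫ f ≫ hF.extProj hD Y =
        (hF.μIso X.A u).hom ≫ F.map (Hom.app η u hu)) : hF.extMap hD η = f := by
  rw [← cancel_mono (hF.extProj hD Y)]
  refine hF.join_hom_ext hD fun u hu m => ?_
  rw [hf u hu m, hF.extMap_spec hD η u hu m]

theorem extMap_ofHom_proj {X Y : Completion C} (h : X.D ≤ Y.D) (f : X.A ⟶ Y.A) :
    hF.extMap hD (ofHom h f : X ⟶ Y) ≫ hF.extProj hD Y = hF.extProj hD X ≫ F.map f := by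
  refine hF.join_hom_ext hD fun u hu m => ?_
  rw [hF.extMap_spec hD _ u hu m, whiskerLeft_hom_proj_assoc, ofHom_app, F.map_comp,
    reassoc_of% (hF.μIso_map_proj X.A u)]

theorem extMap_incl_proj {L M : LowerSet (ZI C)} (h : L ≤ M) (A : C) :
    hF.extMap hD (incl h A) ≫ hF.extProj hD ⟨M, A⟩ = hF.extProj hD ⟨L, A⟩ :=
  (hF.extMap_ofHom_proj hD (X := ⟨L, A⟩) (Y := ⟨M, A⟩) h (𝟙 A)).trans
    ((congrArg _ (F.map_id A)).trans (Category.comp_id _))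

theorem whiskerLeft_hom_extMap {X Y : Completion C} (η : X ⟶ Y) (u : CentralIdempotent C)
    (hu : toZI u ∈ X.D) (m : (hF.map u).Hom (hF.join hD X.D)) (v : CentralIdempotent C)
    (g : X.A ⊗ u.obj ⟶ Y.A ⊗ v.obj) (hg : g ≫ proj Y.A v = Hom.app η u hu)
    (n : (hF.map v).Hom (hF.join hD Y.D)) :
    F.obj X.A ◁ m.f ≫ hF.extMap hD η =
      (hF.μIso X.A u).hom ≫ F.map g ≫ (hF.μIso Y.A v).inv ≫ F.obj Y.A ◁ n.f := by
  rw [← cancel_mono (hF.extProj hD Y), Category.assoc, hF.extMap_spec hD η u hu m]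
  simp only [Category.assoc]
  rw [whiskerLeft_hom_proj, ← hF.μIso_map_proj, Iso.inv_hom_id_assoc, ← F.map_comp, hg]

theorem extMap_id (X : Completion C) : hF.extMap hD (𝟙 X) = 𝟙 _ :=
  hF.extMap_unique hD _ fun u hu m => by
    rw [Category.id_comp, whiskerLeft_hom_proj, id_eq_ofHom, ofHom_app, Category.comp_id,
      hF.μIso_map_proj]

theorem extMap_comp {X Y Z : Completion C} (η : X ⟶ Y) (ζ : Y ⟶ Z) :
    hF.extMap hD (η ≫ ζ) = hF.extMap hD η ≫ hF.extMap hD ζ :=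
  hF.extMap_unique hD _ fun u hu m => by
    have fac := Hom.fac_proj η u hu
    obtain ⟨n⟩ := hF.map_le_join hD (Hom.idx_mem η u hu)
    rw [Category.assoc, reassoc_of% (hF.whiskerLeft_hom_extMap hD η u hu m _ _ fac n),
      hF.extMap_spec hD ζ _ (Hom.idx_mem η u hu) n, Iso.inv_hom_id_assoc, ← F.map_comp]
    exact congrArg (_ ≫ F.map ·) (Hom.comp_app η ζ hu _ _ fac).symm

/-- The extension of `F` to the completion. -/
noncomputable def extension : Completion C ⥤ D where
  obj := hF.extObj hD
  map := hF.extMap hD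
  map_id := hF.extMap_id hD
  map_comp := hF.extMap_comp hD

theorem proj_extMap {X Y : Completion C} (η : X ⟶ Y) (u : CentralIdempotent C)
    (hu : toZI u ∈ X.D) : proj (hF.extObj hD X) (hF.map u) ≫ hF.extMap hD η ≫ hF.extProj hD Y =
      hF.extProj hD X ▷ (hF.map u).obj ≫ (hF.μIso X.A u).hom ≫ F.map (Hom.app η u hu) := by
  obtain ⟨m⟩ := hF.map_le_join hD hu
  rw [hF.proj_extObj hD X u m, Category.assoc, hF.extMap_spec hD η u hu m]

theorem proj_extμ_extMap {X Y Z : Completion C} (η : X.tensor Y ⟶ Z) (w : CentralIdempotent C)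
    (hw : toZI w ∈ X.D ⊓ Y.D) :
    proj (hF.extObj hD X ⊗ hF.extObj hD Y) (hF.map w) ≫ hF.extμ hD X Y ≫ hF.extMap hD η ≫
      hF.extProj hD Z = (hF.extProj hD X ⊗ₘ hF.extProj hD Y) ▷ (hF.map w).obj ≫
        μ F X.A Y.A ▷ (hF.map w).obj ≫ (hF.μIso (X.A ⊗ Y.A) w).hom ≫ F.map (Hom.app η w hw) := by
  rw [← proj_naturality_assoc, hF.proj_extMap hD η w hw, ← comp_whiskerRight_assoc, hF.extμ_proj,
    comp_whiskerRight_assoc]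

theorem extμ_natural_left {X Y : Completion C} (η : X ⟶ Y) (Z : Completion C) :
    hF.extMap hD η ▷ hF.extObj hD Z ≫ hF.extμ hD Y Z =
      hF.extμ hD X Z ≫ hF.extMap hD (whiskerR η Z) := by
  rw [← cancel_mono (hF.extProj hD (Y.tensor Z))]
  refine hF.join_hom_ext_of_isIso_proj hD (L := X.D ⊓ Z.D) fun w hw => ?_
  simp only [Category.assoc]
  rw [hF.proj_extμ_extMap hD _ w hw, hF.extμ_proj, whiskerR_app, F.map_comp,
    reassoc_of% (hF.μ_map_swap X.A Z.A w), ← μ_natural_left, ← swap_proj_assoc,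
    MonoidalCategory.tensorHom_def, MonoidalCategory.tensorHom_def]
  simp only [Category.assoc]
  rw [← comp_whiskerRight_assoc, ← comp_whiskerRight_assoc, Category.assoc,
    hF.proj_extMap hD η w (mem_left hw)]
  simp only [comp_whiskerRight, Category.assoc]
  rw [swap_naturality_right_assoc, reassoc_of% (swap_naturality_left (hF.extProj hD X))]
  simp only [← whisker_exchange_assoc]

theorem extμ_natural_right (Z : Completion C) {X Y : Completion C} (η : X ⟶ Y) :
    hF.extObj hD Z ◁ hF.extMap hD η ≫ hF.extμ hD Z Y =
      hF.extμ hD Z X ≫ hF.extMap hD (whiskerL Z η) := by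
  rw [← cancel_mono (hF.extProj hD (Z.tensor Y))]
  refine hF.join_hom_ext_of_isIso_proj hD (L := Z.D ⊓ X.D) fun w hw => ?_
  have μIso_associator : μ F Z.A X.A ▷ (hF.map w).obj ≫ (hF.μIso (Z.A ⊗ X.A) w).hom ≫
      F.map (α_ Z.A X.A w.obj).hom = (α_ (F.obj Z.A) (F.obj X.A) (hF.map w).obj).hom ≫
        F.obj Z.A ◁ (hF.μIso X.A w).hom ≫ μ F Z.A (X.A ⊗ w.obj) := associativity F _ _ _
  simp only [Category.assoc]
  rw [hF.proj_extμ_extMap hD _ w hw, hF.extμ_proj, whiskerL_app, F.map_comp,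
    reassoc_of% μIso_associator, ← μ_natural_right, proj_tensor,
    MonoidalCategory.tensorHom_def', MonoidalCategory.tensorHom_def']
  simp only [Category.assoc]
  rw [← MonoidalCategory.whiskerLeft_comp_assoc, ← MonoidalCategory.whiskerLeft_comp_assoc,
    Category.assoc, hF.proj_extMap hD η w (mem_right hw)]
  simp only [MonoidalCategory.whiskerLeft_comp, comp_whiskerRight, Category.assoc]
  rw [associator_naturality_left_assoc, whisker_assoc]
  simp only [Category.assoc, Iso.inv_hom_id_assoc, whisker_exchange_assoc]

theorem extμ_associativity (X Y Z : Completion C) :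
    hF.extμ hD X Y ▷ hF.extObj hD Z ≫ hF.extμ hD (X.tensor Y) Z ≫
      hF.extMap hD (α_ X Y Z).hom =
    (α_ (hF.extObj hD X) (hF.extObj hD Y) (hF.extObj hD Z)).hom ≫
      hF.extObj hD X ◁ hF.extμ hD Y Z ≫ hF.extμ hD X (Y.tensor Z) := by
  have extMap_proj : hF.extMap hD (α_ X Y Z).hom ≫ hF.extProj hD (X.tensor (Y.tensor Z)) =
      hF.extProj hD ((X.tensor Y).tensor Z) ≫ F.map (α_ X.A Y.A Z.A).hom := by
    rw [Completion.associator_hom]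
    exact hF.extMap_ofHom_proj hD _ _
  rw [← cancel_mono (hF.extProj hD (X.tensor (Y.tensor Z)))]
  simp only [Category.assoc]
  rw [extMap_proj, hF.extμ_whiskerLeft_proj, reassoc_of% (hF.extμ_whiskerRight_proj hD X Y Z),
    associativity F]
  exact associator_naturality_assoc _ _ _ _

theorem extμ_left_unitality (X : Completion C) :
    (λ_ (hF.extObj hD X)).hom = hF.extε hD ▷ hF.extObj hD X ≫
      hF.extμ hD (unitObj C) X ≫ hF.extMap hD (λ_ X).hom := by
  have extMap_proj : hF.extMap hD (λ_ X).hom ≫ hF.extProj hD X =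
      hF.extProj hD ((unitObj C).tensor X) ≫ F.map (λ_ X.A).hom := by
    rw [leftUnitor_hom]
    exact hF.extMap_ofHom_proj hD _ _
  rw [← cancel_mono (hF.extProj hD X)]
  simp only [Category.assoc]
  rw [extMap_proj, reassoc_of% (hF.extμ_proj hD (unitObj C) X), ← tensorHom_id,
    tensorHom_comp_tensorHom_assoc, hF.extε_proj, Category.id_comp, ← leftUnitor_naturality,
    left_unitality F, MonoidalCategory.tensorHom_def', Category.assoc]

theorem extμ_right_unitality (X : Completion C) :
    (ρ_ (hF.extObj hD X)).hom = hF.extObj hD X ◁ hF.extε hD ≫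
      hF.extμ hD X (unitObj C) ≫ hF.extMap hD (ρ_ X).hom := by
  have extMap_proj : hF.extMap hD (ρ_ X).hom ≫ hF.extProj hD X =
      hF.extProj hD (X.tensor (unitObj C)) ≫ F.map (ρ_ X.A).hom := by
    rw [rightUnitor_hom]
    exact hF.extMap_ofHom_proj hD _ _
  rw [← cancel_mono (hF.extProj hD X)]
  simp only [Category.assoc]
  rw [extMap_proj, reassoc_of% (hF.extμ_proj hD X (unitObj C)), ← id_tensorHom,
    tensorHom_comp_tensorHom_assoc, hF.extε_proj, Category.id_comp, ← rightUnitor_naturality,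
    right_unitality F, MonoidalCategory.tensorHom_def, Category.assoc]

noncomputable instance extensionLaxMonoidal : (hF.extension hD).LaxMonoidal where
  ε := hF.extε hD
  μ := hF.extμ hD
  μ_natural_left η Z := hF.extμ_natural_left hD η Z
  μ_natural_right Z η := hF.extμ_natural_right hD Z η
  associativity := hF.extμ_associativity hD
  left_unitality := hF.extμ_left_unitality hD
  right_unitality := hF.extμ_right_unitality hD

theorem exists_extension_idem_iso (L : LowerSet (ZI C)) :
    ∃ e : (hF.extension hD).obj (idem L).obj ≅ (hF.join hD L).obj,
      e.hom ≫ (hF.join hD L).counit ≫ ε (hF.extension hD) =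
        (hF.extension hD).map (idem L).counit := by
  have := hF.isIso_ε
  refine ⟨(whiskerRightIso (asIso (ε F)).symm _ ≪≫ λ_ _ :
    hF.extObj hD ⟨L, 𝟙_ C⟩ ≅ (hF.join hD L).obj), ?_⟩
  have counit_eq : (inv (ε F) ▷ (hF.join hD L).obj ≫ (λ_ _).hom) ≫ (hF.join hD L).counit ≫
      hF.extε hD = hF.extMap hD (incl le_top (𝟙_ C)) := by
    rw [← cancel_mono (hF.extProj hD (unitObj C)), hF.extMap_incl_proj]
    simp only [Category.assoc, hF.extε_proj]
    rw [← leftUnitor_naturality_assoc, ← whisker_exchange_assoc, unitors_equal,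
      rightUnitor_naturality_assoc, IsIso.inv_hom_id, Category.comp_id]
    rfl
  exact counit_eq

theorem preservesCentralIdempotents_extension :
    PreservesCentralIdempotents (hF.extension hD) := by
  refine .of_forall_exists_toZI_eq (hF.isIso_extε hD) fun u =>
    ⟨idem (lower u), toZI_idem_lower u, fun X => ?_, _, hF.exists_extension_idem_iso hD (lower u)⟩
  have : IsIso (μ F X.A (𝟙_ C)) := hF.isIso_μ X.A (.unit C)
  exact hF.isIso_extμ hD X ⟨lower u, 𝟙_ C⟩

theorem toZI_map_extension (u : CentralIdempotent (Completion C)) :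
    toZI ((hF.preservesCentralIdempotents_extension hD).map u) = toZI (hF.join hD (lower u)) := by
  obtain ⟨e, he⟩ := hF.exists_extension_idem_iso hD (lower u)
  have hP := hF.preservesCentralIdempotents_extension hD
  exact (hP.toZI_map_congr (toZI_idem_lower u)).symm.trans (toZI_map_eq _ _ _ e he)

theorem isJoinMorphism_extension : IsJoinMorphism (hF.extension hD) := by
  refine ⟨hF.preservesCentralIdempotents_extension hD, fun S j hj => ?_⟩
  simp only [hF.toZI_map_extension]
  refine ⟨?_, fun z hz => ?_⟩
  · rintro _ ⟨u, hu, rfl⟩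
    exact toZI_le_toZI.2 (hF.join_mono hD (lower_le_lower.2 (le_of_isLUB hj u hu)))
  · obtain ⟨w, rfl⟩ := toZI_surjective z
    refine toZI_le_toZI.2 (hF.join_le hD fun c hc => ?_)
    obtain ⟨u, hu, hcu⟩ := exists_mem_lower_of_isLUB hj hc
    exact (hF.map_le_join hD hcu).trans (toZI_le_toZI.1 (hz ⟨u, hu, rfl⟩))

/-- The projection `F A ⊗ J ⟶ F A`, where `J` is the join of all `F U`. -/
noncomputable def extProjIso (A : C) : hF.extObj hD ⟨⊤, A⟩ ≅ F.obj A :=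
  @asIso _ _ _ _ (hF.extProj hD ⟨⊤, A⟩) (hF.isIso_proj_join_top hD A)

/-- The extension restricts to `F`. -/
noncomputable def embeddingExtensionIso :
    embeddingFunctor ⋙ hF.extension hD ≅ F :=
  NatIso.ofComponents (hF.extProjIso hD) fun {A B} f =>
    hF.extMap_ofHom_proj hD (X := ⟨⊤, A⟩) (Y := ⟨⊤, B⟩) le_rfl f

instance : NatTrans.IsMonoidal (hF.embeddingExtensionIso hD).hom where
  unit := by
    have extMap_incl : hF.extMap hD (incl le_rfl (𝟙_ C)) ≫ hF.extProj hD ⟨⊤, 𝟙_ C⟩ =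
        hF.extProj hD ⟨⊤, 𝟙_ C⟩ := hF.extMap_incl_proj hD le_rfl (𝟙_ C)
    rw [comp_ε]
    exact (Category.assoc _ _ _).trans ((congrArg (hF.extε hD ≫ ·) extMap_incl).trans
      (hF.extε_proj hD))
  tensor A B := by
    have extMap_incl : hF.extMap hD (incl le_top (A ⊗ B)) ≫ hF.extProj hD ⟨⊤, A ⊗ B⟩ =
        hF.extProj hD (tensor ⟨⊤, A⟩ ⟨⊤, B⟩) := hF.extMap_incl_proj hD _ _
    rw [comp_μ]
    exact (Category.assoc _ _ _).trans ((congrArg (hF.extμ hD ⟨⊤, A⟩ ⟨⊤, B⟩ ≫ ·)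
      extMap_incl).trans (hF.extμ_proj hD ⟨⊤, A⟩ ⟨⊤, B⟩))

end PreservesCentralIdempotents

end Extension

/-! ### Strict extension along the embedding -/

section Transport

universe v₁ v₂ u₁ u₂

open Functor.LaxMonoidal

variable {C : Type u₁} [Category.{v₁} C] [MonoidalCategory C]
  {D : Type u₂} [Category.{v₂} D] [MonoidalCategory D]

/-- Transport of a lax monoidal structure along a natural isomorphism. -/
abbrev laxTransport {F G : C ⥤ D} [F.LaxMonoidal] (e : F ≅ G) : G.LaxMonoidal where
  ε := ε F ≫ e.hom.app _
  μ X Y := (e.inv.app X ⊗ₘ e.inv.app Y) ≫ μ F X Y ≫ e.hom.app (X ⊗ Y)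
  μ_natural_left f Z := by
    simp only [Category.assoc, ← e.hom.naturality, ← μ_natural_left_assoc]
    simp only [MonoidalCategory.tensorHom_def', Category.assoc, ← whisker_exchange_assoc,
      ← comp_whiskerRight_assoc, e.inv.naturality]
  μ_natural_right Z f := by
    simp only [Category.assoc, ← e.hom.naturality, ← μ_natural_right_assoc]
    simp only [MonoidalCategory.tensorHom_def, Category.assoc, whisker_exchange_assoc,
      ← MonoidalCategory.whiskerLeft_comp_assoc, e.inv.naturality]
  associativity X Y Z := by
    have left : ((e.inv.app X ⊗ₘ e.inv.app Y) ≫ μ F X Y ≫ e.hom.app (X ⊗ Y)) ▷ G.obj Z ≫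
        (e.inv.app (X ⊗ Y) ⊗ₘ e.inv.app Z) =
          ((e.inv.app X ⊗ₘ e.inv.app Y) ⊗ₘ e.inv.app Z) ≫ μ F X Y ▷ F.obj Z := by
      simp only [← tensorHom_id, tensorHom_comp_tensorHom, Category.assoc, Iso.hom_inv_id_app,
        Category.comp_id, Category.id_comp]
    have right : G.obj X ◁ ((e.inv.app Y ⊗ₘ e.inv.app Z) ≫ μ F Y Z ≫ e.hom.app (Y ⊗ Z)) ≫
        (e.inv.app X ⊗ₘ e.inv.app (Y ⊗ Z)) =
          (e.inv.app X ⊗ₘ e.inv.app Y ⊗ₘ e.inv.app Z) ≫ F.obj X ◁ μ F Y Z := by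
      simp only [← id_tensorHom, tensorHom_comp_tensorHom, Category.assoc, Iso.hom_inv_id_app,
        Category.comp_id, Category.id_comp]
    simp only [Category.assoc]
    rw [reassoc_of% left, reassoc_of% right, ← e.hom.naturality, associativity_assoc,
      associator_naturality_assoc]
  left_unitality X := by
    have unit : (ε F ≫ e.hom.app (𝟙_ C)) ▷ G.obj X ≫ (e.inv.app (𝟙_ C) ⊗ₘ e.inv.app X) =
        𝟙_ D ◁ e.inv.app X ≫ ε F ▷ F.obj X := by
      simp only [← tensorHom_id, ← id_tensorHom, tensorHom_comp_tensorHom, Category.assoc,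
        Iso.hom_inv_id_app, Category.comp_id, Category.id_comp]
    rw [Category.assoc, Category.assoc, reassoc_of% unit, ← e.hom.naturality,
      ← left_unitality_assoc, leftUnitor_naturality_assoc, Iso.inv_hom_id_app, Category.comp_id]
  right_unitality X := by
    have unit : G.obj X ◁ (ε F ≫ e.hom.app (𝟙_ C)) ≫ (e.inv.app X ⊗ₘ e.inv.app (𝟙_ C)) =
        e.inv.app X ▷ 𝟙_ D ≫ F.obj X ◁ ε F := by
      simp only [← tensorHom_id, ← id_tensorHom, tensorHom_comp_tensorHom, Category.assoc,
        Iso.hom_inv_id_app, Category.comp_id, Category.id_comp]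
    rw [Category.assoc, Category.assoc, reassoc_of% unit, ← e.hom.naturality,
      ← right_unitality_assoc, rightUnitor_naturality_assoc, Iso.inv_hom_id_app, Category.comp_id]

theorem isMonoidal_laxTransport {F G : C ⥤ D} [F.LaxMonoidal] (e : F ≅ G) :
    letI := laxTransport e
    NatTrans.IsMonoidal e.hom :=
  letI := laxTransport e
  { unit := rfl
    tensor X Y := by
      change _ = _ ≫ _ ≫ μ F X Y ≫ _
      rw [tensorHom_comp_tensorHom_assoc, Iso.hom_inv_id_app, Iso.hom_inv_id_app,
        id_tensorHom_id, Category.id_comp] }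

section Invariance

variable {F G : C ⥤ D} [F.LaxMonoidal] [G.LaxMonoidal]

theorem PreservesCentralIdempotents.map_le_of_natTrans (hF : PreservesCentralIdempotents F)
    (hG : PreservesCentralIdempotents G) (c : F ⟶ G) [NatTrans.IsMonoidal c]
    (u : CentralIdempotent C) : hF.map u ≤ hG.map u := by
  have := hF.isIso_ε
  have := hG.isIso_ε
  refine ⟨.mk' (c.app u.obj) ?_⟩
  have app_unit : c.app (𝟙_ C) ≫ inv (ε G) = inv (ε F) := by
    rw [IsIso.comp_inv_eq, IsIso.eq_inv_comp, NatTrans.IsMonoidal.unit]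
  have counit_eq : c.app u.obj ≫ G.map u.counit ≫ inv (ε G) = F.map u.counit ≫ inv (ε F) := by
    rw [← c.naturality_assoc, app_unit]
  exact counit_eq

variable (e : F ≅ G) [NatTrans.IsMonoidal e.hom]
include e

theorem PreservesCentralIdempotents.of_natIso (h : PreservesCentralIdempotents F) :
    PreservesCentralIdempotents G := by
  have unit := NatTrans.IsMonoidal.unit (τ := e.hom)
  have := h.isIso_ε
  have isIso_ε : IsIso (ε G) := by
    rw [← unit]
    infer_instance
  refine .of_iso isIso_ε (fun A u => ?_) fun u => ⟨h.map u, (e.app u.obj).symm, ?_⟩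
  · have := h.isIso_μ A u
    have : IsIso ((e.hom.app A ⊗ₘ e.hom.app u.obj) ≫ μ G A u.obj) := by
      rw [← NatTrans.IsMonoidal.tensor (τ := e.hom)]
      infer_instance
    exact (isIso_comp_left_iff _ _).1 this
  · have counit_eq : e.inv.app u.obj ≫ F.map u.counit ≫ inv (ε F) =
        G.map u.counit ≫ inv (ε G) := by
      rw [IsIso.eq_comp_inv, ← unit, Category.assoc, Category.assoc, IsIso.inv_hom_id_assoc,
        e.hom.naturality, Iso.inv_hom_id_app_assoc]
    exact counit_eq

theorem PreservesCentralIdempotents.toZI_map_of_natIso (hF : PreservesCentralIdempotents F)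
    (hG : PreservesCentralIdempotents G) (u : CentralIdempotent C) :
    toZI (hF.map u) = toZI (hG.map u) :=
  le_antisymm (toZI_le_toZI.2 (hF.map_le_of_natTrans hG e.hom u))
    (toZI_le_toZI.2 (hG.map_le_of_natTrans hF e.inv u))

theorem IsJoinMorphism.of_natIso (h : IsJoinMorphism F) : IsJoinMorphism G := by
  obtain ⟨h, preserves⟩ := h
  refine ⟨h.of_natIso e, fun S j hj => ?_⟩
  simpa only [h.toZI_map_of_natIso e (h.of_natIso e)] using preserves S j hj

end Invariance

/-- The natural isomorphism underlying an isomorphism of lax monoidal functors. -/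
def laxIsoNatIso {F G : LaxMonoidalFunctor C D} (e : F ≅ G) : F.toFunctor ≅ G.toFunctor where
  hom := e.hom.hom
  inv := e.inv.hom
  hom_inv_id := congrArg LaxMonoidalFunctor.Hom.hom e.hom_inv_id
  inv_hom_id := congrArg LaxMonoidalFunctor.Hom.hom e.inv_hom_id

instance {F G : LaxMonoidalFunctor C D} (e : F ≅ G) :
    NatTrans.IsMonoidal (laxIsoNatIso e).hom := e.hom.isMonoidal

theorem laxMonoidal_eq_of_isMonoidal_id {F : C ⥤ D} (l l' : F.LaxMonoidal)
    (h : @NatTrans.IsMonoidal _ _ _ _ _ _ F F (𝟙 F) l l') : l = l' := by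
  ext X Y
  · exact (Category.comp_id _).symm.trans h.unit
  · have tensor := h.tensor X Y
    rw [NatTrans.id_app, NatTrans.id_app, NatTrans.id_app, id_tensorHom_id] at tensor
    exact (Category.comp_id _).symm.trans (tensor.trans (Category.id_comp _))

theorem laxMonoidalFunctor_ext {F G : LaxMonoidalFunctor C D} (e : F ≅ G)
    (hobj : ∀ X, F.obj X = G.obj X) (h : ∀ X, e.hom.hom.app X = eqToHom (hobj X)) : F = G := by
  have toFunctor_eq : F.toFunctor = G.toFunctor := Functor.ext_of_iso (laxIsoNatIso e) hobj h
  have isMonoidal := e.hom.isMonoidal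
  revert h isMonoidal
  generalize e.hom.hom = t
  clear e
  obtain ⟨F, lF⟩ := F
  obtain ⟨G, lG⟩ := G
  obtain rfl : F = G := toFunctor_eq
  intro h isMonoidal
  obtain rfl : t = 𝟙 F := NatTrans.ext (funext h)
  exact congrArg _ (laxMonoidal_eq_of_isMonoidal_id lF lG isMonoidal)

/-- Replacing the values of a lax monoidal functor by isomorphic objects. -/
noncomputable def laxCopy (H : LaxMonoidalFunctor C D) (P : ∀ X, Σ Y : D, H.obj X ≅ Y) :
    LaxMonoidalFunctor C D :=
  @LaxMonoidalFunctor.of _ _ _ _ _ _ (H.toFunctor.copyObj (fun X => (P X).1) fun X => (P X).2)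
    (laxTransport (H.toFunctor.isoCopyObj (fun X => (P X).1) fun X => (P X).2))

/-- The comparison of a lax monoidal functor with its copy. -/
noncomputable def isoLaxCopy (H : LaxMonoidalFunctor C D) (P : ∀ X, Σ Y : D, H.obj X ≅ Y) :
    H ≅ laxCopy H P :=
  @LaxMonoidalFunctor.isoMk _ _ _ _ _ _ H (laxCopy H P)
    (H.toFunctor.isoCopyObj (fun X => (P X).1) fun X => (P X).2) (isMonoidal_laxTransport _)

end Transport

section Extension

universe v₁ v₂ u₁ u₂

variable {C : Type u₁} [Category.{v₁} C] [MonoidalCategory C]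
  {D : Type u₂} [Category.{v₂} D] [MonoidalCategory D]

namespace PreservesCentralIdempotents

variable [IsStiff D] {F : C ⥤ D} [F.LaxMonoidal] (hF : PreservesCentralIdempotents F)
  (hD : HasUniversalJoins D)

open scoped Classical in
/-- The value of the strict extension of `F`, which is `F A` on `⟨⊤, A⟩`, together with its
comparison with the value of the extension. -/
noncomputable def strictObj : ∀ X : Completion C, Σ Y : D, hF.extObj hD X ≅ Y
  | ⟨L, A⟩ => if h : L = ⊤ then ⟨F.obj A, h ▸ hF.extProjIso hD A⟩ else ⟨_, Iso.refl _⟩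

theorem strictObj_top (A : C) :
    hF.strictObj hD ⟨⊤, A⟩ = ⟨F.obj A, hF.extProjIso hD A⟩ := dif_pos rfl

theorem strictObj_inv_extProj (A : C) (h : (hF.strictObj hD ⟨⊤, A⟩).1 = F.obj A) :
    (hF.strictObj hD ⟨⊤, A⟩).2.inv ≫ hF.extProj hD ⟨⊤, A⟩ = eqToHom h := by
  have eq_top := hF.strictObj_top hD A
  revert h
  generalize hF.strictObj hD ⟨⊤, A⟩ = p at eq_top
  subst eq_top
  exact fun _ => (hF.extProjIso hD A).inv_hom_id

end PreservesCentralIdempotents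

variable [IsStiff C] [IsStiff D]

theorem exists_extension (hD : HasUniversalJoins D) (F : LaxMonoidalFunctor C D)
    (hF : PreservesCentralIdempotents F.toFunctor) :
    ∃ Fhat : LaxMonoidalFunctor (Completion C) D,
      IsJoinMorphism Fhat.toFunctor ∧ laxComp (embedding C) Fhat = F := by
  let H : LaxMonoidalFunctor (Completion C) D := .of (hF.extension hD)
  let copy : H ≅ laxCopy H (hF.strictObj hD) := isoLaxCopy H (hF.strictObj hD)
  let restrict : laxComp (embedding C) H ≅ F :=
    @LaxMonoidalFunctor.isoMk _ _ _ _ _ _ (laxComp (embedding C) H) F (hF.embeddingExtensionIso hD)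
      (inferInstanceAs (NatTrans.IsMonoidal (hF.embeddingExtensionIso hD).hom))
  refine ⟨laxCopy H (hF.strictObj hD),
    .of_natIso (F := H.toFunctor) (laxIsoNatIso copy) (hF.isJoinMorphism_extension hD),
    laxMonoidalFunctor_ext (laxCompIso (Iso.refl _) copy.symm ≪≫ restrict)
      (fun A => congrArg Sigma.fst (hF.strictObj_top hD A)) fun A => ?_⟩
  have app_eq : (hF.strictObj hD ⟨⊤, A⟩).2.inv ≫ H.map (𝟙 _) = (hF.strictObj hD ⟨⊤, A⟩).2.inv :=
    (congrArg _ (H.map_id _)).trans (Category.comp_id _)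
  exact (congrArg (· ≫ hF.extProj hD ⟨⊤, A⟩) app_eq).trans (hF.strictObj_inv_extProj hD A _)

end Extension

/-! ### Lifting natural transformations along the embedding -/

section Uniqueness

universe v₁ v₂ v₃ u₁ u₂ u₃

open Functor.LaxMonoidal

theorem PreservesCentralIdempotents.toZI_map_comp {C : Type u₁} [Category.{v₁} C]
    [MonoidalCategory C] {D : Type u₂} [Category.{v₂} D] [MonoidalCategory D]
    {E : Type u₃} [Category.{v₃} E] [MonoidalCategory E] {F : C ⥤ D} [F.LaxMonoidal]
    {G : D ⥤ E} [G.LaxMonoidal] (hF : PreservesCentralIdempotents F)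
    (hG : PreservesCentralIdempotents G) (u : CentralIdempotent C) :
    toZI ((hF.comp hG).map u) = toZI (hG.map (hF.map u)) := by
  have := hF.isIso_ε
  have := hG.isIso_ε
  exact PreservesCentralIdempotents.toZI_map_eq _ u _ (Iso.refl _)
    (by simp [PreservesCentralIdempotents.map])

variable {C : Type u₁} [Category.{v₁} C] [MonoidalCategory C] [IsStiff C]
  {D : Type u₂} [Category.{v₂} D] [MonoidalCategory D]

namespace Completion

theorem exists_iso_comp_proj_eq_toTop (X : Completion C) :
    ∃ e : X ≅ (⟨⊤, X.A⟩ : Completion C) ⊗ (idem X.D).obj,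
      e.hom ≫ proj (⟨⊤, X.A⟩ : Completion C) (idem X.D) = toTop X := by
  refine ⟨ofIso (X := X) (Y := ⟨⊤ ⊓ X.D, X.A⟩) (top_inf_eq _).symm (Iso.refl _) ≪≫
    (tensorIdemIso ⟨⊤, X.A⟩ X.D).symm, ?_⟩
  rw [proj_idem, Iso.trans_hom, Iso.symm_hom, Category.assoc, Iso.inv_hom_id_assoc]
  exact ofHom_comp_eq (h := (top_inf_eq X.D).ge) (Y := ⟨⊤ ⊓ X.D, X.A⟩) (Z := ⟨⊤, X.A⟩) _
    (Category.comp_id (𝟙 X.A))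

theorem tensorHom_toTop_comp_toTop (X Y : Completion C) :
    (toTop X ⊗ₘ toTop Y) ≫ toTop (tensor ⟨⊤, X.A⟩ ⟨⊤, Y.A⟩) = toTop (X.tensor Y) := by
  rw [MonoidalCategory.tensorHom_def, whiskerRight_ofHom, whiskerLeft_ofHom]
  have h : (𝟙 X.A ▷ Y.A ≫ X.A ◁ 𝟙 Y.A) ≫ 𝟙 (X.A ⊗ Y.A) = 𝟙 (X.A ⊗ Y.A) := by simp
  refine (congrArg (· ≫ _) (ofHom_comp_ofHom _ _ _ _)).trans ?_
  exact ofHom_comp_eq (X := X.tensor Y) (Z := ⟨⊤, X.A ⊗ Y.A⟩) _ h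

theorem isLUB_idem (L : LowerSet (ZI C)) :
    IsLUB (toZI '' (preservesCentralIdempotents_embedding (C := C)).image L) (toZI (idem L)) := by
  refine ⟨?_, fun z hz => ?_⟩
  · rintro _ ⟨_, ⟨a, ha, rfl⟩, rfl⟩
    rw [toZI_map_embedding]
    exact toZI_le_toZI.2 (idem_le_idem.2 (LowerSet.Iic_le.2 ha))
  · obtain ⟨w, rfl⟩ := toZI_surjective z
    refine toZI_le_toZI.2 (idem_le_iff.2 fun a ha => ?_)
    obtain ⟨a, rfl⟩ := toZI_surjective a
    rw [← toZI_le_toZI, ← toZI_map_embedding]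
    exact hz ⟨_, ⟨a, ha, rfl⟩, rfl⟩

section Functor

variable {G : Completion C ⥤ D} [G.LaxMonoidal] (h : PreservesCentralIdempotents G)
include h

theorem mono_map_toTop [IsStiff D] (X : Completion C) : Mono (G.map (toTop X)) := by
  obtain ⟨e, he⟩ := exists_iso_comp_proj_eq_toTop X
  have := h.mono_map_proj ⟨⊤, X.A⟩ (idem X.D)
  rw [← he, G.map_comp]
  infer_instance

theorem isIso_proj_map_idem (X : Completion C) :
    IsIso (proj (G.obj X) (h.map (idem X.D))) := by
  obtain ⟨e, -⟩ := exists_iso_comp_proj_eq_toTop X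
  have := isIso_proj_of_iso e (idem X.D)
  rw [← h.μIso_map_proj]
  infer_instance

theorem exists_comp_map_toTop_eq {X : Completion C} {Z : D} (f : Z ⟶ G.obj ⟨⊤, X.A⟩)
    (hf : RestrictsTo f (h.map (idem X.D))) : ∃ g : Z ⟶ G.obj X, g ≫ G.map (toTop X) = f := by
  obtain ⟨e, he⟩ := exists_iso_comp_proj_eq_toTop X
  obtain ⟨g, hg⟩ := hf
  refine ⟨g ≫ (h.μIso ⟨⊤, X.A⟩ (idem X.D)).hom ≫ G.map e.inv, ?_⟩
  rw [Category.assoc, Category.assoc, ← G.map_comp, ← he, Iso.inv_hom_id_assoc,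
    h.μIso_map_proj, hg]

theorem toZI_map_comp_embedding (a : CentralIdempotent C) :
    toZI ((preservesCentralIdempotents_embedding.comp h).map a) =
      toZI (h.map (idem (LowerSet.Iic (toZI a)))) :=
  (preservesCentralIdempotents_embedding.toZI_map_comp h a).trans
    (h.toZI_map_congr (toZI_map_embedding a))

theorem isLUB_map_idem (hj : h.PreservesJoins) (L : LowerSet (ZI C)) :
    IsLUB (toZI '' (preservesCentralIdempotents_embedding.comp h).image L)
      (toZI (h.map (idem L))) := by
  have isLUB := hj _ _ (isLUB_idem L)
  simpa only [PreservesCentralIdempotents.image, Set.image_image,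
    preservesCentralIdempotents_embedding.toZI_map_comp h] using isLUB

theorem map_hom_ext (hj : h.PreservesJoins) (hD : HasUniversalJoins D) {X : Completion C} {Y : D}
    {f g : G.obj X ⟶ Y}
    (H : ∀ (a : CentralIdempotent C), toZI a ∈ X.D →
      ∀ p : (⟨⊤, X.A ⊗ a.obj⟩ : Completion C) ⟶ X, p ≫ toTop X = topHom (proj X.A a) →
        G.map p ≫ f = G.map p ≫ g) : f = g := by
  have := isIso_proj_map_idem h X
  refine (hD.isUniversalJoin (PreservesCentralIdempotents.meetClosed_image_lowerSet _ X.D)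
    (isLUB_map_idem h hj X.D)).hom_ext_of_isIso_proj ?_
  rintro _ ⟨a, ha, rfl⟩
  obtain ⟨m⟩ := toZI_le_toZI.1 (toZI_map_comp_embedding h a).le
  obtain ⟨e, he⟩ := exists_iso_tensor_idem_Iic X a ha
  have eq_after := H a ha _ he
  rw [G.map_comp, Category.assoc, Category.assoc, cancel_epi] at eq_after
  rw [← whiskerLeft_hom_proj _ m, ← h.μIso_map_proj]
  simp only [Category.assoc, eq_after]

omit h in
theorem μ_map_toTop (G : Completion C ⥤ D) [G.LaxMonoidal] (X Y : Completion C) :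
    μ G X Y ≫ G.map (toTop (X.tensor Y)) = (G.map (toTop X) ⊗ₘ G.map (toTop Y)) ≫
      μ G ⟨⊤, X.A⟩ ⟨⊤, Y.A⟩ ≫ G.map (toTop (tensor ⟨⊤, X.A⟩ ⟨⊤, Y.A⟩)) := by
  rw [← tensorHom_toTop_comp_toTop]
  exact (congrArg (μ G X Y ≫ ·) (G.map_comp _ _)).trans
    (μ_natural_assoc G (toTop X) (toTop Y) _).symm

end Functor

section Lift

theorem natTrans_ext [IsStiff D] {G₁ G₂ : Completion C ⥤ D} [G₂.LaxMonoidal]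
    (h₂ : PreservesCentralIdempotents G₂) {s t : G₁ ⟶ G₂}
    (h : ∀ A : C, s.app ⟨⊤, A⟩ = t.app ⟨⊤, A⟩) : s = t := by
  ext X
  have := mono_map_toTop h₂ X
  rw [← cancel_mono (G₂.map (toTop X)), ← s.naturality, ← t.naturality, h]

variable {G₁ G₂ : Completion C ⥤ D} [G₁.LaxMonoidal] [G₂.LaxMonoidal]
  (h₁ : PreservesCentralIdempotents G₁) (hj : h₁.PreservesJoins)
  (h₂ : PreservesCentralIdempotents G₂) (c : embeddingFunctor (C := C) ⋙ G₁ ⟶ embeddingFunctor ⋙ G₂)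

include hj in
theorem map_idem_le_of_natTrans [NatTrans.IsMonoidal c] (L : LowerSet (ZI C)) :
    h₁.map (idem L) ≤ h₂.map (idem L) := by
  refine toZI_le_toZI.1 ((isLUB_map_idem h₁ hj L).2 ?_)
  rintro _ ⟨_, ⟨a, ha, rfl⟩, rfl⟩
  have le := (preservesCentralIdempotents_embedding.comp h₁).map_le_of_natTrans
    (preservesCentralIdempotents_embedding.comp h₂) c a
  refine (toZI_le_toZI.2 le).trans ((toZI_map_comp_embedding h₂ a).trans_le ?_)
  exact toZI_le_toZI.2 (h₂.map_mono (idem_le_idem.2 (LowerSet.Iic_le.2 ha)))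

variable [IsStiff D]

include h₁ hj h₂ in
theorem exists_comp_map_toTop_eq_app [NatTrans.IsMonoidal c] (X : Completion C) :
    ∃ g : G₁.obj X ⟶ G₂.obj X, g ≫ G₂.map (toTop X) = G₁.map (toTop X) ≫ c.app X.A := by
  have := isIso_proj_map_idem h₁ X
  have := isIso_proj_of_le (Z := G₁.obj X) (map_idem_le_of_natTrans h₁ hj h₂ c X.D)
  exact exists_comp_map_toTop_eq h₂ _ (restrictsTo_of_isIso_proj _ _)

section Components

variable {c : ∀ A : C, G₁.obj ⟨⊤, A⟩ ⟶ G₂.obj ⟨⊤, A⟩} {φ : ∀ X, G₁.obj X ⟶ G₂.obj X}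
  (hφ : ∀ X, φ X ≫ G₂.map (toTop X) = G₁.map (toTop X) ≫ c X.A)
include hφ

omit [MonoidalCategory D] [IsStiff D] [G₁.LaxMonoidal] [G₂.LaxMonoidal] in
theorem lift_app_top (A : C) : φ ⟨⊤, A⟩ = c A := by
  have map_toTop (G : Completion C ⥤ D) : G.map (toTop ⟨⊤, A⟩) = 𝟙 (G.obj ⟨⊤, A⟩) := G.map_id _
  have := hφ ⟨⊤, A⟩
  rwa [map_toTop, map_toTop, Category.comp_id, Category.id_comp] at this

include h₁ hj h₂ in
theorem lift_naturality (hD : HasUniversalJoins D)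
    (hc : ∀ (A B : C) (g : A ⟶ B), G₁.map (topHom g) ≫ c B = c A ≫ G₂.map (topHom g))
    {X Y : Completion C} (f : X ⟶ Y) : G₁.map f ≫ φ Y = φ X ≫ G₂.map f := by
  have mono := mono_map_toTop h₂
  rw [← cancel_mono (G₂.map (toTop Y)), Category.assoc, Category.assoc, hφ, ← G₂.map_comp,
    ← G₁.map_comp_assoc]
  refine map_hom_ext h₁ hj hD fun a ha p hp => ?_
  have app_eq := comp_eq_topHom_app (f ≫ toTop Y) a ha p hp
  have local_natural : G₁.map p ≫ φ X = c _ ≫ G₂.map p := by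
    rw [← cancel_mono (G₂.map (toTop X)), Category.assoc, Category.assoc, hφ, ← G₂.map_comp,
      ← G₁.map_comp_assoc, hp, hc]
  rw [← G₁.map_comp_assoc, app_eq, hc, reassoc_of% local_natural, ← G₂.map_comp, app_eq]

include h₂ in
theorem lift_μ (hc : ∀ A B : C,
      μ G₁ ⟨⊤, A⟩ ⟨⊤, B⟩ ≫ G₁.map (toTop (tensor ⟨⊤, A⟩ ⟨⊤, B⟩)) ≫ c (A ⊗ B) =
        (c A ⊗ₘ c B) ≫ μ G₂ ⟨⊤, A⟩ ⟨⊤, B⟩ ≫ G₂.map (toTop (tensor ⟨⊤, A⟩ ⟨⊤, B⟩)))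
    (X Y : Completion C) :
    μ G₁ X Y ≫ φ (X.tensor Y) = (φ X ⊗ₘ φ Y) ≫ μ G₂ X Y := by
  have mono := mono_map_toTop h₂ (X.tensor Y)
  rw [← cancel_mono (G₂.map (toTop (X.tensor Y)))]
  calc (μ G₁ X Y ≫ φ (X.tensor Y)) ≫ G₂.map (toTop (X.tensor Y))
    _ = (μ G₁ X Y ≫ G₁.map (toTop (X.tensor Y))) ≫ c (X.A ⊗ Y.A) := by
      rw [Category.assoc, Category.assoc, hφ]
    _ = (G₁.map (toTop X) ⊗ₘ G₁.map (toTop Y)) ≫ (c X.A ⊗ₘ c Y.A) ≫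
          μ G₂ ⟨⊤, X.A⟩ ⟨⊤, Y.A⟩ ≫ G₂.map (toTop (tensor ⟨⊤, X.A⟩ ⟨⊤, Y.A⟩)) := by
      rw [μ_map_toTop G₁ X Y, Category.assoc, Category.assoc, hc]
    _ = (φ X ⊗ₘ φ Y) ≫ (G₂.map (toTop X) ⊗ₘ G₂.map (toTop Y)) ≫
          μ G₂ ⟨⊤, X.A⟩ ⟨⊤, Y.A⟩ ≫ G₂.map (toTop (tensor ⟨⊤, X.A⟩ ⟨⊤, Y.A⟩)) := by
      rw [tensorHom_comp_tensorHom_assoc, tensorHom_comp_tensorHom_assoc, hφ, hφ]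
    _ = ((φ X ⊗ₘ φ Y) ≫ μ G₂ X Y) ≫ G₂.map (toTop (X.tensor Y)) := by
      rw [Category.assoc, μ_map_toTop G₂ X Y]

end Components

include h₁ hj h₂ in
theorem exists_lift [NatTrans.IsMonoidal c] (hD : HasUniversalJoins D) :
    ∃ t : G₁ ⟶ G₂, NatTrans.IsMonoidal t ∧ ∀ A : C, t.app ⟨⊤, A⟩ = c.app A := by
  choose φ hφ using exists_comp_map_toTop_eq_app h₁ hj h₂ c
  refine ⟨⟨φ, fun _ _ => lift_naturality h₁ hj h₂ hφ hD fun _ _ g => c.naturality g⟩,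
    ⟨?_, lift_μ h₂ hφ fun A B => ?_⟩, lift_app_top hφ⟩
  · have ε_comp (G : Completion C ⥤ D) [G.LaxMonoidal] : ε (embeddingFunctor ⋙ G) = ε G :=
      (congrArg (ε G ≫ ·) (G.map_id _)).trans (Category.comp_id _)
    have unit := NatTrans.IsMonoidal.unit (τ := c)
    rw [ε_comp, ε_comp] at unit
    exact (congrArg (ε G₁ ≫ ·) (lift_app_top hφ (𝟙_ C))).trans unit
  · exact (Category.assoc _ _ _).symm.trans (NatTrans.IsMonoidal.tensor (τ := c) A B)

end Lift

section LaxMonoidalFunctor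

variable [IsStiff D] {G₁ G₂ : LaxMonoidalFunctor (Completion C) D}

theorem laxMonoidalFunctor_hom_ext (h₂ : PreservesCentralIdempotents G₂.toFunctor) {s t : G₁ ⟶ G₂}
    (h : ∀ A : C, s.hom.app ((embedding C).obj A) = t.hom.app ((embedding C).obj A)) : s = t :=
  LaxMonoidalFunctor.hom_ext (natTrans_ext h₂ h)

theorem existsUnique_hom (hD : HasUniversalJoins D) (h₁ : IsJoinMorphism G₁.toFunctor)
    (h₂ : PreservesCentralIdempotents G₂.toFunctor)
    (γ : laxComp (embedding C) G₁ ⟶ laxComp (embedding C) G₂) :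
    ∃! φ : G₁ ⟶ G₂, ∀ A : C, φ.hom.app ((embedding C).obj A) = γ.hom.app A := by
  obtain ⟨h₁, hj⟩ := h₁
  have : NatTrans.IsMonoidal (F₁ := embeddingFunctor (C := C) ⋙ G₁.toFunctor)
    (F₂ := embeddingFunctor ⋙ G₂.toFunctor) γ.hom := γ.isMonoidal
  obtain ⟨t, ht, happ⟩ := exists_lift h₁ hj h₂ γ.hom hD
  exact ⟨⟨t, ht⟩, happ, fun φ hφ =>
    laxMonoidalFunctor_hom_ext h₂ fun A => (hφ A).trans (happ A).symm⟩

theorem existsUnique_iso (hD : HasUniversalJoins D) (h₁ : IsJoinMorphism G₁.toFunctor)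
    (h₂ : IsJoinMorphism G₂.toFunctor) (γ : laxComp (embedding C) G₁ ≅ laxComp (embedding C) G₂) :
    ∃! φ : G₁ ≅ G₂, ∀ A : C, φ.hom.hom.app ((embedding C).obj A) = γ.hom.hom.app A := by
  obtain ⟨s, hs, s_unique⟩ := existsUnique_hom hD h₁ h₂.choose γ.hom
  obtain ⟨t, ht, -⟩ := existsUnique_hom hD h₂ h₁.choose γ.inv
  refine ⟨⟨s, t, laxMonoidalFunctor_hom_ext h₁.choose fun A => ?_,
    laxMonoidalFunctor_hom_ext h₂.choose fun A => ?_⟩, hs, fun φ hφ => Iso.ext (s_unique _ hφ)⟩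
  · exact (congrArg₂ (· ≫ ·) (hs A) (ht A)).trans ((laxIsoNatIso γ).hom_inv_id_app A)
  · exact (congrArg₂ (· ≫ ·) (ht A) (hs A)).trans ((laxIsoNatIso γ).inv_hom_id_app A)

end LaxMonoidalFunctor

end Completion

end Uniqueness

/-! ### The left adjoint -/

namespace MonCatS

/-- The completion of a small stiff monoidal category, as an object of `MonCat_j`. -/
noncomputable abbrev completion (C : MonCatS.{u}) : MonCatJ.{u} :=
  { carrier := Completion C.carrier, isJ := inMonCatJ_completion C.carrier }

/-- The class of the embedding into the completion, the unit of the adjunction. -/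
noncomputable abbrev toCompletion (C : MonCatS.{u}) : C ⟶ forgetJS.obj C.completion :=
  MonCatS.homMk (D := C.completion.toS) (embedding C.carrier)
    Completion.preservesCentralIdempotents_embedding

theorem toCompletion_comp_bijective (C : MonCatS.{u}) (D : MonCatJ.{u}) :
    Function.Bijective fun f : C.completion ⟶ D => C.toCompletion ≫ forgetJS.map f := by
  have := D.isJ.stiff
  have hD := D.isJ.joins
  constructor
  · rintro ⟨F⟩ ⟨G⟩ h
    obtain ⟨γ⟩ := Quotient.exact h
    obtain ⟨φ, -⟩ := Completion.existsUnique_iso hD F.2 G.2 γ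
    exact Quotient.sound ⟨φ⟩
  · rintro ⟨F⟩
    obtain ⟨G, hG, h⟩ := exists_extension hD F.1 F.2
    exact ⟨Quotient.mk _ ⟨G, hG⟩, Quotient.sound ⟨eqToIso h⟩⟩

/-- Restriction along the embedding, as the hom-set bijection of the adjunction. -/
noncomputable def completionHomEquiv (C : MonCatS.{u}) (D : MonCatJ.{u}) :
    (C.completion ⟶ D) ≃ (C ⟶ forgetJS.obj D) :=
  Equiv.ofBijective _ (C.toCompletion_comp_bijective D)

theorem completionHomEquiv_comp (C : MonCatS.{u}) (D D' : MonCatJ.{u}) (g : D ⟶ D')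
    (f : C.completion ⟶ D) :
    completionHomEquiv C D' (f ≫ g) = completionHomEquiv C D f ≫ forgetJS.map g := by
  change C.toCompletion ≫ forgetJS.map (f ≫ g) = (C.toCompletion ≫ forgetJS.map f) ≫ forgetJS.map g
  rw [forgetJS.map_comp, Category.assoc]

/-- The functor from `MonCat_s` to `MonCat_j` with object part `completion`. -/
noncomputable def completionFunctor : MonCatS.{u} ⥤ MonCatJ.{u} :=
  Adjunction.leftAdjointOfEquiv completionHomEquiv completionHomEquiv_comp

/-- The completion is left adjoint to the forgetful functor. -/
noncomputable def completionAdjunction : completionFunctor ⊣ forgetJS.{u} :=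
  Adjunction.adjunctionOfEquivLeft completionHomEquiv completionHomEquiv_comp

theorem completionAdjunction_unit_app (C : MonCatS.{u}) :
    completionAdjunction.unit.app C = C.toCompletion :=
  (congrArg (C.toCompletion ≫ ·) (forgetJS.map_id C.completion)).trans (Category.comp_id _)

end MonCatS

end CentralIdem

universe v₁

open CentralIdem in
theorem mainTheorem4_general :
    (∀ (C : Type u) [Category.{v₁} C] [MonoidalCategory C] [IsStiff C],
      InMonCatJ (Completion C) ∧
      PreservesCentralIdempotents (embedding C).toFunctor ∧
      ∀ (D : Type v) [Category.{w} D] [MonoidalCategory D] [IsStiff D],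
        HasUniversalJoins D →
        (∀ F : LaxMonoidalFunctor C D, PreservesCentralIdempotents F.toFunctor →
          ∃ Fhat : LaxMonoidalFunctor (Completion C) D,
            IsJoinMorphism Fhat.toFunctor ∧ laxComp (embedding C) Fhat = F) ∧
        (∀ G₁ G₂ : LaxMonoidalFunctor (Completion C) D,
          IsJoinMorphism G₁.toFunctor → IsJoinMorphism G₂.toFunctor →
          ∀ γ : laxComp (embedding C) G₁ ≅ laxComp (embedding C) G₂,
            ∃! φ : G₁ ≅ G₂, ∀ A : C,
              φ.hom.hom.app ((embedding C).obj A) = γ.hom.hom.app A)) ∧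
    (∃ (hD : ∀ C : MonCatS.{u}, InMonCatJ (Completion C.carrier))
        (hE : ∀ C : MonCatS.{u},
          PreservesCentralIdempotents (embedding C.carrier).toFunctor)
        (L : MonCatS.{u} ⥤ MonCatJ.{u})
        (hL : ∀ C : MonCatS.{u},
          L.obj C = { carrier := Completion C.carrier, isJ := hD C })
        (adj : L ⊣ forgetJS.{u}),
      ∀ C : MonCatS.{u},
        adj.unit.app C ≫ forgetJS.map (eqToHom (hL C)) =
          MonCatS.homMk (D := MonCatJ.toS { carrier := Completion C.carrier, isJ := hD C })
            (embedding C.carrier) (hE C)) := by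
  refine ⟨fun C _ _ _ => ⟨inMonCatJ_completion C,
      Completion.preservesCentralIdempotents_embedding, fun D _ _ _ hD =>
        ⟨fun F hF => exists_extension hD F hF, fun _ _ h₁ h₂ γ =>
          Completion.existsUnique_iso hD h₁ h₂ γ⟩⟩,
    fun C => inMonCatJ_completion C.carrier,
    fun _ => Completion.preservesCentralIdempotents_embedding,
    MonCatS.completionFunctor, fun _ => rfl, MonCatS.completionAdjunction, fun C => ?_⟩
  refine (congrArg (_ ≫ ·) (forgetJS.map_id C.completion)).trans ((Category.comp_id _).trans ?_)
  exact MonCatS.completionAdjunction_unit_app C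

open CentralIdem in
theorem mainTheorem4 :
    (∀ (C : Type u) [SmallCategory C] [MonoidalCategory C] [IsStiff C],
      InMonCatJ (Completion C) ∧
      PreservesCentralIdempotents (embedding C).toFunctor ∧
      ∀ (D : Type v) [Category.{w} D] [MonoidalCategory D] [IsStiff D],
        HasUniversalJoins D →
        (∀ F : LaxMonoidalFunctor C D, PreservesCentralIdempotents F.toFunctor →
          ∃ Fhat : LaxMonoidalFunctor (Completion C) D,
            IsJoinMorphism Fhat.toFunctor ∧ laxComp (embedding C) Fhat = F) ∧
        (∀ G₁ G₂ : LaxMonoidalFunctor (Completion C) D,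
          IsJoinMorphism G₁.toFunctor → IsJoinMorphism G₂.toFunctor →
          ∀ γ : laxComp (embedding C) G₁ ≅ laxComp (embedding C) G₂,
            ∃! φ : G₁ ≅ G₂, ∀ A : C,
              φ.hom.hom.app ((embedding C).obj A) = γ.hom.hom.app A)) ∧
    (∃ (hD : ∀ C : MonCatS.{u}, InMonCatJ (Completion C.carrier))
        (hE : ∀ C : MonCatS.{u},
          PreservesCentralIdempotents (embedding C.carrier).toFunctor)
        (L : MonCatS.{u} ⥤ MonCatJ.{u})
        (hL : ∀ C : MonCatS.{u},
          L.obj C = { carrier := Completion C.carrier, isJ := hD C })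
        (adj : L ⊣ forgetJS.{u}),
      ∀ C : MonCatS.{u},
        adj.unit.app C ≫ forgetJS.map (eqToHom (hL C)) =
          MonCatS.homMk (D := MonCatJ.toS { carrier := Completion C.carrier, isJ := hD C })
            (embedding C.carrier) (hE C)) :=
  mainTheorem4_general
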